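/- Let $S^3\subset\mathbb{C}^2$ be the unit sphere with the CR structure and Riemannian metric induced from $\mathbb{C}^2$, on which the unitary group $U(2)$ acts by CR isometries. For a finite subgroup $G\subset U(2)$ acting freely on $S^3$, give $G\backslash S^3$ the CR structure and metric for which the projection $S^3\to G\backslash S^3$ is a local CR isometry, and let $\Box_b=\overline{\partial}_b^{\,*}\overline{\partial}_b$ be the Kohn Laplacian on functions, regarded as an unbounded operator on $L^2(G\backslash S^3)$ (the closure of $\Box_b$ on smooth functions). Its spectrum is the collection of its eigenvalues counted with multiplicity. Then the spectrum of $\Box_b$ on $L^2(G\backslash S^3)$ determines the isomorphism class of $G$: if $G,G'\subset U(2)$ are finite subgroups acting freely on $S^3$ such that, for every $\mu\in\mathbb{R}$, $$\dim\{u\in L^2(G\backslash S^3):\Box_b u=\mu u\}=\dim\{u\in L^2(G'\backslash S^3):\Box_b u=\mu u\},$$ then $G\cong G'$. -/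

import Mathlib

open MeasureTheory
open scoped Manifold ContDiff ComplexConjugate

noncomputable section

namespace KohnSphere

/-- `ℂ²` with its standard Hermitian norm. -/
abbrev C2 : Type := EuclideanSpace ℂ (Fin 2)

/-- The unit sphere `S³ ⊂ ℂ²`. -/
abbrev S3 : Type := Metric.sphere (0 : C2) 1

/-- The unitary group `U(2)`. -/
abbrev U2 : Type := Matrix.unitaryGroup (Fin 2) ℂ

instance finrank_C2 : Fact (Module.finrank ℝ C2 = 3 + 1) :=
  ⟨by
    rw [← Module.finrank_mul_finrank ℝ ℂ C2, Complex.finrank_real_complex,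
      finrank_euclideanSpace_fin]⟩

theorem norm_toEuclideanLin (g : U2) (z : C2) :
    ‖Matrix.toEuclideanLin (g : Matrix (Fin 2) (Fin 2) ℂ) z‖ = ‖z‖ := by
  have h : inner ℂ (Matrix.toEuclideanLin (g : Matrix (Fin 2) (Fin 2) ℂ) z)
      (Matrix.toEuclideanLin (g : Matrix (Fin 2) (Fin 2) ℂ) z) = inner ℂ z z := by
    rw [← LinearMap.adjoint_inner_left, ← Matrix.toEuclideanLin_conjTranspose_eq_adjoint,
      ← LinearMap.comp_apply]
    have h1 : (g : Matrix (Fin 2) (Fin 2) ℂ).conjTranspose * (g : Matrix (Fin 2) (Fin 2) ℂ) = 1 :=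
      (Matrix.mem_unitaryGroup_iff').1 g.2
    have h2 : (Matrix.toEuclideanLin (g : Matrix (Fin 2) (Fin 2) ℂ).conjTranspose ∘ₗ
        Matrix.toEuclideanLin (g : Matrix (Fin 2) (Fin 2) ℂ)) z = z := by
      rw [LinearMap.comp_apply, Matrix.toLpLin_apply, Matrix.toLpLin_apply, Matrix.mulVec_mulVec,
        h1, Matrix.one_mulVec]
    rw [h2]
  rw [@norm_eq_sqrt_re_inner ℂ, @norm_eq_sqrt_re_inner ℂ, h]

/-- `U(2)` acts on `S³` by matrix-vector multiplication. -/
instance : MulAction U2 S3 where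
  smul g z := ⟨Matrix.toEuclideanLin (g : Matrix (Fin 2) (Fin 2) ℂ) (z : C2), by
    rw [mem_sphere_zero_iff_norm, norm_toEuclideanLin, norm_eq_of_mem_sphere]⟩
  one_smul z := by
    apply Subtype.ext
    change Matrix.toEuclideanLin (1 : Matrix (Fin 2) (Fin 2) ℂ) (z : C2) = z
    rw [Matrix.toLpLin_apply, Matrix.one_mulVec]
  mul_smul g h z := by
    apply Subtype.ext
    change Matrix.toEuclideanLin
        ((g : Matrix (Fin 2) (Fin 2) ℂ) * (h : Matrix (Fin 2) (Fin 2) ℂ)) (z : C2) =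
      Matrix.toEuclideanLin (g : Matrix (Fin 2) (Fin 2) ℂ)
        (Matrix.toEuclideanLin (h : Matrix (Fin 2) (Fin 2) ℂ) (z : C2))
    rw [Matrix.toLpLin_apply, Matrix.toLpLin_apply, Matrix.toLpLin_apply, Matrix.mulVec_mulVec]

/-- A subgroup of `U(2)` acts freely on `S³`: only the identity has a fixed point. -/
def ActsFreely (G : Subgroup U2) : Prop :=
  ∀ g ∈ G, ∀ z : S3, g • z = z → g = 1

/-! ### The tangential Cauchy-Riemann operator on `S³` -/

/-- The extension of a function on `S³` to `ℂ² ∖ {0}` that is constant on rays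
(with value `0` at the origin). -/
def radialExt (f : S3 → ℂ) (x : C2) : ℂ :=
  if hx : x ≠ 0 then
    f ⟨(‖x‖⁻¹ : ℝ) • x, by
      rw [mem_sphere_zero_iff_norm, norm_smul, norm_inv, norm_norm,
        inv_mul_cancel₀ (norm_ne_zero_iff.2 hx)]⟩
  else 0

/-- The differential of `f` at `z ∈ S³` applied to a vector `v` tangent to `S³` at `z`. -/
def tangentDeriv (f : S3 → ℂ) (z : S3) (v : C2) : ℂ :=
  fderiv ℝ (radialExt f) (z : C2) v

/-- A unit vector spanning the complex tangent line
`H_z = {v ∈ ℂ² : ⟪z, v⟫ = 0} = T_z S³ ∩ i T_z S³`. -/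
def crFrame (z : S3) : C2 :=
  WithLp.toLp 2 ![-conj ((z : C2) 1), conj ((z : C2) 0)]

/-- `∂̄_b f` at `z`, as a form on the complex tangent line `H_z`: the conjugate-linear part of the
differential of `f` on `H_z`. -/
def dbarB (f : S3 → ℂ) (z : S3) (v : C2) : ℂ :=
  (1 / 2 : ℂ) * (tangentDeriv f z v + Complex.I * tangentDeriv f z (Complex.I • v))

/-- The pointwise Hermitian product `⟨∂̄_b f, ∂̄_b φ⟩` at `z` of the `(0,1)`-forms `∂̄_b f`, `∂̄_b φ`
for the metric induced from `ℂ² = ℝ⁴`; the vectors `e`, `i e` with `e = crFrame z` are an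
orthonormal basis of the real plane `H_z`. -/
def dbarBInner (f φ : S3 → ℂ) (z : S3) : ℂ :=
  dbarB f z (crFrame z) * conj (dbarB φ z (crFrame z)) +
    dbarB f z (Complex.I • crFrame z) * conj (dbarB φ z (Complex.I • crFrame z))

/-! ### The quotient `G \ S³` and its Kohn Laplacian -/

/-- The standard surface measure on `S³`. -/
def surface : Measure S3 := (volume : Measure C2).toSphere

/-- The quotient `G \ S³`. -/
abbrev Quot3 (G : Subgroup U2) : Type := MulAction.orbitRel.Quotient G S3

/-- The projection `π : S³ → G \ S³`. -/
def proj (G : Subgroup U2) (z : S3) : Quot3 G := Quotient.mk _ z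

/-- The volume measure of `G \ S³` for the metric induced from `S³`: since `π` is a Riemannian
covering with `|G|` sheets, it is the push-forward of the surface measure divided by `|G|`. -/
def quotMeasure (G : Subgroup U2) : Measure (Quot3 G) :=
  (Nat.card G : ENNReal)⁻¹ • surface.map (proj G)

/-- The Hilbert space `L²(G \ S³)`. -/
abbrev L2 (G : Subgroup U2) : Type := Lp ℂ 2 (quotMeasure G)

/-- Smooth complex functions on `G \ S³`. As `π` is a local diffeomorphism, `f` is smooth if and
only if `f ∘ π` is smooth on `S³`. -/
def IsSmooth {G : Subgroup U2} (f : Quot3 G → ℂ) : Prop :=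
  ContMDiff (𝓡 3) 𝓘(ℝ, ℂ) ∞ (fun z : S3 => f (proj G z))

/-- For smooth `f`, `h` on `G \ S³`: `h = □_b f`, where `□_b = ∂̄_b^* ∂̄_b` and `∂̄_b^*` is the formal
adjoint, i.e. `∫ h φ̄ = ∫ ⟨∂̄_b f, ∂̄_b φ⟩` for all smooth `φ` on `G \ S³`. The CR structure and the
metric of `G \ S³` are those for which `π` is a local CR isometry, so both integrals over `G \ S³`
are computed on `S³` (the common factor `1 / |G|` is left out). -/
def IsKohnLaplacianOf {G : Subgroup U2} (f h : Quot3 G → ℂ) : Prop :=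
  ∀ φ : Quot3 G → ℂ, IsSmooth φ →
    ∫ z, h (proj G z) * conj (φ (proj G z)) ∂surface =
      ∫ z, dbarBInner (fun w => f (proj G w)) (fun w => φ (proj G w)) z ∂surface

/-- The graph of the Kohn Laplacian `□_b`, as an unbounded operator on `L²(G \ S³)`: the closure
of its graph on smooth functions (these pairs already form a subspace, so that the span only
records the linear structure). -/
def kohnGraph (G : Subgroup U2) : Submodule ℂ (L2 G × L2 G) :=
  (Submodule.span ℂ {p : L2 G × L2 G | ∃ f h : Quot3 G → ℂ,
    IsSmooth f ∧ IsSmooth h ∧ IsKohnLaplacianOf f h ∧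
      p.1 =ᵐ[quotMeasure G] f ∧ p.2 =ᵐ[quotMeasure G] h}).topologicalClosure

/-- The eigenspace `{u ∈ Dom □_b : □_b u = μ u}`. -/
def kohnEigenspace (G : Subgroup U2) (μ : ℝ) : Submodule ℂ (L2 G) :=
  (kohnGraph G).comap (LinearMap.id.prod ((μ : ℂ) • LinearMap.id))

/-- The multiplicity of `μ` in the spectrum of `□_b` on `L²(G \ S³)`; it is `0` when `μ` is not an
eigenvalue. -/
def multiplicity (G : Subgroup U2) (μ : ℝ) : Cardinal :=
  Module.rank ℂ (kohnEigenspace G μ)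

/-- `G \ S³` and `G' \ S³` have the same spectrum of `□_b`, counted with multiplicity. (`□_b` is
nonnegative and self-adjoint and its eigenfunctions span a dense subspace.) -/
def Isospectral (G G' : Subgroup U2) : Prop :=
  ∀ μ : ℝ, multiplicity G μ = multiplicity G' μ

end KohnSphere

end

/-! Put J(z₀, z₁) = (-z̄₁, z̄₀) and w = Jz. The functions P(z, w) with P polynomial are dense on S³.
In the frame Jz the operator ∂̄_b acts on them as minus the derivation w ↦ z (`lower`), and its
conjugate as the derivation z ↦ w (`raise`), so □_b becomes twice `raise ∘ lower`. By the `sl₂`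
relations, `raise^q F` for a binary form F of degree n is an eigenfunction with eigenvalue 2q(n + 1
- q). The Capelli identity shows that these strings, multiplied by powers of z ∧ w, span all
polynomials, and z ∧ w = |z|² = 1 on the sphere. Since J(gz) = det(g)⁻¹ g Jz, the string descends to
G \ S³ when F ∘ g = det(g)^q F for all g in G. For m > 0 the equation q(n + 1 - q) = m leaves the
divisors q of m with n = m/q + q - 1, so the multiplicity of 2m is a finite sum of dimensions of
semi-invariants (`multiplicity_eq`).

Two asymptotic invariants follow from character sums. Summing the multiplicities over m ≤ X gives a
Weyl law whose leading term is inversely proportional to |G| (`card_eq_of_specMult_eq`). The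
multiplicities at m = 2l, for large primes l congruent to 1 modulo the number z of scalars in G,
grow at a rate that determines z up to confusing 2 with 4 when z is even
(`scalWeight_eq_of_specMult_eq`, `zc_eq_of_scalWeight_eq`).

Freeness means that in a common eigenbasis one eigenvalue determines the element. Hence commutative
groups, and centralizers of nonscalar elements, are cyclic. Commuting is transitive off the scalars,
so counting G by centralizers yields the equation 1/k₁ + 1/k₂ + 1/k₃ = 1 + 2/N of the finite
rotation groups, with N = |G|/z (`IsCA.exists_triple`): a noncommutative G is of dihedral or
polyhedral type. The same count computes dimensions of semi-invariants (`IsTriple.two_mul_finrank`),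
and the multiplicities at m = 2, 4, 6 then separate commutative from noncommutative groups, dihedral
from polyhedral type, and z = 2 from z = 4.

Finally, once the type, z and |G| are known, G has two noncommuting elements with prescribed
determinants and prescribed traces of both elements and of their product, which generate it together
with the scalars. Such a pair is unique up to conjugation in GL₂(ℂ) (`exists_conj`), so two groups
with the same data are conjugate there. -/

noncomputable section

namespace KohnSphere

/-! ### Polynomials in `z` and `w = J z` -/

/-- Polynomials in the coordinates `z` (indexed by `Sum.inl`) and `w` (indexed by `Sum.inr`). -/
abbrev PolyZW : Type := MvPolynomial (Fin 2 ⊕ Fin 2) ℂ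

open MvPolynomial in
/-- The derivation `z ↦ w`, `w ↦ 0`. -/
def raise : Derivation ℂ PolyZW PolyZW :=
  mkDerivation ℂ (Sum.elim (fun i => X (Sum.inr i)) (fun _ => 0))

open MvPolynomial in
/-- The derivation `w ↦ z`, `z ↦ 0`. -/
def lower : Derivation ℂ PolyZW PolyZW :=
  mkDerivation ℂ (Sum.elim (fun _ => 0) (fun i => X (Sum.inl i)))

open MvPolynomial in
/-- The derivation `z ↦ z`, `w ↦ -w`. -/
def weight : Derivation ℂ PolyZW PolyZW :=
  mkDerivation ℂ (Sum.elim (fun i => X (Sum.inl i)) (fun i => -X (Sum.inr i)))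

section Algebra

open MvPolynomial

@[simp] lemma raise_X_inl (i : Fin 2) : raise (X (Sum.inl i)) = X (Sum.inr i) := by
  simp [raise]
@[simp] lemma raise_X_inr (i : Fin 2) : raise (X (Sum.inr i)) = 0 := by
  simp [raise]
@[simp] lemma lower_X_inl (i : Fin 2) : lower (X (Sum.inl i)) = 0 := by
  simp [lower]
@[simp] lemma lower_X_inr (i : Fin 2) : lower (X (Sum.inr i)) = X (Sum.inl i) := by
  simp [lower]
@[simp] lemma weight_X_inl (i : Fin 2) : weight (X (Sum.inl i)) = X (Sum.inl i) := by
  simp [weight]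
@[simp] lemma weight_X_inr (i : Fin 2) : weight (X (Sum.inr i)) = -X (Sum.inr i) := by
  simp [weight]

/-- Commutators of derivations are derivations, so the `sl₂` relations need only be checked on the
variables. -/
lemma lower_raise (P : PolyZW) : lower (raise P) = raise (lower P) + weight P := by
  have h : ⁅lower, raise⁆ = weight := by
    apply MvPolynomial.derivation_ext
    rintro (i | i) <;> simp [Derivation.commutator_apply]
  rw [← h, Derivation.commutator_apply]
  ring

lemma weight_raise (P : PolyZW) : weight (raise P) = raise (weight P) - (2 : ℂ) • raise P := by
  have h : ⁅weight, raise⁆ = (-2 : ℂ) • raise := by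
    apply MvPolynomial.derivation_ext
    rintro (i | i)
    · simp only [Derivation.commutator_apply, Derivation.smul_apply, raise_X_inl, weight_X_inl,
        weight_X_inr]
      module
    · simp [Derivation.commutator_apply]
  have h2 := congrArg (fun D => D P) h
  simp only [Derivation.commutator_apply, Derivation.smul_apply] at h2
  rw [sub_eq_iff_eq_add] at h2
  rw [h2]
  module

/-- A binary form regarded as a polynomial in `z`. -/
def inZ : MvPolynomial (Fin 2) ℂ →ₐ[ℂ] PolyZW := rename Sum.inl

lemma lower_inZ (F : MvPolynomial (Fin 2) ℂ) : lower (inZ F) = 0 := by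
  induction F using MvPolynomial.induction_on with
  | C a => simp [inZ]
  | add p q hp hq => simp [hp, hq]
  | mul_X p i hp => rw [map_mul, Derivation.leibniz, hp]; simp [inZ]

/-- On polynomials in z alone `weight` is the Euler operator. -/
lemma weight_inZ {F : MvPolynomial (Fin 2) ℂ} {n : ℕ} (hF : F.IsHomogeneous n) :
    weight (inZ F) = (n : ℂ) • inZ F := by
  have h : ∀ F : MvPolynomial (Fin 2) ℂ, weight (inZ F) = inZ (∑ i, X i * pderiv i F) := by
    intro F
    induction F using MvPolynomial.induction_on with
    | C a => simp [inZ]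
    | add p q hp hq =>
      simp only [map_add, hp, hq, mul_add, Finset.sum_add_distrib]
    | mul_X p i hp =>
      rw [map_mul, Derivation.leibniz, hp]
      simp only [Derivation.leibniz, inZ, rename_X, weight_X_inl]
      fin_cases i <;> simp [Fin.sum_univ_two, pderiv_X] <;> ring
  rw [h, hF.sum_X_mul_pderiv]
  simp [← Nat.cast_smul_eq_nsmul ℂ]

lemma weight_raise_iter {F : MvPolynomial (Fin 2) ℂ} {n : ℕ} (hF : F.IsHomogeneous n) (q : ℕ) :
    weight (raise^[q] (inZ F)) = ((n : ℂ) - 2 * q) • raise^[q] (inZ F) := by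
  induction q with
  | zero => simp [weight_inZ hF]
  | succ q ih =>
    rw [Function.iterate_succ_apply', weight_raise, ih, Derivation.map_smul]
    push_cast
    module

/-- The `sl₂` relation on a string of a highest weight vector of weight `n`. -/
lemma lower_raise_iter {F : MvPolynomial (Fin 2) ℂ} {n : ℕ} (hF : F.IsHomogeneous n) (q : ℕ) :
    lower (raise^[q + 1] (inZ F)) = (((q : ℂ) + 1) * (n - q)) • raise^[q] (inZ F) := by
  induction q with
  | zero =>
    rw [Function.iterate_succ_apply', lower_raise]
    simp [lower_inZ, weight_inZ hF]
  | succ q ih =>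
    rw [Function.iterate_succ_apply', lower_raise, ih, weight_raise_iter hF, Derivation.map_smul,
      ← Function.iterate_succ_apply' raise, ← add_smul]
    congr 1
    push_cast
    ring

/-- The Kohn Laplacian acts on polynomial functions as twice `raise ∘ lower`, so the scalar found
here is half its eigenvalue on the string. -/
lemma raise_lower_raise_iter {F : MvPolynomial (Fin 2) ℂ} {n : ℕ} (hF : F.IsHomogeneous n)
    (q : ℕ) : raise (lower (raise^[q] (inZ F))) =
      ((q : ℂ) * (n + 1 - q)) • raise^[q] (inZ F) := by
  cases q with
  | zero => simp [lower_inZ]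
  | succ q =>
    rw [lower_raise_iter hF, Derivation.map_smul, ← Function.iterate_succ_apply' raise]
    congr 1
    push_cast
    ring

/-- The scalar is the product of the factors (j + 1)(n - j) with j < q, none of which vanishes
before the string ends at q = n. Thus F can be recovered from the vectors of its string. -/
lemma lower_iter_raise_iter {F : MvPolynomial (Fin 2) ℂ} {n : ℕ} (hF : F.IsHomogeneous n) (q : ℕ)
    (hq : q ≤ n) : ∃ c : ℂ, c ≠ 0 ∧ lower^[q] (raise^[q] (inZ F)) = c • inZ F := by
  induction q with
  | zero => exact ⟨1, one_ne_zero, by simp⟩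
  | succ q ih =>
    obtain ⟨c, hc, h⟩ := ih (by omega)
    refine ⟨((q : ℂ) + 1) * (n - q) * c, ?_, ?_⟩
    · refine mul_ne_zero (mul_ne_zero (by exact_mod_cast q.succ_ne_zero) ?_) hc
      rw [sub_ne_zero]
      exact_mod_cast (by omega : n ≠ q)
    · rw [Function.iterate_succ_apply, lower_raise_iter hF]
      have : ∀ (k : ℕ) (a : ℂ) (P : PolyZW), lower^[k] (a • P) = a • lower^[k] P := by
        intro k a P
        induction k with
        | zero => rfl
        | succ k ihk => rw [Function.iterate_succ_apply', ihk, Function.iterate_succ_apply',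
            Derivation.map_smul]
      rw [this, h, smul_smul]

lemma raise_eq_pderiv (P : PolyZW) : raise P =
    X (Sum.inr 0) * pderiv (Sum.inl 0) P + X (Sum.inr 1) * pderiv (Sum.inl 1) P := by
  induction P using MvPolynomial.induction_on with
  | C a => simp
  | add p q hp hq => simp only [map_add, hp, hq]; ring
  | mul_X p i hp =>
    rw [Derivation.leibniz, hp]
    rcases i with i | i <;> fin_cases i <;> simp [pderiv_X, Derivation.leibniz] <;> ring

lemma lower_eq_pderiv (P : PolyZW) : lower P =
    X (Sum.inl 0) * pderiv (Sum.inr 0) P + X (Sum.inl 1) * pderiv (Sum.inr 1) P := by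
  induction P using MvPolynomial.induction_on with
  | C a => simp
  | add p q hp hq => simp only [map_add, hp, hq]; ring
  | mul_X p i hp =>
    rw [Derivation.leibniz, hp]
    rcases i with i | i <;> fin_cases i <;> simp [pderiv_X, Derivation.leibniz] <;> ring

/-- The polynomial `z ∧ w`. -/
def wedge : PolyZW := X (Sum.inl 0) * X (Sum.inr 1) - X (Sum.inl 1) * X (Sum.inr 0)

/-- The Cayley operator. -/
def cayley (P : PolyZW) : PolyZW :=
  pderiv (Sum.inl 0) (pderiv (Sum.inr 1) P) - pderiv (Sum.inl 1) (pderiv (Sum.inr 0) P)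

/-- The Capelli identity. -/
lemma capelli (s : Fin 2 ⊕ Fin 2 →₀ ℕ) :
    raise (lower (monomial s (1 : ℂ))) + wedge * cayley (monomial s 1) =
      (((s (Sum.inr 0) : ℂ) + s (Sum.inr 1)) * (s (Sum.inl 0) + s (Sum.inl 1) + 1)) •
        monomial s (1 : ℂ) := by
  -- The left side is E_z E_w + E_w, where E_z and E_w are the Euler operators in z and in w; these
  -- are diagonal on monomials.
  have hw : ∀ P : PolyZW, raise (lower P) + wedge * cayley P =
      (X (Sum.inl 0) * pderiv (Sum.inl 0) (X (Sum.inr 0) * pderiv (Sum.inr 0) P +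
        X (Sum.inr 1) * pderiv (Sum.inr 1) P) +
      X (Sum.inl 1) * pderiv (Sum.inl 1) (X (Sum.inr 0) * pderiv (Sum.inr 0) P +
        X (Sum.inr 1) * pderiv (Sum.inr 1) P)) + (X (Sum.inr 0) * pderiv (Sum.inr 0) P +
        X (Sum.inr 1) * pderiv (Sum.inr 1) P) := by
    intro P
    rw [lower_eq_pderiv, raise_eq_pderiv, wedge, cayley]
    simp [Derivation.leibniz, pderiv_X]
    ring
  rw [hw]
  have hm : ∀ i, X i * pderiv i (monomial s (1 : ℂ)) = (s i : ℂ) • monomial s 1 := by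
    intro i
    rw [X_mul_pderiv_monomial, Nat.cast_smul_eq_nsmul]
  rw [hm, hm, map_add, map_add, Derivation.map_smul, Derivation.map_smul, Derivation.map_smul,
    Derivation.map_smul, mul_add, mul_add, mul_smul_comm, mul_smul_comm, mul_smul_comm,
    mul_smul_comm, hm, hm]
  module

/-- The span of the products of powers of `z ∧ w` with the strings of binary forms. -/
def stringSpan : Submodule ℂ PolyZW :=
  Submodule.span ℂ {P | ∃ (k q n : ℕ) (F : MvPolynomial (Fin 2) ℂ), F.IsHomogeneous n ∧
    P = wedge ^ k * raise^[q] (inZ F)}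

lemma raise_wedge : raise wedge = 0 := by
  simp [wedge, Derivation.leibniz]
  ring

lemma raise_mem_stringSpan {P : PolyZW} (hP : P ∈ stringSpan) : raise P ∈ stringSpan := by
  induction hP using Submodule.span_induction with
  | mem P h =>
    obtain ⟨k, q, n, F, hF, rfl⟩ := h
    apply Submodule.subset_span
    refine ⟨k, q + 1, n, F, hF, ?_⟩
    rw [Derivation.leibniz, Derivation.leibniz_pow, raise_wedge, Function.iterate_succ_apply']
    simp
  | zero => simp
  | add x y _ _ hx hy => rw [map_add]; exact add_mem hx hy
  | smul a x _ hx => rw [Derivation.map_smul]; exact Submodule.smul_mem _ _ hx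

lemma wedge_mul_mem_stringSpan {P : PolyZW} (hP : P ∈ stringSpan) :
    wedge * P ∈ stringSpan := by
  induction hP using Submodule.span_induction with
  | mem P h =>
    obtain ⟨k, q, n, F, hF, rfl⟩ := h
    apply Submodule.subset_span
    exact ⟨k + 1, q, n, F, hF, by ring⟩
  | zero => simp
  | add x y _ _ hx hy => rw [mul_add]; exact add_mem hx hy
  | smul a x _ hx => rw [mul_smul_comm]; exact Submodule.smul_mem _ _ hx

/-- The Capelli identity writes a nonzero multiple of a monomial of degree b > 0 in w through `raise
(lower _)` and `wedge * cayley _`. Both `lower` and `cayley` reduce the degree in w by one, so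
induction on b applies; for b = 0 the monomial is a binary form in z. -/
lemma monomial_mem_stringSpan (b : ℕ) : ∀ (s : Fin 2 ⊕ Fin 2 →₀ ℕ) (a : ℂ),
    s (Sum.inr 0) + s (Sum.inr 1) = b → monomial s a ∈ stringSpan := by
  induction b with
  | zero =>
    intro s a hs
    apply Submodule.subset_span
    refine ⟨0, 0, _, monomial (Finsupp.single 0 (s (Sum.inl 0)) + Finsupp.single 1 (s (Sum.inl 1))) a,
      isHomogeneous_monomial _ rfl, ?_⟩
    have h0 : s (Sum.inr 0) = 0 := by omega
    have h1 : s (Sum.inr 1) = 0 := by omega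
    simp only [pow_zero, one_mul, Function.iterate_zero, id, inZ, rename_monomial]
    congr 1
    refine congrArg _ (Finsupp.ext fun i => ?_)
    rw [Finsupp.mapDomain_add, Finsupp.mapDomain_single, Finsupp.mapDomain_single]
    rcases i with i | i <;> fin_cases i <;> simp [h0, h1]
  | succ b ih =>
    intro s a hs
    have hd : ∀ i j, pderiv (Sum.inl j) (pderiv (Sum.inr i) (monomial s (1 : ℂ))) ∈
        stringSpan := by
      intro i j
      rw [pderiv_monomial, pderiv_monomial]
      by_cases h : s (Sum.inr i) = 0
      · simp [h]
      · apply ih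
        fin_cases i <;> fin_cases j <;> simp at h ⊢ <;> omega
    have hl : lower (monomial s (1 : ℂ)) ∈ stringSpan := by
      rw [lower_eq_pderiv]
      have : ∀ i, X (Sum.inl i) * pderiv (Sum.inr i) (monomial s (1 : ℂ)) ∈ stringSpan := by
        intro i
        rw [pderiv_monomial, X, monomial_mul]
        by_cases h : s (Sum.inr i) = 0
        · simp [h]
        · apply ih
          fin_cases i <;> simp at h ⊢ <;> omega
      exact add_mem (this 0) (this 1)
    have hc : cayley (monomial s (1 : ℂ)) ∈ stringSpan := sub_mem (hd 1 0) (hd 0 1)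
    have h := add_mem (raise_mem_stringSpan hl) (wedge_mul_mem_stringSpan hc)
    rw [capelli] at h
    have hne : ((s (Sum.inr 0) : ℂ) + s (Sum.inr 1)) * (s (Sum.inl 0) + s (Sum.inl 1) + 1) ≠ 0 := by
      apply mul_ne_zero
      · have : s (Sum.inr 0) + s (Sum.inr 1) ≠ 0 := by omega
        exact_mod_cast this
      · exact_mod_cast Nat.succ_ne_zero (s (Sum.inl 0) + s (Sum.inl 1))
    have h2 := Submodule.smul_mem _ a ((Submodule.smul_mem_iff _ hne).1 h)
    rwa [smul_monomial, smul_eq_mul, mul_one] at h2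

lemma stringSpan_eq_top : stringSpan = ⊤ := by
  rw [eq_top_iff]
  intro P _
  rw [P.as_sum]
  exact sum_mem fun s _ => monomial_mem_stringSpan _ s _ rfl

/-! ### Substitution of a matrix -/

/-- The binary form `F ∘ g`. -/
def formComp (g : Matrix (Fin 2) (Fin 2) ℂ) :
    MvPolynomial (Fin 2) ℂ →ₐ[ℂ] MvPolynomial (Fin 2) ℂ :=
  aeval fun i => ∑ j, C (g i j) * X j

/-- The substitution `z ↦ g z`, `w ↦ d g w`. -/
def polyComp (g : Matrix (Fin 2) (Fin 2) ℂ) (d : ℂ) : PolyZW →ₐ[ℂ] PolyZW :=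
  aeval (Sum.elim (fun i => ∑ j, C (g i j) * X (Sum.inl j))
    (fun i => C d * ∑ j, C (g i j) * X (Sum.inr j)))

lemma polyComp_inZ (g : Matrix (Fin 2) (Fin 2) ℂ) (d : ℂ) (F : MvPolynomial (Fin 2) ℂ) :
    polyComp g d (inZ F) = inZ (formComp g F) := by
  have : (polyComp g d).comp inZ = inZ.comp (formComp g) := by
    apply MvPolynomial.algHom_ext
    intro i
    simp [polyComp, inZ, formComp]
  exact DFunLike.congr_fun this F

/-- `raise` trades one z for one w, and only w carries the factor d. -/
lemma raise_polyComp (g : Matrix (Fin 2) (Fin 2) ℂ) {d : ℂ} (hd : d ≠ 0) (P : PolyZW) :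
    raise (polyComp g d P) = d⁻¹ • polyComp g d (raise P) := by
  induction P using MvPolynomial.induction_on with
  | C a => simp [polyComp]
  | add p q hp hq => simp only [map_add, hp, hq, smul_add]
  | mul_X p i hp =>
    have hX : raise (polyComp g d (X i)) = d⁻¹ • polyComp g d (raise (X i)) := by
      rcases i with i | i
      · simp [polyComp, Derivation.leibniz, ← C_mul', ← mul_assoc, ← C_mul, inv_mul_cancel₀ hd]
      · simp [polyComp, Derivation.leibniz]
    rw [map_mul, Derivation.leibniz, Derivation.leibniz, hp, hX, map_add]
    simp only [smul_eq_mul, map_mul, mul_smul_comm, smul_add]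

lemma raise_iter_polyComp (g : Matrix (Fin 2) (Fin 2) ℂ) {d : ℂ} (hd : d ≠ 0) (q : ℕ)
    (P : PolyZW) : raise^[q] (polyComp g d P) = (d⁻¹) ^ q • polyComp g d (raise^[q] P) := by
  induction q with
  | zero => simp
  | succ q ih =>
    rw [Function.iterate_succ_apply', ih, Derivation.map_smul, raise_polyComp g hd, smul_smul,
      Function.iterate_succ_apply', pow_succ]

lemma formComp_isHomogeneous (g : Matrix (Fin 2) (Fin 2) ℂ) {F : MvPolynomial (Fin 2) ℂ} {n : ℕ}
    (hF : F.IsHomogeneous n) : (formComp g F).IsHomogeneous n := by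
  have h := hF.aeval (fun i => ∑ j, C (g i j) * X j) (n := 1) (by
    intro i
    apply IsHomogeneous.sum
    intro j _
    simpa using (isHomogeneous_C (Fin 2) (g i j)).mul (isHomogeneous_X ℂ j))
  simpa [formComp] using h

lemma eval_formComp (g : Matrix (Fin 2) (Fin 2) ℂ) (F : MvPolynomial (Fin 2) ℂ) (x : Fin 2 → ℂ) :
    eval x (formComp g F) = eval (g.mulVec x) F := by
  have : ((aeval x : MvPolynomial (Fin 2) ℂ →ₐ[ℂ] ℂ)).comp (formComp g) = aeval (g.mulVec x) := by
    apply MvPolynomial.algHom_ext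
    intro i
    fin_cases i <;> simp [formComp]
  have h := DFunLike.congr_fun this F
  simpa [aeval_eq_eval] using h

lemma formComp_mul (g h : Matrix (Fin 2) (Fin 2) ℂ) (F : MvPolynomial (Fin 2) ℂ) :
    formComp (g * h) F = formComp h (formComp g F) := by
  apply MvPolynomial.funext
  intro x
  rw [eval_formComp, eval_formComp, eval_formComp, Matrix.mulVec_mulVec]

lemma formComp_one (F : MvPolynomial (Fin 2) ℂ) : formComp 1 F = F := by
  apply MvPolynomial.funext
  intro x
  rw [eval_formComp, Matrix.one_mulVec]

/-- Binary forms of degree `n` with `F ∘ g = det(g)^q F` for all `g ∈ G`. -/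
def semiInv (G : Subgroup U2) (n q : ℕ) : Submodule ℂ (MvPolynomial (Fin 2) ℂ) where
  carrier := {F | F.IsHomogeneous n ∧ ∀ g ∈ G, formComp (g : Matrix (Fin 2) (Fin 2) ℂ) F =
    (g : Matrix (Fin 2) (Fin 2) ℂ).det ^ q • F}
  add_mem' := by
    rintro a b ⟨ha, ha'⟩ ⟨hb, hb'⟩
    exact ⟨ha.add hb, fun g hg => by rw [map_add, ha' g hg, hb' g hg, smul_add]⟩
  zero_mem' := ⟨isHomogeneous_zero _ _ _, by simp⟩
  smul_mem' := by
    rintro c a ⟨ha, ha'⟩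
    refine ⟨(homogeneousSubmodule (Fin 2) ℂ n).smul_mem c ha, fun g hg => ?_⟩
    rw [map_smul, ha' g hg, smul_comm]

end Algebra

/-! ### Real isometries of the sphere -/

instance : IsFiniteMeasure surface := by unfold surface; infer_instance

instance : surface.IsOpenPosMeasure := by unfold surface; infer_instance

/-- The map of `S³` induced by a real linear isometry of `ℂ²`. -/
def sphereMap (U : C2 →ₗᵢ[ℝ] C2) (z : S3) : S3 :=
  ⟨U z, by rw [mem_sphere_zero_iff_norm, U.norm_map, norm_eq_of_mem_sphere]⟩

lemma continuous_sphereMap (U : C2 →ₗᵢ[ℝ] C2) : Continuous (sphereMap U) :=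
  (U.continuous.comp continuous_subtype_val).subtype_mk _

-- The surface measure of a set is a multiple of the volume of the cone over it, and a linear
-- isometry preserves volume and carries cones to cones.
open scoped Pointwise in
lemma measurePreserving_sphereMap (U : C2 →ₗᵢ[ℝ] C2) :
    MeasurePreserving (sphereMap U) surface surface := by
  refine ⟨(continuous_sphereMap U).measurable, ?_⟩
  ext s hs
  rw [Measure.map_apply (continuous_sphereMap U).measurable hs, surface,
    Measure.toSphere_apply' _ hs,
    Measure.toSphere_apply' _ ((continuous_sphereMap U).measurable hs)]
  congr 1
  let V : C2 ≃ₗᵢ[ℝ] C2 := U.toLinearIsometryEquiv rfl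
  have hV : ∀ x, V x = U x := fun x => rfl
  have hpre : (Set.Ioo (0 : ℝ) 1 • (Subtype.val '' (sphereMap U ⁻¹' s)) : Set C2) =
      V ⁻¹' (Set.Ioo (0 : ℝ) 1 • (Subtype.val '' s)) := by
    ext x
    simp only [Set.mem_smul, Set.mem_preimage, Set.mem_image]
    constructor
    · rintro ⟨r, hr, _, ⟨y, hy, rfl⟩, rfl⟩
      exact ⟨r, hr, _, ⟨_, hy, rfl⟩, by rw [map_smul, hV]; rfl⟩
    · rintro ⟨r, hr, _, ⟨y, hy, rfl⟩, hx⟩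
      have hy' : V.symm (y : C2) ∈ Metric.sphere (0 : C2) 1 := by
        rw [mem_sphere_zero_iff_norm, V.symm.norm_map, norm_eq_of_mem_sphere]
      refine ⟨r, hr, V.symm y, ⟨⟨V.symm y, hy'⟩, ?_, rfl⟩, ?_⟩
      · have : sphereMap U ⟨V.symm y, hy'⟩ = y := by
          apply Subtype.ext
          change V (V.symm y) = y
          simp
        rw [this]
        exact hy
      · rw [← map_smul, hx]; simp
  rw [hpre]
  exact V.measurePreserving.measure_preimage_emb
    V.toHomeomorph.measurableEmbedding _

lemma integral_comp_sphereMap (U : C2 →ₗᵢ[ℝ] C2) {f : S3 → ℂ} (hf : Continuous f) :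
    ∫ z, f (sphereMap U z) ∂surface = ∫ z, f z ∂surface := by
  have h := measurePreserving_sphereMap U
  conv_rhs => rw [← h.map_eq]
  rw [integral_map h.measurable.aemeasurable hf.aestronglyMeasurable]

/-- The action of an element of `U(2)` as a real linear isometry. -/
def isoOfU2 (g : U2) : C2 →ₗᵢ[ℝ] C2 where
  toLinearMap := (Matrix.toEuclideanLin (g : Matrix (Fin 2) (Fin 2) ℂ)).restrictScalars ℝ
  norm_map' := norm_toEuclideanLin g

lemma sphereMap_isoOfU2 (g : U2) (z : S3) : sphereMap (isoOfU2 g) z = g • z := rfl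

/-- The real structure `J (z₀, z₁) = (-z̄₁, z̄₀)`. -/
def crJ (x : C2) : C2 := WithLp.toLp 2 ![-conj (x 1), conj (x 0)]

@[simp] lemma crJ_zero (x : C2) : crJ x 0 = -conj (x 1) := rfl
@[simp] lemma crJ_one (x : C2) : crJ x 1 = conj (x 0) := rfl

lemma crFrame_eq (z : S3) : crFrame z = crJ z := rfl

lemma norm_sq_C2 (x : C2) : ‖x‖ ^ 2 = Complex.normSq (x 0) + Complex.normSq (x 1) := by
  rw [EuclideanSpace.norm_sq_eq, Fin.sum_univ_two, Complex.sq_norm, Complex.sq_norm]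

/-- The one-parameter group of rotations generated by `x ↦ c J x`. -/
def rotIso (c : ℂ) (hc : Complex.normSq c = 1) (t : ℝ) : C2 →ₗᵢ[ℝ] C2 where
  toFun x := Real.cos t • x + Real.sin t • (c • crJ x)
  map_add' x y := by
    ext i
    fin_cases i <;> simp <;> ring
  map_smul' r x := by
    ext i
    fin_cases i <;> simp <;> ring
  norm_map' x := by
    rw [← sq_eq_sq₀ (norm_nonneg _) (norm_nonneg _), norm_sq_C2, norm_sq_C2]
    have h1 := Real.cos_sq_add_sin_sq t
    simp [Complex.normSq_apply, -Complex.ofReal_cos, -Complex.ofReal_sin] at hc ⊢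
    linear_combination ((x 0).re ^ 2 + (x 0).im ^ 2 + (x 1).re ^ 2 + (x 1).im ^ 2) *
      (h1 + Real.sin t ^ 2 * hc)

lemma rotIso_apply (c : ℂ) (hc : Complex.normSq c = 1) (t : ℝ) (x : C2) :
    rotIso c hc t x = Real.cos t • x + Real.sin t • (c • crJ x) := rfl

/-- J is conjugate-linear with J² = -1, so x ↦ cJx squares to -1 when |c| = 1, and the rotation is
its exponential. -/
lemma smul_crJ_rotIso (c : ℂ) (hc : Complex.normSq c = 1) (t : ℝ) (x : C2) :
    c • crJ (rotIso c hc t x) = (-Real.sin t) • x + Real.cos t • (c • crJ x) := by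
  have hc' : c * conj c = 1 := by rw [Complex.mul_conj, hc]; simp
  rw [rotIso_apply]
  ext i
  fin_cases i <;> simp [-Complex.ofReal_cos, -Complex.ofReal_sin]
  · linear_combination (-(Real.sin t : ℂ) * x 0) * hc'
  · linear_combination (-(Real.sin t : ℂ) * x 1) * hc'

lemma hasDerivAt_rotIso (c : ℂ) (hc : Complex.normSq c = 1) (t : ℝ) (x : C2) :
    HasDerivAt (fun s => rotIso c hc s x) (c • crJ (rotIso c hc t x)) t := by
  rw [smul_crJ_rotIso]
  exact ((Real.hasDerivAt_cos t).smul_const x).add ((Real.hasDerivAt_sin t).smul_const (c • crJ x))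

lemma rotIso_zero (c : ℂ) (hc : Complex.normSq c = 1) (x : C2) : rotIso c hc 0 x = x := by
  simp [rotIso_apply]

/-! ### Smooth functions on the sphere -/

/-- Smooth complex functions on `S³`. -/
def Smooth (f : S3 → ℂ) : Prop := ContMDiff (𝓡 3) 𝓘(ℝ, ℂ) ∞ f

lemma Smooth.continuous {f : S3 → ℂ} (hf : Smooth f) : Continuous f := ContMDiff.continuous hf

lemma Smooth.mul {f g : S3 → ℂ} (hf : Smooth f) (hg : Smooth g) : Smooth fun z => f z * g z :=
  have h : ContDiff ℝ ∞ fun p : ℂ × ℂ => p.1 * p.2 := by fun_prop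
  h.contMDiff.comp (ContMDiff.prodMk_space hf hg)

lemma Smooth.conj {f : S3 → ℂ} (hf : Smooth f) : Smooth fun z => conj (f z) :=
  have h : ContDiff ℝ ∞ fun p : ℂ => Complex.conjCLE p := Complex.conjCLE.contDiff
  h.contMDiff.comp hf

lemma smooth_of_contDiff {F : C2 → ℂ} (hF : ContDiff ℝ ∞ F) : Smooth fun z => F z :=
  hF.contMDiff.comp contMDiff_coe_sphere

lemma radialExt_coe (f : S3 → ℂ) (z : S3) : radialExt f z = f z := by
  have hz : (z : C2) ≠ 0 := ne_zero_of_mem_unit_sphere z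
  have hn : ‖(z : C2)‖ = 1 := norm_eq_of_mem_sphere z
  rw [radialExt, dif_pos hz]
  congr 1
  apply Subtype.ext
  simp [hn]

lemma contDiffOn_radialExt {f : S3 → ℂ} (hf : Smooth f) :
    ContDiffOn ℝ ∞ (radialExt f) {0}ᶜ := by
  let U : TopologicalSpace.Opens C2 := ⟨{0}ᶜ, isOpen_compl_singleton⟩
  intro x hx
  apply ContDiffAt.contDiffWithinAt
  rw [← contMDiffAt_iff_contDiffAt]
  let ν : U → C2 := fun y => ‖(y : C2)‖⁻¹ • (y : C2)
  have hν' : ∀ y, ν y ∈ Metric.sphere (0 : C2) 1 := by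
    intro y
    rw [mem_sphere_zero_iff_norm, norm_smul, norm_inv, norm_norm,
        inv_mul_cancel₀ (norm_ne_zero_iff.2 y.2)]
  have hν : ContMDiff 𝓘(ℝ, C2) 𝓘(ℝ, C2) ∞ ν := by
    intro y
    have hy : (y : C2) ≠ 0 := y.2
    have h1 : ContDiffAt ℝ ∞ (fun x : C2 => ‖x‖⁻¹ • x) y :=
      ((contDiffAt_norm ℝ hy).inv (norm_ne_zero_iff.2 hy)).smul contDiffAt_id
    exact h1.contMDiffAt.comp y contMDiff_subtype_val.contMDiffAt
  have h2 := hf.comp (hν.codRestrict_sphere hν')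
  have h3 := h2.contMDiffAt (x := (⟨x, hx⟩ : U))
  have h4 : (f ∘ Set.codRestrict ν _ hν') = fun y : U => radialExt f (y : C2) := by
    ext y
    have hy : (y : C2) ≠ 0 := y.2
    rw [radialExt, dif_pos hy]
    rfl
  rw [h4] at h3
  exact contMDiffAt_subtype_iff.1 h3

lemma differentiableAt_radialExt {f : S3 → ℂ} (hf : Smooth f) (z : S3) :
    DifferentiableAt ℝ (radialExt f) z :=
  ((contDiffOn_radialExt hf).contDiffAt
    (isOpen_compl_singleton.mem_nhds (ne_zero_of_mem_unit_sphere z))).differentiableAt (by simp)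

lemma Smooth.hasDerivAt_comp {f : S3 → ℂ} (hf : Smooth f) {γ : ℝ → S3} {t : ℝ} {v : C2}
    (hγ : HasDerivAt (fun s => (γ s : C2)) v t) :
    HasDerivAt (fun s => f (γ s)) (tangentDeriv f (γ t) v) t := by
  have h := (differentiableAt_radialExt hf (γ t)).hasFDerivAt.comp_hasDerivAt t hγ
  have h2 : (radialExt f ∘ fun s => (γ s : C2)) = fun s => f (γ s) := by
    ext s
    exact radialExt_coe f (γ s)
  rwa [h2] at h

lemma hasDerivAt_rot (c : ℂ) (hc : Complex.normSq c = 1) (t : ℝ) (z : S3) :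
    HasDerivAt (fun s => (sphereMap (rotIso c hc s) z : C2))
      (c • crFrame (sphereMap (rotIso c hc t) z)) t :=
  hasDerivAt_rotIso c hc t z

lemma rot_zero (c : ℂ) (hc : Complex.normSq c = 1) (z : S3) :
    sphereMap (rotIso c hc 0) z = z :=
  Subtype.ext (rotIso_zero c hc z)

/-- The tangential derivative along `c J z` is the derivative along the rotation. -/
lemma Smooth.hasDerivAt_rot {f : S3 → ℂ} (hf : Smooth f) (c : ℂ) (hc : Complex.normSq c = 1)
    (z : S3) (t : ℝ) :
    HasDerivAt (fun s => f (sphereMap (rotIso c hc s) z))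
      (tangentDeriv f (sphereMap (rotIso c hc t) z) (c • crFrame (sphereMap (rotIso c hc t) z)))
      t :=
  hf.hasDerivAt_comp (KohnSphere.hasDerivAt_rot c hc t z)

lemma Smooth.hasDerivAt_rot_zero {f : S3 → ℂ} (hf : Smooth f) (c : ℂ) (hc : Complex.normSq c = 1)
    (z : S3) :
    HasDerivAt (fun s => f (sphereMap (rotIso c hc s) z)) (tangentDeriv f z (c • crFrame z)) 0 := by
  have h := hf.hasDerivAt_rot c hc z 0
  rwa [rot_zero] at h

lemma tangentDeriv_mul {f g : S3 → ℂ} (hf : Smooth f) (hg : Smooth g) (c : ℂ)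
    (hc : Complex.normSq c = 1) (z : S3) :
    tangentDeriv (fun z => f z * g z) z (c • crFrame z) =
      tangentDeriv f z (c • crFrame z) * g z + f z * tangentDeriv g z (c • crFrame z) := by
  have h := (hf.hasDerivAt_rot_zero c hc z).mul (hg.hasDerivAt_rot_zero c hc z)
  simp only [rot_zero] at h
  exact ((hf.mul hg).hasDerivAt_rot_zero c hc z).unique h

lemma tangentDeriv_conj {f : S3 → ℂ} (hf : Smooth f) (c : ℂ)
    (hc : Complex.normSq c = 1) (z : S3) :
    tangentDeriv (fun z => conj (f z)) z (c • crFrame z) =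
      conj (tangentDeriv f z (c • crFrame z)) := by
  have h := Complex.conjCLE.toContinuousLinearMap.hasFDerivAt.comp_hasDerivAt 0
    (hf.hasDerivAt_rot_zero c hc z)
  exact (hf.conj.hasDerivAt_rot_zero c hc z).unique h

lemma continuous_crFrame : Continuous crFrame := by
  unfold crFrame
  refine (PiLp.continuous_toLp 2 _).comp (continuous_pi fun i => ?_)
  fin_cases i
  · simp
    fun_prop
  · simp
    fun_prop

lemma continuous_tangentDeriv {f : S3 → ℂ} (hf : Smooth f) (c : ℂ) :
    Continuous fun z => tangentDeriv f z (c • crFrame z) := by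
  have h := (contDiffOn_radialExt hf).continuousOn_fderiv_of_isOpen isOpen_compl_singleton
    (by simp)
  have h2 : Continuous fun z : S3 => fderiv ℝ (radialExt f) (z : C2) :=
    h.comp_continuous continuous_subtype_val fun z => ne_zero_of_mem_unit_sphere z
  exact h2.clm_apply (continuous_crFrame.const_smul c)

lemma integrable_of_continuous {f : S3 → ℂ} (hf : Continuous f) : Integrable f surface :=
  hf.integrable_of_hasCompactSupport (HasCompactSupport.of_compactSpace f)

/-- The derivative of a smooth function along a Killing field integrates to zero. -/
lemma integral_tangentDeriv {f : S3 → ℂ} (hf : Smooth f) (c : ℂ) (hc : Complex.normSq c = 1) :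
    ∫ z, tangentDeriv f z (c • crFrame z) ∂surface = 0 := by
  have hcont := continuous_tangentDeriv hf c
  obtain ⟨M, hM⟩ := (isCompact_univ (X := S3)).exists_bound_of_continuousOn hcont.continuousOn
  have h := (hasDerivAt_integral_of_dominated_loc_of_deriv_le (μ := surface) (𝕜 := ℝ)
    (F := fun t z => f (sphereMap (rotIso c hc t) z)) (x₀ := 0) (s := Set.univ)
    (F' := fun t z => tangentDeriv f (sphereMap (rotIso c hc t) z)
      (c • crFrame (sphereMap (rotIso c hc t) z)))
    (bound := fun _ => M) Filter.univ_mem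
    (Filter.Eventually.of_forall fun t =>
      (hf.continuous.comp (continuous_sphereMap _)).aestronglyMeasurable)
    (integrable_of_continuous (hf.continuous.comp (continuous_sphereMap _)))
    (hcont.comp (continuous_sphereMap _)).aestronglyMeasurable
    (Filter.Eventually.of_forall fun z t _ => hM _ (Set.mem_univ _))
    (integrable_const M)
    (Filter.Eventually.of_forall fun z t _ => hf.hasDerivAt_rot c hc z t)).2
  -- Rotations preserve the surface measure, so the integral being differentiated is constant in t.
  simp only [integral_comp_sphereMap _ hf.continuous, rot_zero] at h
  exact h.unique (hasDerivAt_const (0 : ℝ) _)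

/-! ### The operators `L` and its conjugate -/

lemma normSq_one' : Complex.normSq 1 = 1 := by simp
lemma normSq_I' : Complex.normSq Complex.I = 1 := by simp

/-- `∂̄_b` in the frame `J z`. -/
def opL (f : S3 → ℂ) (z : S3) : ℂ := dbarB f z (crFrame z)

/-- The conjugate of `opL`. -/
def opR (f : S3 → ℂ) (z : S3) : ℂ :=
  (1 / 2 : ℂ) * (tangentDeriv f z (crFrame z) - Complex.I * tangentDeriv f z (Complex.I • crFrame z))

lemma dbarB_I_smul (f : S3 → ℂ) (z : S3) :
    dbarB f z (Complex.I • crFrame z) = -Complex.I * opL f z := by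
  have h : tangentDeriv f z (Complex.I • Complex.I • crFrame z) = -tangentDeriv f z (crFrame z) := by
    rw [smul_smul, Complex.I_mul_I, neg_smul, one_smul, tangentDeriv, map_neg]
    rfl
  rw [opL, dbarB, dbarB, h]
  linear_combination ((1 / 2 : ℂ) * tangentDeriv f z (Complex.I • crFrame z)) * Complex.I_mul_I

/-- A (0,1)-form takes values of equal modulus on e and ie, so both frame vectors contribute the
same. This is the origin of the factor 2 in the eigenvalues. -/
lemma dbarBInner_eq (f φ : S3 → ℂ) (z : S3) :
    dbarBInner f φ z = 2 * (opL f z * conj (opL φ z)) := by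
  rw [dbarBInner, dbarB_I_smul, dbarB_I_smul, ← opL, ← opL, map_mul, map_neg, Complex.conj_I]
  linear_combination (-opL f z * conj (opL φ z)) * Complex.I_mul_I

lemma conj_opL {f : S3 → ℂ} (hf : Smooth f) (z : S3) :
    conj (opL f z) = opR (fun z => conj (f z)) z := by
  have h1 := tangentDeriv_conj hf 1 normSq_one' z
  have h2 := tangentDeriv_conj hf Complex.I normSq_I' z
  rw [one_smul] at h1
  have h3 : conj (1 / 2 : ℂ) = 1 / 2 := by
    rw [map_div₀, map_one, Complex.conj_ofNat]
  rw [opL, opR, dbarB, h1, h2, map_mul, map_add, map_mul, Complex.conj_I, h3]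
  ring

lemma opR_mul {f g : S3 → ℂ} (hf : Smooth f) (hg : Smooth g) (z : S3) :
    opR (fun z => f z * g z) z = opR f z * g z + f z * opR g z := by
  have h1 := tangentDeriv_mul hf hg 1 normSq_one' z
  have h2 := tangentDeriv_mul hf hg Complex.I normSq_I' z
  rw [one_smul] at h1
  rw [opR, opR, opR, h1, h2]
  ring

lemma continuous_opR {f : S3 → ℂ} (hf : Smooth f) : Continuous (opR f) := by
  have h1 := continuous_tangentDeriv hf 1
  have h2 := continuous_tangentDeriv hf Complex.I
  simp only [one_smul] at h1
  unfold opR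
  fun_prop

lemma integral_opR {f : S3 → ℂ} (hf : Smooth f) : ∫ z, opR f z ∂surface = 0 := by
  have h1 := integral_tangentDeriv hf 1 normSq_one'
  have h2 := integral_tangentDeriv hf Complex.I normSq_I'
  have c1 := continuous_tangentDeriv hf 1
  have c2 := continuous_tangentDeriv hf Complex.I
  simp only [one_smul] at h1 c1
  unfold opR
  rw [integral_const_mul, integral_sub (integrable_of_continuous c1)
    ((integrable_of_continuous c2).const_mul _), integral_const_mul, h1, h2]
  simp

/-! ### Polynomial functions on the sphere -/

open MvPolynomial in
/-- The function `P(z, J z)` on `ℂ²`. -/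
def polyFun (P : PolyZW) (x : C2) : ℂ :=
  aeval (Sum.elim (fun i => x i) (fun i => crJ x i)) P

/-- The function `P(z, J z)` on `S³`. -/
def sphFun (P : PolyZW) (z : S3) : ℂ := polyFun P z

open MvPolynomial in
lemma contDiff_polyFun (P : PolyZW) : ContDiff ℝ ∞ (polyFun P) := by
  unfold polyFun
  have hcoord : ∀ i : Fin 2, ContDiff ℝ ∞ fun x : C2 => x i := fun i =>
    ((EuclideanSpace.proj i : C2 →L[ℂ] ℂ).restrictScalars ℝ).contDiff
  have hconj : ∀ i : Fin 2, ContDiff ℝ ∞ fun x : C2 => conj (x i) := fun i =>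
    Complex.conjCLE.contDiff.comp (hcoord i)
  induction P using MvPolynomial.induction_on with
  | C a => simpa using contDiff_const
  | add p q hp hq => simp only [map_add]; exact hp.add hq
  | mul_X p i hp =>
    simp only [map_mul]
    refine hp.mul ?_
    rcases i with i | i
    · simpa using hcoord i
    · fin_cases i
      · simpa using (hconj 1).neg
      · simpa using hconj 0

lemma smooth_sphFun (P : PolyZW) : Smooth (sphFun P) := smooth_of_contDiff (contDiff_polyFun P)

lemma sphFun_add (P Q : PolyZW) : sphFun (P + Q) = fun z => sphFun P z + sphFun Q z := by
  ext z; simp [sphFun, polyFun]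

lemma sphFun_mul (P Q : PolyZW) : sphFun (P * Q) = fun z => sphFun P z * sphFun Q z := by
  ext z; simp [sphFun, polyFun]

lemma sphFun_smul (a : ℂ) (P : PolyZW) : sphFun (a • P) = fun z => a * sphFun P z := by
  ext z; simp [sphFun, polyFun]

lemma tangentDeriv_add {f g : S3 → ℂ} (hf : Smooth f) (hg : Smooth g) (c : ℂ)
    (hc : Complex.normSq c = 1) (hfg : Smooth fun z => f z + g z) (z : S3) :
    tangentDeriv (fun z => f z + g z) z (c • crFrame z) =
      tangentDeriv f z (c • crFrame z) + tangentDeriv g z (c • crFrame z) :=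
  (hfg.hasDerivAt_rot_zero c hc z).unique
    ((hf.hasDerivAt_rot_zero c hc z).add (hg.hasDerivAt_rot_zero c hc z))

open MvPolynomial in
lemma tangentDeriv_C (a : ℂ) (c : ℂ) (hc : Complex.normSq c = 1) (z : S3) :
    tangentDeriv (sphFun (C a)) z (c • crFrame z) = 0 := by
  have h := (smooth_sphFun (C a)).hasDerivAt_rot_zero c hc z
  have h2 : (fun s : ℝ => sphFun (C a) (sphereMap (rotIso c hc s) z)) = fun _ => a := by
    ext s; simp [sphFun, polyFun]
  rw [h2] at h
  exact h.unique (hasDerivAt_const _ _)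

open MvPolynomial in
lemma tangentDeriv_X_inl (i : Fin 2) (c : ℂ) (hc : Complex.normSq c = 1) (z : S3) :
    tangentDeriv (sphFun (X (Sum.inl i))) z (c • crFrame z) = c * crFrame z i := by
  have h := (smooth_sphFun (X (Sum.inl i))).hasDerivAt_rot_zero c hc z
  have h1 := KohnSphere.hasDerivAt_rot c hc 0 z
  rw [rot_zero] at h1
  have h2 := ((EuclideanSpace.proj i : C2 →L[ℂ] ℂ).restrictScalars ℝ).hasFDerivAt.comp_hasDerivAt
    (0 : ℝ) h1
  have h3 : (fun s : ℝ => sphFun (X (Sum.inl i)) (sphereMap (rotIso c hc s) z)) =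
      ((EuclideanSpace.proj i : C2 →L[ℂ] ℂ).restrictScalars ℝ) ∘
        (fun s => (sphereMap (rotIso c hc s) z : C2)) := by
    ext s; simp [sphFun, polyFun]
  rw [h3] at h
  simpa using h.unique h2

-- Moving z with velocity cJz moves w = Jz with velocity J(cJz) = c̄J²z = -c̄z.
open MvPolynomial in
lemma tangentDeriv_X_inr (i : Fin 2) (c : ℂ) (hc : Complex.normSq c = 1) (z : S3) :
    tangentDeriv (sphFun (X (Sum.inr i))) z (c • crFrame z) = -conj c * (z : C2) i := by
  have h1 : ∀ j : Fin 2, tangentDeriv (fun w => conj (sphFun (X (Sum.inl j)) w)) z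
      (c • crFrame z) = conj c * conj (crFrame z j) := by
    intro j
    rw [tangentDeriv_conj (smooth_sphFun _) c hc, tangentDeriv_X_inl j c hc, map_mul]
  fin_cases i
  · have h2 : sphFun (X (Sum.inr 0)) = fun w => sphFun (C (-1)) w *
        conj (sphFun (X (Sum.inl 1)) w) := by
      ext w; simp [sphFun, polyFun]
    change tangentDeriv (sphFun (X (Sum.inr 0))) z (c • crFrame z) = _
    rw [h2, tangentDeriv_mul (smooth_sphFun _) (smooth_sphFun _).conj c hc, tangentDeriv_C _ c hc,
      h1]
    simp [sphFun, polyFun, crFrame_eq]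
  · have h2 : sphFun (X (Sum.inr 1)) = fun w => conj (sphFun (X (Sum.inl 0)) w) := by
      ext w; simp [sphFun, polyFun]
    change tangentDeriv (sphFun (X (Sum.inr 1))) z (c • crFrame z) = _
    rw [h2, h1]
    simp [crFrame_eq]

-- Both sides are derivations in P, and on the variables z has velocity cw and w has velocity -c̄z.
-- The cases c = 1 and c = i turn ∂̄_b and its conjugate into the algebraic operators `lower` and
-- `raise`.
open MvPolynomial in
lemma tangentDeriv_sphFun (P : PolyZW) (c : ℂ) (hc : Complex.normSq c = 1) (z : S3) :
    tangentDeriv (sphFun P) z (c • crFrame z) =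
      c * sphFun (raise P) z - conj c * sphFun (lower P) z := by
  induction P using MvPolynomial.induction_on with
  | C a => rw [tangentDeriv_C a c hc]; simp [sphFun, polyFun]
  | add p q hp hq =>
    have hs := smooth_sphFun (p + q)
    rw [sphFun_add] at hs ⊢
    rw [tangentDeriv_add (smooth_sphFun _) (smooth_sphFun _) c hc hs, hp, hq, map_add, map_add,
      sphFun_add, sphFun_add]
    ring
  | mul_X p i hp =>
    have hX : tangentDeriv (sphFun (X i)) z (c • crFrame z) =
        c * sphFun (raise (X i)) z - conj c * sphFun (lower (X i)) z := by
      rcases i with i | i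
      · rw [tangentDeriv_X_inl i c hc]; simp [sphFun, polyFun, crFrame_eq]
      · rw [tangentDeriv_X_inr i c hc]; simp [sphFun, polyFun]
    rw [sphFun_mul, tangentDeriv_mul (smooth_sphFun _) (smooth_sphFun _) c hc, hp, hX,
      Derivation.leibniz, Derivation.leibniz, sphFun_add, sphFun_add]
    simp only [smul_eq_mul, sphFun_mul]
    ring

lemma opR_sphFun (P : PolyZW) : opR (sphFun P) = sphFun (raise P) := by
  ext z
  have h1 := tangentDeriv_sphFun P 1 normSq_one' z
  have h2 := tangentDeriv_sphFun P Complex.I normSq_I' z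
  rw [one_smul, map_one] at h1
  rw [Complex.conj_I] at h2
  rw [opR, h1, h2]
  linear_combination (-(1 / 2 : ℂ) * (sphFun (raise P) z + sphFun (lower P) z)) * Complex.I_mul_I

lemma opL_sphFun (P : PolyZW) : opL (sphFun P) = fun z => -sphFun (lower P) z := by
  ext z
  have h1 := tangentDeriv_sphFun P 1 normSq_one' z
  have h2 := tangentDeriv_sphFun P Complex.I normSq_I' z
  rw [one_smul, map_one] at h1
  rw [Complex.conj_I] at h2
  rw [opL, dbarB, h1, h2]
  linear_combination ((1 / 2 : ℂ) * (sphFun (raise P) z + sphFun (lower P) z)) * Complex.I_mul_I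

/-- Integration by parts: the weak form of `□_b f` for a polynomial function `f`. -/
lemma integral_dbarBInner_sphFun (P : PolyZW) {φ : S3 → ℂ} (hφ : Smooth φ) :
    ∫ z, dbarBInner (sphFun P) φ z ∂surface =
      ∫ z, sphFun ((2 : ℂ) • raise (lower P)) z * conj (φ z) ∂surface := by
  have h := integral_opR ((smooth_sphFun (lower P)).mul hφ.conj)
  have h1 : ∀ z, opR (fun z => sphFun (lower P) z * conj (φ z)) z =
      sphFun (raise (lower P)) z * conj (φ z) + sphFun (lower P) z * conj (opL φ z) := by
    intro z
    rw [opR_mul (smooth_sphFun _) hφ.conj, opR_sphFun, conj_opL hφ]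
  have c1 : Continuous fun z => sphFun (raise (lower P)) z * conj (φ z) :=
    ((smooth_sphFun _).mul hφ.conj).continuous
  have c2 : Continuous fun z => sphFun (lower P) z * conj (opL φ z) := by
    simp only [conj_opL hφ]
    exact (smooth_sphFun _).continuous.mul (continuous_opR hφ.conj)
  simp only [h1] at h
  rw [integral_add (integrable_of_continuous c1) (integrable_of_continuous c2)] at h
  simp only [dbarBInner_eq, opL_sphFun, sphFun_smul, mul_assoc, neg_mul]
  rw [integral_const_mul, integral_const_mul, integral_neg, ← eq_neg_of_add_eq_zero_left h]

/-! ### Strings of binary forms as functions on the sphere -/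

/-- The function on `S³` attached to the `q`-th vector of the string of the binary form `F`. -/
def strFun (q : ℕ) (F : MvPolynomial (Fin 2) ℂ) : S3 → ℂ := sphFun (raise^[q] (inZ F))

lemma raise_iter_add (q : ℕ) (P Q : PolyZW) : raise^[q] (P + Q) = raise^[q] P + raise^[q] Q := by
  induction q generalizing P Q with
  | zero => rfl
  | succ q ih => rw [Function.iterate_succ_apply, map_add, ih]; rfl

lemma raise_iter_smul (q : ℕ) (a : ℂ) (P : PolyZW) : raise^[q] (a • P) = a • raise^[q] P := by
  induction q generalizing P with
  | zero => rfl
  | succ q ih => rw [Function.iterate_succ_apply, Derivation.map_smul, ih]; rfl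

lemma strFun_add (q : ℕ) (F F' : MvPolynomial (Fin 2) ℂ) :
    strFun q (F + F') = fun z => strFun q F z + strFun q F' z := by
  rw [strFun, map_add, raise_iter_add, sphFun_add]; rfl

lemma strFun_smul (q : ℕ) (a : ℂ) (F : MvPolynomial (Fin 2) ℂ) :
    strFun q (a • F) = fun z => a * strFun q F z := by
  rw [strFun, map_smul, raise_iter_smul, sphFun_smul]; rfl

lemma strFun_zero (q : ℕ) : strFun q 0 = fun _ => 0 := by
  have h := strFun_smul q 0 0
  simpa using h

lemma strFun_sum (q : ℕ) {ι : Type*} (s : Finset ι) (F : ι → MvPolynomial (Fin 2) ℂ) :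
    strFun q (∑ i ∈ s, F i) = fun z => ∑ i ∈ s, strFun q (F i) z := by
  induction s using Finset.cons_induction with
  | empty => simp [strFun_zero]
  | cons a s ha ih => simp only [Finset.sum_cons, strFun_add, ih]

lemma smooth_strFun (q : ℕ) (F : MvPolynomial (Fin 2) ℂ) : Smooth (strFun q F) := smooth_sphFun _

lemma continuous_strFun (q : ℕ) (F : MvPolynomial (Fin 2) ℂ) : Continuous (strFun q F) :=
  (smooth_strFun q F).continuous

lemma det_ne_zero (g : U2) : (g : Matrix (Fin 2) (Fin 2) ℂ).det ≠ 0 := by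
  intro h
  have h1 : (g : Matrix (Fin 2) (Fin 2) ℂ) * star (g : Matrix (Fin 2) (Fin 2) ℂ) = 1 :=
    Matrix.mem_unitaryGroup_iff.1 g.2
  have h2 := congrArg Matrix.det h1
  rw [Matrix.det_mul, h] at h2
  simp at h2

lemma coe_smul_apply (g : U2) (z : S3) (i : Fin 2) :
    ((g • z : S3) : C2) i = (g : Matrix (Fin 2) (Fin 2) ℂ) i 0 * (z : C2) 0 +
      (g : Matrix (Fin 2) (Fin 2) ℂ) i 1 * (z : C2) 1 := by
  change Matrix.toEuclideanLin (g : Matrix (Fin 2) (Fin 2) ℂ) (z : C2) i = _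
  rw [Matrix.toLpLin_apply]
  simp only [Matrix.mulVec, dotProduct, Fin.sum_univ_two]

/-- For unitary g the adjugate is det(g) g*, which expresses the conjugates of the entries of g
through the entries themselves. -/
lemma crJ_smul (g : U2) (z : S3) (i : Fin 2) :
    crJ ((g • z : S3) : C2) i = (g : Matrix (Fin 2) (Fin 2) ℂ).det⁻¹ *
      ((g : Matrix (Fin 2) (Fin 2) ℂ) i 0 * crJ z 0 +
        (g : Matrix (Fin 2) (Fin 2) ℂ) i 1 * crJ z 1) := by
  have hd := det_ne_zero g
  rw [eq_inv_mul_iff_mul_eq₀ hd]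
  have h1 : star (g : Matrix (Fin 2) (Fin 2) ℂ) * (g : Matrix (Fin 2) (Fin 2) ℂ) = 1 :=
    Matrix.mem_unitaryGroup_iff'.1 g.2
  have hadj : (g : Matrix (Fin 2) (Fin 2) ℂ).adjugate =
      (g : Matrix (Fin 2) (Fin 2) ℂ).det • star (g : Matrix (Fin 2) (Fin 2) ℂ) := by
    have h2 := congrArg (star (g : Matrix (Fin 2) (Fin 2) ℂ) * ·)
      (Matrix.mul_adjugate (g : Matrix (Fin 2) (Fin 2) ℂ))
    simp only [← mul_assoc, h1, one_mul] at h2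
    rw [h2]
    simp
  have e00 := congrFun (congrFun hadj 0) 0
  have e01 := congrFun (congrFun hadj 0) 1
  have e10 := congrFun (congrFun hadj 1) 0
  have e11 := congrFun (congrFun hadj 1) 1
  rw [Matrix.adjugate_fin_two] at e00 e01 e10 e11
  simp only [Matrix.smul_apply, Matrix.star_apply, smul_eq_mul, Matrix.of_apply, Matrix.cons_val',
    Matrix.cons_val_zero, Matrix.cons_val_one, Matrix.cons_val_fin_one, RCLike.star_def]
    at e00 e01 e10 e11
  fin_cases i
  · simp only [crJ_zero, crJ_one, coe_smul_apply, map_add, map_mul, Fin.zero_eta]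
    linear_combination conj ((z : C2) 0) * e01 + conj ((z : C2) 1) * e11
  · simp only [crJ_zero, crJ_one, coe_smul_apply, map_add, map_mul, Fin.mk_one]
    linear_combination -conj ((z : C2) 0) * e00 - conj ((z : C2) 1) * e10

open MvPolynomial in
lemma sphFun_smul_arg (P : PolyZW) (g : U2) (z : S3) :
    sphFun P (g • z) = sphFun (polyComp (g : Matrix (Fin 2) (Fin 2) ℂ)
      (g : Matrix (Fin 2) (Fin 2) ℂ).det⁻¹ P) z := by
  unfold sphFun polyFun
  have : (aeval (Sum.elim (fun i => (z : C2) i) (fun i => crJ z i))).comp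
      (polyComp (g : Matrix (Fin 2) (Fin 2) ℂ) (g : Matrix (Fin 2) (Fin 2) ℂ).det⁻¹) =
      aeval (Sum.elim (fun i => ((g • z : S3) : C2) i) (fun i => crJ ((g • z : S3) : C2) i)) := by
    apply MvPolynomial.algHom_ext
    rintro (i | i)
    · rw [AlgHom.comp_apply, polyComp, aeval_X, aeval_X, Sum.elim_inl, Sum.elim_inl, coe_smul_apply]
      simp
    · rw [AlgHom.comp_apply, polyComp, aeval_X, aeval_X, Sum.elim_inr, Sum.elim_inr, crJ_smul]
      simp
  rw [← this]
  rfl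

/-- Equivariance of the strings. -/
lemma strFun_smul_arg (q : ℕ) (F : MvPolynomial (Fin 2) ℂ) (g : U2) (z : S3) :
    strFun q F (g • z) = ((g : Matrix (Fin 2) (Fin 2) ℂ).det⁻¹) ^ q *
      strFun q (formComp (g : Matrix (Fin 2) (Fin 2) ℂ) F) z := by
  have hd : (g : Matrix (Fin 2) (Fin 2) ℂ).det⁻¹ ≠ 0 := inv_ne_zero (det_ne_zero g)
  rw [strFun, strFun, sphFun_smul_arg, ← polyComp_inZ _ (g : Matrix (Fin 2) (Fin 2) ℂ).det⁻¹,
    raise_iter_polyComp _ hd, sphFun_smul, ← mul_assoc, ← mul_pow, mul_inv_cancel₀ hd, one_pow,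
    one_mul]

/-- Each w in the string contributes a factor det(g)⁻¹, and the twist det(g)^q in `semiInv` cancels
the q of them. -/
lemma strFun_invariant {G : Subgroup U2} {n q : ℕ} {F : MvPolynomial (Fin 2) ℂ}
    (hF : F ∈ semiInv G n q) {g : U2} (hg : g ∈ G) (z : S3) : strFun q F (g • z) = strFun q F z := by
  rw [strFun_smul_arg, hF.2 g hg, strFun_smul, ← mul_assoc, ← mul_pow,
    inv_mul_cancel₀ (det_ne_zero g), one_pow, one_mul]

/-- The semi-invariant average of a binary form. -/
def semiAvg (G : Subgroup U2) [Fintype G] (q : ℕ) (F : MvPolynomial (Fin 2) ℂ) :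
    MvPolynomial (Fin 2) ℂ :=
  (Fintype.card G : ℂ)⁻¹ • ∑ g : G, (((g : U2) : Matrix (Fin 2) (Fin 2) ℂ).det⁻¹) ^ q •
    formComp ((g : U2) : Matrix (Fin 2) (Fin 2) ℂ) F

open MvPolynomial in
lemma semiAvg_mem (G : Subgroup U2) [Fintype G] {n : ℕ} (q : ℕ) {F : MvPolynomial (Fin 2) ℂ}
    (hF : F.IsHomogeneous n) : semiAvg G q F ∈ semiInv G n q := by
  constructor
  · refine (homogeneousSubmodule (Fin 2) ℂ n).smul_mem _ (sum_mem fun g _ => ?_)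
    exact (homogeneousSubmodule (Fin 2) ℂ n).smul_mem _ (formComp_isHomogeneous _ hF)
  · intro h hh
    rw [semiAvg, map_smul, map_sum, smul_comm]
    congr 1
    rw [Finset.smul_sum]
    refine Fintype.sum_equiv (Equiv.mulRight (⟨h, hh⟩ : G)) _ _ fun g => ?_
    simp only [Equiv.coe_mulRight, Subgroup.coe_mul, Submonoid.coe_mul, map_smul, formComp_mul,
      smul_smul, Matrix.det_mul, mul_inv, mul_pow]
    congr 1
    rw [mul_comm, mul_assoc, ← mul_pow, inv_mul_cancel₀ (det_ne_zero h), one_pow, mul_one]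

lemma strFun_semiAvg (G : Subgroup U2) [Fintype G] (q : ℕ) (F : MvPolynomial (Fin 2) ℂ) (z : S3) :
    strFun q (semiAvg G q F) z =
      (Fintype.card G : ℂ)⁻¹ * ∑ g : G, strFun q F ((g : U2) • z) := by
  rw [semiAvg, strFun_smul, strFun_sum]
  simp only [strFun_smul, strFun_smul_arg]

/-- Strings are eigenfunctions of the Kohn Laplacian, in the weak sense. -/
lemma integral_dbarBInner_strFun {F : MvPolynomial (Fin 2) ℂ} {n : ℕ} (hF : F.IsHomogeneous n)
    (q : ℕ) {φ : S3 → ℂ} (hφ : Smooth φ) :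
    ∫ z, dbarBInner (strFun q F) φ z ∂surface =
      ∫ z, (2 * ((q : ℂ) * (n + 1 - q))) * strFun q F z * conj (φ z) ∂surface := by
  rw [strFun, integral_dbarBInner_sphFun _ hφ, raise_lower_raise_iter hF, smul_smul]
  simp only [sphFun_smul]

/-- A polynomial is not determined by its function, since `wedge` restricts to 1. Nevertheless
`lower` acts on functions, because it is realized by the differential operator `opL`. -/
lemma sphFun_eq_zero_lower {P : PolyZW} (h : sphFun P = fun _ => 0) :
    sphFun (lower P) = fun _ => 0 := by
  have h1 := opL_sphFun P
  have h0 : sphFun (0 : PolyZW) = fun _ => 0 := by ext z; simp [sphFun, polyFun]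
  have h2 := opL_sphFun 0
  rw [map_zero, h0] at h2
  rw [h, h2] at h1
  ext z
  have := congrFun h1 z
  simpa using this.symm

open MvPolynomial in
lemma formComp_diagonal_monomial (a : Fin 2 → ℂ) (s : Fin 2 →₀ ℕ) (r : ℂ) :
    formComp (Matrix.diagonal a) (monomial s r) = (a 0 ^ s 0 * a 1 ^ s 1) • monomial s r := by
  have hs : ∀ t : Fin 2 →₀ ℕ, monomial t r = C r * (X 0 ^ t 0 * X 1 ^ t 1) := by
    intro t
    rw [monomial_eq, Finsupp.prod_fintype _ _ (by simp), Fin.prod_univ_two]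
  rw [hs]
  simp [formComp, Matrix.diagonal, mul_pow, ← C_mul']
  ring

open MvPolynomial in
lemma formComp_smul_one (c : ℂ) {F : MvPolynomial (Fin 2) ℂ} {n : ℕ} (hF : F.IsHomogeneous n) :
    formComp (c • 1) F = c ^ n • F := by
  have h1 : (c • 1 : Matrix (Fin 2) (Fin 2) ℂ) = Matrix.diagonal fun _ => c :=
    Matrix.smul_one_eq_diagonal c
  rw [F.as_sum, map_sum, Finset.smul_sum]
  refine Finset.sum_congr rfl fun s hs => ?_
  have h2 := hF.degree_eq_sum_deg_support hs
  rw [h1, formComp_diagonal_monomial, ← pow_add]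
  congr 2
  rw [h2, ← Fin.sum_univ_two (f := s), ← Finsupp.degree_eq_sum]
  rfl

open MvPolynomial in
lemma eval_smul_of_isHomogeneous (c : ℂ) {F : MvPolynomial (Fin 2) ℂ} {n : ℕ}
    (hF : F.IsHomogeneous n) (x : Fin 2 → ℂ) : eval (c • x) F = c ^ n * eval x F := by
  have h := eval_formComp (c • 1) F x
  rw [formComp_smul_one c hF, Matrix.smul_mulVec, Matrix.one_mulVec] at h
  rw [← h, smul_eval]

open MvPolynomial in
lemma sphFun_inZ (F : MvPolynomial (Fin 2) ℂ) (z : S3) :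
    sphFun (inZ F) z = eval (fun i => (z : C2) i) F := by
  rw [sphFun, polyFun, inZ, aeval_rename, aeval_eq_eval]
  rfl

open MvPolynomial in
lemma eq_zero_of_forall_sphere {F : MvPolynomial (Fin 2) ℂ} {n : ℕ} (hF : F.IsHomogeneous n)
    (h : ∀ z : S3, eval (fun i => (z : C2) i) F = 0) : F = 0 := by
  apply MvPolynomial.funext
  intro x
  rw [map_zero]
  obtain ⟨c, z, hz⟩ : ∃ (c : ℂ) (z : S3), x = c • fun i => (z : C2) i := by
    by_cases hx : (WithLp.toLp 2 x : C2) = 0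
    · refine ⟨0, ⟨EuclideanSpace.single 0 1, by simp⟩, ?_⟩
      ext i
      simpa using congrArg (fun y : C2 => y i) hx
    · have hn := norm_ne_zero_iff.2 hx
      refine ⟨‖(WithLp.toLp 2 x : C2)‖,
        ⟨((‖(WithLp.toLp 2 x : C2)‖⁻¹ : ℝ) : ℂ) • WithLp.toLp 2 x, ?_⟩, ?_⟩
      · rw [mem_sphere_zero_iff_norm, norm_smul, Complex.norm_real, norm_inv, norm_norm,
          inv_mul_cancel₀ hn]
      · ext i
        have : (‖(WithLp.toLp 2 x : C2)‖ : ℂ) ≠ 0 := by exact_mod_cast hn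
        simp [mul_inv_cancel_left₀ this]
  rw [hz, eval_smul_of_isHomogeneous c hF, h, mul_zero]

/-- Applying `lower` q times leads back to a nonzero multiple of F, and a form vanishing on the
sphere vanishes by homogeneity. -/
lemma eq_zero_of_strFun_eq_zero {F : MvPolynomial (Fin 2) ℂ} {n : ℕ} (hF : F.IsHomogeneous n)
    {q : ℕ} (hq : q ≤ n) (h : ∀ z, strFun q F z = 0) : F = 0 := by
  have hk : ∀ (k : ℕ) (P : PolyZW), (sphFun P = fun _ => 0) →
      sphFun (lower^[k] P) = fun _ => 0 := by
    intro k
    induction k with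
    | zero => exact fun P hP => hP
    | succ k ih => exact fun P hP => ih _ (sphFun_eq_zero_lower hP)
  have h0 : sphFun (raise^[q] (inZ F)) = fun _ => 0 := _root_.funext h
  obtain ⟨c, hc, he⟩ := lower_iter_raise_iter hF q hq
  refine eq_zero_of_forall_sphere hF fun z => ?_
  have h1 : sphFun (c • inZ F) z = 0 := by rw [← he, hk q _ h0]
  simp only [sphFun_smul, sphFun_inZ] at h1
  exact (mul_eq_zero.1 h1).resolve_left hc

/-! ### Density of the polynomial functions -/

/-- Polynomial functions on the sphere as continuous maps. -/
def sphMap : PolyZW →ₐ[ℂ] C(S3, ℂ) where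
  toFun P := ⟨sphFun P, (smooth_sphFun P).continuous⟩
  map_one' := by ext z; simp [sphFun, polyFun]
  map_mul' P Q := by ext z; simp [sphFun, polyFun]
  map_zero' := by ext z; simp [sphFun, polyFun]
  map_add' P Q := by ext z; simp [sphFun, polyFun]
  commutes' a := by ext z; simp [sphFun, polyFun]

lemma sphMap_apply (P : PolyZW) (z : S3) : sphMap P z = sphFun P z := rfl

-- The coordinates of Jz are, up to sign, the conjugates of those of z. This closure under
-- conjugation is what the Stone–Weierstrass theorem requires.
open MvPolynomial in
lemma exists_sphMap_eq_star (P : PolyZW) : ∃ Q : PolyZW, sphMap Q = star (sphMap P) := by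
  induction P using MvPolynomial.induction_on with
  | C a => exact ⟨C (conj a), by ext z; simp⟩
  | add p q hp hq =>
    obtain ⟨p', hp'⟩ := hp
    obtain ⟨q', hq'⟩ := hq
    exact ⟨p' + q', by rw [map_add, map_add, star_add, hp', hq']⟩
  | mul_X p i hp =>
    obtain ⟨p', hp'⟩ := hp
    obtain ⟨x, hx⟩ : ∃ Q : PolyZW, sphMap Q = star (sphMap (X i)) := by
      rcases i with i | i <;> fin_cases i
      · exact ⟨X (Sum.inr 1), by ext z; simp [sphMap_apply, sphFun, polyFun]⟩
      · exact ⟨-X (Sum.inr 0), by ext z; simp [sphMap_apply, sphFun, polyFun]⟩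
      · exact ⟨-X (Sum.inl 1), by ext z; simp [sphMap_apply, sphFun, polyFun]⟩
      · exact ⟨X (Sum.inl 0), by ext z; simp [sphMap_apply, sphFun, polyFun]⟩
    exact ⟨p' * x, by rw [map_mul, map_mul, star_mul', hp', hx]⟩

open MvPolynomial in
/-- Polynomial functions are dense in the continuous functions. -/
lemma dense_range_sphMap : Dense (Set.range sphMap) := by
  let A : StarSubalgebra ℂ C(S3, ℂ) :=
    { sphMap.range with
      star_mem' := by
        rintro _ ⟨P, rfl⟩
        obtain ⟨Q, hQ⟩ := exists_sphMap_eq_star P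
        exact ⟨Q, hQ⟩ }
  have hA : A.SeparatesPoints := by
    intro x y hxy
    have : ∃ i : Fin 2, (x : C2) i ≠ (y : C2) i := by
      by_contra h
      push Not at h
      exact hxy (Subtype.ext (PiLp.ext h))
    obtain ⟨i, hi⟩ := this
    refine ⟨_, ⟨sphMap (X (Sum.inl i)), ⟨X (Sum.inl i), rfl⟩, rfl⟩, ?_⟩
    simpa [sphMap_apply, sphFun, polyFun] using hi
  have h := ContinuousMap.starSubalgebra_topologicalClosure_eq_top_of_separatesPoints A hA
  intro f
  have hf : f ∈ A.topologicalClosure := by rw [h]; trivial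
  exact hf

lemma sphFun_wedge : sphFun wedge = fun _ => 1 := by
  ext z
  have h := norm_sq_C2 (z : C2)
  rw [norm_eq_of_mem_sphere z] at h
  simp only [sphFun, polyFun, wedge, map_sub, map_mul, MvPolynomial.aeval_X, Sum.elim_inl,
    Sum.elim_inr, crJ_zero, crJ_one]
  rw [mul_neg, sub_neg_eq_add, Complex.mul_conj, Complex.mul_conj]
  rw [one_pow] at h
  exact_mod_cast h.symm

/-- A square integrable function orthogonal to all strings vanishes. -/
lemma ae_eq_zero_of_forall_strFun {v : S3 → ℂ} (hv : MemLp v 2 surface)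
    (h : ∀ (n q : ℕ) (F : MvPolynomial (Fin 2) ℂ), F.IsHomogeneous n →
      ∫ z, conj (strFun q F z) * v z ∂surface = 0) : v =ᵐ[surface] 0 := by
  have hvi : Integrable v surface := hv.integrable (by norm_num)
  have hint : ∀ f : C(S3, ℂ), Integrable (fun z => conj (f z) * v z) surface := by
    intro f
    obtain ⟨M, hM⟩ := (isCompact_univ (X := S3)).exists_bound_of_continuousOn
      f.continuous.continuousOn
    refine hvi.bdd_mul (c := M) (Continuous.aestronglyMeasurable (by fun_prop))
      (Filter.Eventually.of_forall fun z => ?_)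
    simpa using hM z (Set.mem_univ _)
  have h1 : ∀ P : PolyZW, ∫ z, conj (sphFun P z) * v z ∂surface = 0 := by
    intro P
    have hP : P ∈ stringSpan := by rw [stringSpan_eq_top]; trivial
    induction hP using Submodule.span_induction with
    | mem P hP =>
      obtain ⟨k, q, n, F, hF, rfl⟩ := hP
      -- The powers of `wedge` restrict to 1, so on the sphere strings alone span the polynomial
      -- functions.
      have h2 : sphFun (wedge ^ k * raise^[q] (inZ F)) = strFun q F := by
        have hk : sphMap (wedge ^ k) = 1 := by
          have : sphMap wedge = 1 := by
            ext z; rw [sphMap_apply, sphFun_wedge]; rfl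
          rw [map_pow, this, one_pow]
        ext z
        rw [sphFun_mul]
        change sphMap (wedge ^ k) z * _ = _
        rw [hk, ContinuousMap.one_apply, one_mul]
        rfl
      rw [h2]
      exact h n q F hF
    | zero => simp [sphFun, polyFun]
    | add x y _ _ hx hy =>
      simp only [sphFun_add, map_add, add_mul]
      have hxi : Integrable (fun z => conj (sphFun x z) * v z) surface := hint (sphMap x)
      have hyi : Integrable (fun z => conj (sphFun y z) * v z) surface := hint (sphMap y)
      rw [integral_add hxi hyi, hx, hy, add_zero]
    | smul a x _ hx =>
      simp only [sphFun_smul, map_mul, mul_assoc]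
      rw [integral_const_mul, hx, mul_zero]
  let V : Lp ℂ 2 surface := hv.toLp v
  have hV : V =ᵐ[surface] v := hv.coeFn_toLp
  have hin : ∀ f : C(S3, ℂ), inner ℂ (ContinuousMap.toLp 2 surface ℂ f) V =
      ∫ z, conj (f z) * v z ∂surface := by
    intro f
    rw [L2.inner_def]
    refine integral_congr_ae ?_
    filter_upwards [hV, ContinuousMap.coeFn_toLp (p := 2) (𝕜 := ℂ) surface f] with z hz1 hz2
    rw [hz1, hz2, RCLike.inner_apply, mul_comm]
  -- Orthogonality passes from polynomials to continuous functions and then, by density once more,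
  -- to all of L².
  have h2 : ∀ f : C(S3, ℂ), inner ℂ (ContinuousMap.toLp 2 surface ℂ f) V = 0 := by
    have hc : Continuous fun f : C(S3, ℂ) => inner ℂ (ContinuousMap.toLp 2 surface ℂ f) V :=
      (ContinuousMap.toLp 2 surface ℂ).continuous.inner continuous_const
    have := Continuous.ext_on dense_range_sphMap hc (continuous_const (y := (0 : ℂ))) (by
      rintro _ ⟨P, rfl⟩
      change inner ℂ (ContinuousMap.toLp 2 surface ℂ (sphMap P)) V = 0
      rw [hin]
      exact h1 P)
    exact congrFun this
  have h3 : V = 0 := by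
    have hd := ContinuousMap.toLp_denseRange ℂ surface (p := 2) ℂ (by norm_num)
    have hc : Continuous fun w : Lp ℂ 2 surface => inner ℂ w V := continuous_id.inner
      continuous_const
    have := Continuous.ext_on hd hc (continuous_const (y := (0 : ℂ))) (by
      rintro _ ⟨f, rfl⟩
      exact h2 f)
    exact inner_self_eq_zero.1 (congrFun this V)
  rw [h3] at hV
  exact hV.symm.trans (Lp.coeFn_zero _ _ _)

/-! ### Functions on the quotient -/

section Quotient

variable (G : Subgroup U2)

lemma measurable_proj : Measurable (proj G) := measurable_quotient_mk''

lemma proj_smul {g : U2} (hg : g ∈ G) (z : S3) : proj G (g • z) = proj G z :=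
  Quotient.sound ⟨⟨g, hg⟩, rfl⟩

/-- The function on the quotient induced by an invariant function. -/
def desc (f : S3 → ℂ) (x : Quot3 G) : ℂ := f (Quotient.out x)

variable {G} in
lemma desc_proj {f : S3 → ℂ} (hf : ∀ g ∈ G, ∀ z, f (g • z) = f z) (z : S3) :
    desc G f (proj G z) = f z := by
  have h : (MulAction.orbitRel G S3) (Quotient.out (proj G z)) z := Quotient.mk_out z
  obtain ⟨g, hg⟩ := h
  have h2 : (g : U2) • z = Quotient.out (proj G z) := hg
  rw [desc, ← h2, hf g g.2]

variable [Finite G]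

lemma card_ne_zero' : (Nat.card G : ENNReal) ≠ 0 := by
  exact_mod_cast Nat.card_pos.ne'

instance : IsFiniteMeasure (quotMeasure G) := by
  have h : IsFiniteMeasure (surface.map (proj G)) := Measure.isFiniteMeasure_map _ _
  exact ⟨by
    rw [quotMeasure, Measure.smul_apply, smul_eq_mul]
    exact ENNReal.mul_lt_top (ENNReal.inv_lt_top.2 (pos_iff_ne_zero.2 (card_ne_zero' G)))
      (measure_lt_top _ _)⟩

lemma map_proj_eq : surface.map (proj G) = (Nat.card G : ENNReal) • quotMeasure G := by
  rw [quotMeasure, smul_smul, ENNReal.mul_inv_cancel (card_ne_zero' G) (by simp), one_smul]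

lemma ae_surface_of_ae {p : Quot3 G → Prop} (h : ∀ᵐ x ∂quotMeasure G, p x) :
    ∀ᵐ z ∂surface, p (proj G z) := by
  apply ae_of_ae_map (measurable_proj G).aemeasurable
  rw [map_proj_eq]
  exact Measure.ae_smul_measure h _

lemma integral_quotMeasure {f : Quot3 G → ℂ} (hf : AEStronglyMeasurable f (quotMeasure G)) :
    ∫ x, f x ∂quotMeasure G = (Nat.card G : ℂ)⁻¹ * ∫ z, f (proj G z) ∂surface := by
  have hf' : AEStronglyMeasurable f (surface.map (proj G)) := by
    rw [map_proj_eq]; exact hf.smul_measure _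
  rw [quotMeasure, integral_smul_measure, integral_map (measurable_proj G).aemeasurable hf']
  simp

lemma memLp_comp_proj (u : L2 G) : MemLp (fun z => u (proj G z)) 2 surface := by
  have h := (Lp.memLp u).smul_measure (c := (Nat.card G : ENNReal)) (by simp)
  rw [← map_proj_eq] at h
  exact (memLp_map_measure_iff h.1 (measurable_proj G).aemeasurable).1 h

variable {G}

lemma memLp_desc {f : S3 → ℂ} (hf : ∀ g ∈ G, ∀ z, f (g • z) = f z) (hc : Continuous f) :
    MemLp (desc G f) 2 (quotMeasure G) := by
  have hm : Measurable (desc G f) := by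
    rw [measurable_from_quotient]
    have : desc G f ∘ Quotient.mk'' = f := by
      ext z
      exact desc_proj hf z
    rw [this]
    exact hc.measurable
  obtain ⟨M, hM⟩ := (isCompact_univ (X := S3)).exists_bound_of_continuousOn hc.continuousOn
  exact MemLp.of_bound hm.aestronglyMeasurable M
    (Filter.Eventually.of_forall fun x => hM _ (Set.mem_univ _))

variable (G)

/-- The element of `L²(G \ S³)` attached to a semi-invariant binary form. -/
def eigMap (n q : ℕ) : semiInv G n q →ₗ[ℂ] L2 G where
  toFun F := (memLp_desc (fun _ hg z => strFun_invariant F.2 hg z)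
    (continuous_strFun q F.1)).toLp (desc G (strFun q F.1))
  map_add' F F' := by
    rw [← MemLp.toLp_add]
    congr 1
    ext x
    simp [desc, strFun_add]
  map_smul' a F := by
    rw [RingHom.id_apply, ← MemLp.toLp_const_smul]
    congr 1
    ext x
    simp [desc, strFun_smul]

variable {G}

lemma eigMap_ae {n q : ℕ} (F : semiInv G n q) :
    ∀ᵐ z ∂surface, eigMap G n q F (proj G z) = strFun q F.1 z := by
  have h := ae_surface_of_ae G (MemLp.coeFn_toLp (memLp_desc
    (fun _ hg z => strFun_invariant F.2 hg z) (continuous_strFun q F.1)))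
  filter_upwards [h] with z hz
  rw [← desc_proj (fun _ hg z => strFun_invariant F.2 hg z) z]
  exact hz

lemma inner_L2 (u v : L2 G) : inner ℂ u v =
    (Nat.card G : ℂ)⁻¹ * ∫ z, conj (u (proj G z)) * v (proj G z) ∂surface := by
  rw [L2.inner_def, integral_quotMeasure G]
  · simp only [RCLike.inner_apply, mul_comm]
  · exact (Lp.aestronglyMeasurable u).inner (Lp.aestronglyMeasurable v)

lemma inner_eigMap {n q : ℕ} (F : semiInv G n q) (v : L2 G) : inner ℂ (eigMap G n q F) v =
    (Nat.card G : ℂ)⁻¹ * ∫ z, conj (strFun q F.1 z) * v (proj G z) ∂surface := by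
  rw [inner_L2]
  congr 1
  refine integral_congr_ae ?_
  filter_upwards [eigMap_ae F] with z hz
  rw [hz]

/-- An element of `L²(G \ S³)` orthogonal to all semi-invariant strings vanishes. -/
lemma eq_zero_of_forall_inner_eigMap {u : L2 G}
    (h : ∀ (n q : ℕ) (F : semiInv G n q), inner ℂ (eigMap G n q F) u = 0) : u = 0 := by
  have := Fintype.ofFinite G
  have hcard : (Nat.card G : ℂ) ≠ 0 := by exact_mod_cast Nat.card_pos.ne'
  have hu := memLp_comp_proj G u
  have hui : Integrable (fun z => u (proj G z)) surface := hu.integrable (by norm_num)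
  have key : (fun z => u (proj G z)) =ᵐ[surface] 0 := by
    refine ae_eq_zero_of_forall_strFun hu fun n q F hF => ?_
    have h1 := h n q ⟨_, semiAvg_mem G q hF⟩
    rw [inner_eigMap] at h1
    have h2 := (mul_eq_zero.1 h1).resolve_left (inv_ne_zero hcard)
    simp only [strFun_semiAvg] at h2
    have hb : ∀ g : U2, Integrable (fun z => conj (strFun q F (g • z)) * u (proj G z)) surface := by
      intro g
      have hc : Continuous fun z : S3 => conj (strFun q F (g • z)) :=
        Complex.continuous_conj.comp
          ((continuous_strFun q F).comp (continuous_sphereMap (isoOfU2 g)))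
      obtain ⟨M, hM⟩ := (isCompact_univ (X := S3)).exists_bound_of_continuousOn hc.continuousOn
      exact hui.bdd_mul (c := M) hc.aestronglyMeasurable
        (Filter.Eventually.of_forall fun z => hM z (Set.mem_univ _))
    -- Both `u ∘ proj` and the surface measure are invariant under g, so all terms of the average
    -- give the same integral.
    have h3 : ∀ g : G, ∫ z, conj (strFun q F ((g : U2) • z)) * u (proj G z) ∂surface =
        ∫ z, conj (strFun q F z) * u (proj G z) ∂surface := by
      intro g
      have hmp := measurePreserving_sphereMap (isoOfU2 (g : U2))
      have hm : AEStronglyMeasurable (fun z => conj (strFun q F z) * u (proj G z))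
          (surface.map (sphereMap (isoOfU2 (g : U2)))) := by
        rw [hmp.map_eq]
        simpa using (hb 1).1
      conv_rhs => rw [← hmp.map_eq, integral_map hmp.measurable.aemeasurable hm]
      simp only [sphereMap_isoOfU2, proj_smul G g.2]
    simp only [map_mul, map_sum, mul_assoc, Finset.sum_mul] at h2
    rw [integral_const_mul, integral_finsetSum _ fun (g : G) _ => hb (g : U2)] at h2
    simp only [h3] at h2
    rw [Finset.sum_const, Finset.card_univ, nsmul_eq_mul] at h2
    have hc2 : (Fintype.card G : ℂ) ≠ 0 := by rwa [← Nat.card_eq_fintype_card]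
    have hc3 : conj ((Fintype.card G : ℂ)⁻¹) ≠ 0 := by
      rw [map_inv₀, Complex.conj_natCast]
      exact inv_ne_zero hc2
    exact (mul_eq_zero.1 ((mul_eq_zero.1 h2).resolve_left hc3)).resolve_left hc2
  have h0 : inner ℂ u u = (0 : ℂ) := by
    rw [inner_L2]
    have : ∫ z, conj (u (proj G z)) * u (proj G z) ∂surface = 0 := by
      rw [← integral_zero S3 ℂ (μ := surface)]
      refine integral_congr_ae ?_
      filter_upwards [key] with z hz
      rw [hz]
      simp
    rw [this, mul_zero]
  exact inner_self_eq_zero.1 h0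

end Quotient

/-! ### The eigenspaces of the Kohn Laplacian -/

section Eigenspaces

variable {G : Subgroup U2}

/-- Half the eigenvalue of the Kohn Laplacian on the `q`-th vectors of the strings of forms of
degree `n`. -/
def halfEig (n q : ℕ) : ℤ := q * (n + 1 - q)

lemma mem_kohnEigenspace (μ : ℝ) (u : L2 G) :
    u ∈ kohnEigenspace G μ ↔ (u, (μ : ℂ) • u) ∈ kohnGraph G := Iff.rfl

variable [Finite G]

lemma eigMap_mem_kohnGraph {n q : ℕ} (F : semiInv G n q) :
    (eigMap G n q F, (2 * (halfEig n q : ℂ)) • eigMap G n q F) ∈ kohnGraph G := by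
  apply Submodule.le_topologicalClosure
  apply Submodule.subset_span
  have hinv : ∀ g ∈ G, ∀ z, strFun q F.1 (g • z) = strFun q F.1 z :=
    fun _ hg z => strFun_invariant F.2 hg z
  have hae := MemLp.coeFn_toLp (memLp_desc hinv (continuous_strFun q F.1))
  refine ⟨desc G (strFun q F.1), fun x => (2 * (halfEig n q : ℂ)) * desc G (strFun q F.1) x,
    ?_, ?_, ?_, hae, ?_⟩
  · simp only [IsSmooth, desc_proj hinv]
    exact smooth_strFun q F.1
  · simp only [IsSmooth, desc_proj hinv, ← strFun_smul]
    exact smooth_strFun q _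
  · intro φ hφ
    have h := integral_dbarBInner_strFun F.2.1 q hφ
    simp only [desc_proj hinv]
    rw [show (fun w => strFun q F.1 w) = strFun q F.1 from rfl, h]
    simp only [halfEig]
    push_cast
    rfl
  · filter_upwards [Lp.coeFn_smul (2 * (halfEig n q : ℂ)) (eigMap G n q F), hae] with x h1 h2
    rw [h1, Pi.smul_apply, smul_eq_mul]
    congr 1

lemma dbarBInner_symm (f φ : S3 → ℂ) (z : S3) :
    dbarBInner f φ z = conj (dbarBInner φ f z) := by
  rw [dbarBInner_eq, dbarBInner_eq, map_mul, map_mul, Complex.conj_conj, Complex.conj_ofNat]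
  ring

/-- Symmetry of the closed operator against the strings. -/
lemma inner_eigMap_of_mem_kohnGraph {n q : ℕ} (F : semiInv G n q) {p : L2 G × L2 G}
    (hp : p ∈ kohnGraph G) :
    inner ℂ (eigMap G n q F) p.2 = (2 * (halfEig n q : ℂ)) * inner ℂ (eigMap G n q F) p.1 := by
  let ℓ : L2 G →L[ℂ] ℂ := innerSL ℂ (eigMap G n q F)
  let T : L2 G × L2 G →L[ℂ] ℂ := ℓ.comp (ContinuousLinearMap.snd ℂ _ _) -
    (2 * (halfEig n q : ℂ)) • ℓ.comp (ContinuousLinearMap.fst ℂ _ _)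
  have hT : ∀ p, T p = inner ℂ (eigMap G n q F) p.2 -
    (2 * (halfEig n q : ℂ)) * inner ℂ (eigMap G n q F) p.1 := fun p => rfl
  -- The relation is closed in the pair p, so it extends from smooth pairs to the closure of the
  -- graph.
  have hle : kohnGraph G ≤ LinearMap.ker (T : L2 G × L2 G →ₗ[ℂ] ℂ) := by
    refine Submodule.topologicalClosure_minimal _ (Submodule.span_le.2 ?_)
      (ContinuousLinearMap.isClosed_ker T)
    rintro ⟨p1, p2⟩ ⟨f, h, hf, hh, hfh, h1, h2⟩
    change T (p1, p2) = 0
    rw [hT, sub_eq_zero, inner_eigMap, inner_eigMap]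
    have e1 : ∫ z, conj (strFun q F.1 z) * p1 (proj G z) ∂surface =
        ∫ z, conj (strFun q F.1 z) * f (proj G z) ∂surface := by
      refine integral_congr_ae ?_
      filter_upwards [ae_surface_of_ae G h1] with z hz
      rw [hz]
    have e2 : ∫ z, conj (strFun q F.1 z) * p2 (proj G z) ∂surface =
        ∫ z, h (proj G z) * conj (strFun q F.1 z) ∂surface := by
      refine integral_congr_ae ?_
      filter_upwards [ae_surface_of_ae G h2] with z hz
      rw [hz, mul_comm]
    have hinv : ∀ g ∈ G, ∀ z, strFun q F.1 (g • z) = strFun q F.1 z :=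
      fun _ hg z => strFun_invariant F.2 hg z
    have hs : IsSmooth (desc G (strFun q F.1)) := by
      simp only [IsSmooth, desc_proj hinv]
      exact smooth_strFun q F.1
    have e3 := hfh _ hs
    simp only [desc_proj hinv] at e3
    have e4 := integral_dbarBInner_strFun F.2.1 q (φ := fun z => f (proj G z)) hf
    have e5 : ∫ z, dbarBInner (fun z => f (proj G z)) (strFun q F.1) z ∂surface =
        conj (∫ z, dbarBInner (strFun q F.1) (fun z => f (proj G z)) z ∂surface) := by
      rw [← integral_conj]
      simp only [← dbarBInner_symm]
    have e6 : conj (∫ z, 2 * ((q : ℂ) * (n + 1 - q)) * strFun q F.1 z * conj (f (proj G z))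
        ∂surface) = (2 * (halfEig n q : ℂ)) *
          ∫ z, conj (strFun q F.1 z) * f (proj G z) ∂surface := by
      rw [← integral_conj, ← integral_const_mul]
      congr 1
      ext z
      simp only [map_mul, map_sub, map_add, Complex.conj_conj, Complex.conj_natCast, map_one,
        Complex.conj_ofNat, halfEig]
      push_cast
      ring
    rw [e1, e2, e3, show (fun w => strFun q F.1 w) = strFun q F.1 from rfl, e5, e4, e6]
    ring
  have := hle hp
  have h3 : T p = 0 := this
  rw [hT, sub_eq_zero] at h3
  exact h3

instance finiteDimensional_semiInv (G : Subgroup U2) (n q : ℕ) :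
    FiniteDimensional ℂ (semiInv G n q) := by
  have hfg : FiniteDimensional ℂ (MvPolynomial.homogeneousSubmodule (Fin 2) ℂ n) :=
    Module.Finite.iff_fg.2 (MvPolynomial.homogeneousSubmodule_fg (R := ℂ) (Fin 2) n)
  exact Submodule.finiteDimensional_of_le (S₂ := MvPolynomial.homogeneousSubmodule (Fin 2) ℂ n)
    fun F hF => hF.1

variable (G)

/-- The degree of the forms with index `q` that contribute to the eigenvalue `2 m`. -/
def divDegree (m q : ℕ) : ℕ := m / q + q - 1

/-- The sum of the maps `eigMap` over the divisors `q` of `m`. -/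
def totalEigMap (m : ℕ) :
    (∀ q : m.divisors, semiInv G (divDegree m q) q) →ₗ[ℂ] L2 G :=
  ∑ q : m.divisors, (eigMap G (divDegree m q) q).comp (LinearMap.proj q)

variable {G}

lemma totalEigMap_apply (m : ℕ) (F : ∀ q : m.divisors, semiInv G (divDegree m q) q) :
    totalEigMap G m F = ∑ q : m.divisors, eigMap G (divDegree m q) q (F q) := by
  simp [totalEigMap]

lemma halfEig_divDegree {m q : ℕ} (hq : q ∈ m.divisors) : halfEig (divDegree m q) q = m := by
  rw [Nat.mem_divisors] at hq
  obtain ⟨⟨d, rfl⟩, hm⟩ := hq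
  have hq0 : 0 < q := Nat.pos_of_ne_zero (by rintro rfl; simp at hm)
  have hd0 : 0 < d := Nat.pos_of_ne_zero (by rintro rfl; simp at hm)
  rw [halfEig, divDegree, Nat.mul_div_cancel_left _ hq0, Nat.cast_sub (by omega)]
  push_cast
  ring

lemma totalEigMap_mem (m : ℕ) (F : ∀ q : m.divisors, semiInv G (divDegree m q) q) :
    totalEigMap G m F ∈ kohnEigenspace G (2 * m) := by
  rw [totalEigMap_apply]
  refine sum_mem fun q _ => ?_
  have h := eigMap_mem_kohnGraph (F q)
  rw [halfEig_divDegree q.2] at h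
  rw [mem_kohnEigenspace]
  push_cast at h ⊢
  exact h

lemma exists_divisor_of_halfEig {m n q : ℕ} (hm : 0 < m) (h : halfEig n q = m) :
    q ∈ m.divisors ∧ n = divDegree m q := by
  rw [halfEig] at h
  have hq : 0 < q := Nat.pos_of_ne_zero (by rintro rfl; simp at h; omega)
  have h1 : (0 : ℤ) < n + 1 - q := by
    by_contra h2
    push Not at h2
    have : (q : ℤ) * (n + 1 - q) ≤ 0 := mul_nonpos_of_nonneg_of_nonpos (by positivity) h2
    omega
  obtain ⟨d, hd⟩ : ∃ d : ℕ, n + 1 = q + d := ⟨n + 1 - q, by omega⟩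
  have h3 : m = q * d := by
    have : (n : ℤ) + 1 = q + d := by exact_mod_cast hd
    rw [this, add_sub_cancel_left] at h
    exact_mod_cast h.symm
  subst h3
  refine ⟨Nat.mem_divisors.2 ⟨dvd_mul_right _ _, hm.ne'⟩, ?_⟩
  rw [divDegree, Nat.mul_div_cancel_left _ hq]
  omega

/-- The range is finite-dimensional, so an eigenvector splits into a part in the range and an
eigenvector w orthogonal to it. Strings with the eigenvalue 2m lie in the range, and the others are
orthogonal to w by symmetry; hence w is orthogonal to all strings and vanishes. Positivity of m
excludes q = 0, which every degree n would allow. -/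
lemma range_totalEigMap {m : ℕ} (hm : 0 < m) :
    LinearMap.range (totalEigMap G m) = kohnEigenspace G (2 * m) := by
  apply le_antisymm
  · rintro _ ⟨F, rfl⟩
    exact totalEigMap_mem m F
  · intro u hu
    obtain ⟨y, hy, w, hw, rfl⟩ :=
      Submodule.exists_add_mem_mem_orthogonal (K := LinearMap.range (totalEigMap G m)) u
    have hy' : y ∈ kohnEigenspace G (2 * m) := by
      obtain ⟨F, rfl⟩ := hy
      exact totalEigMap_mem m F
    have hw' : w ∈ kohnEigenspace G (2 * m) := by
      have := sub_mem hu hy'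
      rwa [add_sub_cancel_left] at this
    have hw0 : w = 0 := by
      refine eq_zero_of_forall_inner_eigMap fun n q F => ?_
      by_cases h : halfEig n q = m
      · obtain ⟨hq, rfl⟩ := exists_divisor_of_halfEig hm h
        have hmem : eigMap G (divDegree m q) q F ∈ LinearMap.range (totalEigMap G m) := by
          classical
          refine ⟨Pi.single (⟨q, hq⟩ : m.divisors) F, ?_⟩
          rw [totalEigMap_apply, Finset.sum_eq_single (⟨q, hq⟩ : m.divisors)]
          · rw [Pi.single_eq_same]
          · intro b _ hb
            rw [Pi.single_eq_of_ne hb, map_zero]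
          · simp
        exact Submodule.inner_right_of_mem_orthogonal hmem hw
      · have h1 := inner_eigMap_of_mem_kohnGraph F ((mem_kohnEigenspace _ _).1 hw')
        simp only [inner_smul_right] at h1
        have h2 : ((2 * (m : ℂ)) - 2 * (halfEig n q : ℂ)) * inner ℂ (eigMap G n q F) w = 0 := by
          push_cast at h1
          linear_combination h1
        refine (mul_eq_zero.1 h2).resolve_left ?_
        rw [← mul_sub]
        refine mul_ne_zero two_ne_zero (sub_ne_zero.2 fun h3 => h ?_)
        exact_mod_cast h3.symm
    rw [hw0, add_zero]
    exact hy

/-- Scalar matrices of modulus one. -/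
def scalarU2 (c : ℂ) (hc : c * conj c = 1) : U2 :=
  ⟨c • 1, by
    rw [Matrix.mem_unitaryGroup_iff, star_smul, star_one, smul_mul_smul_comm, one_mul]
    simp [hc]⟩

lemma strFun_scalar {c : ℂ} (hc : c * conj c = 1) {n q : ℕ} {F : MvPolynomial (Fin 2) ℂ}
    (hF : F.IsHomogeneous n) (z : S3) :
    strFun q F (scalarU2 c hc • z) = c ^ ((n : ℤ) - 2 * q) * strFun q F z := by
  have h0 : c ≠ 0 := by rintro rfl; simp at hc
  rw [strFun_smul_arg]
  have h1 : ((scalarU2 c hc : U2) : Matrix (Fin 2) (Fin 2) ℂ) = c • 1 := rfl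
  rw [h1, formComp_smul_one c hF, strFun_smul, Matrix.det_smul, Matrix.det_one, zpow_sub₀ h0,
    zpow_natCast, zpow_mul, zpow_natCast]
  simp only [Fintype.card_fin, mul_one]
  rw [zpow_ofNat, div_eq_mul_inv, inv_pow]
  ring

/-- The weight n - 2q equals m/q - q - 1, which is strictly decreasing in q. -/
lemma divDegree_sub_injective (m : ℕ) {q q' : ℕ} (hq : q ∈ m.divisors) (hq' : q' ∈ m.divisors)
    (h : (divDegree m q : ℤ) - 2 * q = divDegree m q' - 2 * q') : q = q' := by
  have aux : ∀ {q q' : ℕ}, q ∈ m.divisors → q' ∈ m.divisors → q < q' →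
      (divDegree m q' : ℤ) - 2 * q' < divDegree m q - 2 * q := by
    intro q q' hq hq' hlt
    have h1 := Nat.pos_of_mem_divisors hq
    have h2 : m / q' ≤ m / q := Nat.div_le_div_left hlt.le h1
    rw [divDegree, divDegree]
    omega
  rcases lt_trichotomy q q' with hlt | heq | hlt
  · have := aux hq hq' hlt; omega
  · exact heq
  · have := aux hq' hq hlt; omega

lemma abs_divDegree_sub_le {m q : ℕ} (hq : q ∈ m.divisors) :
    |(divDegree m q : ℤ) - 2 * q| ≤ m + 1 := by
  have h1 := Nat.pos_of_mem_divisors hq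
  have h2 := Nat.divisor_le hq
  have h3 : m / q ≤ m := Nat.div_le_self m q
  rw [divDegree, abs_le]
  generalize m / q = d at h3 ⊢
  omega

/-- Scalar rotations of S³, which need not belong to G, act on the strings of the various q by
different characters c^(n - 2q). So a vanishing sum has vanishing summands, and each summand
determines its form. -/
lemma totalEigMap_injective {m : ℕ} (hm : 0 < m) : Function.Injective (totalEigMap G m) := by
  rw [← LinearMap.ker_eq_bot, LinearMap.ker_eq_bot']
  intro F hF
  -- the sum of the string functions vanishes on the sphere
  have h0 : ∀ z, ∑ q : m.divisors, strFun q (F q).1 z = 0 := by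
    have hae : (fun z => ∑ q : m.divisors, strFun q (F q).1 z) =ᵐ[surface] fun _ => 0 := by
      rw [totalEigMap_apply] at hF
      have h1 : ∀ᵐ x ∂quotMeasure G,
          ∑ q : m.divisors, eigMap G (divDegree m q) q (F q) x = 0 := by
        have h2 := Lp.coeFn_finsetSum (μ := quotMeasure G) (p := 2) Finset.univ
          (fun q : m.divisors => eigMap G (divDegree m q) q (F q))
        rw [hF] at h2
        filter_upwards [h2, Lp.coeFn_zero ℂ 2 (quotMeasure G)] with x hx hx0
        rw [hx0] at hx
        simpa using hx.symm
      have h3 : ∀ᵐ z ∂surface, ∀ q : m.divisors,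
          eigMap G (divDegree m q) q (F q) (proj G z) = strFun q (F q).1 z :=
        ae_all_iff.2 fun q => eigMap_ae (F q)
      filter_upwards [ae_surface_of_ae G h1, h3] with z hz hz3
      rw [← hz]
      exact Finset.sum_congr rfl fun q _ => (hz3 q).symm
    have hcont : Continuous fun z => ∑ q : m.divisors, strFun q (F q).1 z :=
      continuous_finsetSum _ fun q _ => continuous_strFun _ _
    exact congrFun ((Continuous.ae_eq_iff_eq surface hcont continuous_const).1 hae)
  -- rotation by a root of unity of large order separates the summands
  let M : ℕ := 2 * m + 3
  have hM : M ≠ 0 := by omega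
  let c : ℂ := Complex.exp (2 * Real.pi * Complex.I / M)
  have hprim : IsPrimitiveRoot c M := Complex.isPrimitiveRoot_exp M hM
  have hc : c * conj c = 1 := by
    rw [Complex.mul_conj, Complex.normSq_eq_norm_sq, hprim.norm'_eq_one hM]
    simp
  have hc0 : c ≠ 0 := hprim.ne_zero hM
  let T : Module.End ℂ (S3 → ℂ) :=
    { toFun := fun f z => f (scalarU2 c hc • z)
      map_add' := fun _ _ => rfl
      map_smul' := fun _ _ => rfl }
  let k : m.divisors → ℤ := fun q => (divDegree m q : ℤ) - 2 * (q : ℕ)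
  have hinj : Function.Injective fun q => c ^ k q := by
    intro q q' h
    have h1 : c ^ (k q - k q') = 1 := by
      rw [zpow_sub₀ hc0, div_eq_one_iff_eq (zpow_ne_zero _ hc0)]
      exact h
    rw [hprim.zpow_eq_one_iff_dvd] at h1
    have h2 := abs_le.1 (abs_divDegree_sub_le q.2)
    have h3 := abs_le.1 (abs_divDegree_sub_le q'.2)
    -- Both exponents are at most m + 1 in absolute value, so they differ by at most 2m + 2, which
    -- is less than the order M = 2m + 3 of the root of unity.
    have h4 : k q - k q' = 0 := by
      apply Int.eq_zero_of_abs_lt_dvd h1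
      rw [abs_lt]
      simp only [k, M]
      push_cast
      omega
    exact Subtype.ext (divDegree_sub_injective m q.2 q'.2 (sub_eq_zero.1 h4))
  have hzero : ∀ q : m.divisors, strFun q (F q).1 = 0 := by
    by_contra hne
    push Not at hne
    obtain ⟨q₀, hq₀⟩ := hne
    let S := {q : m.divisors // strFun q (F q).1 ≠ 0}
    have hli := Module.End.eigenvectors_linearIndependent' T (fun q : S => c ^ k q.1)
      (hinj.comp Subtype.val_injective) (fun q : S => strFun q.1 (F q.1).1) (by
        intro q
        refine ⟨Module.End.mem_eigenspace_iff.2 ?_, q.2⟩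
        ext z
        exact strFun_scalar hc (F q.1).2.1 z)
    classical
    have hsum : ∑ q : S, (1 : ℂ) • strFun q.1 (F q.1).1 = 0 := by
      ext z
      rw [Finset.sum_apply, Pi.zero_apply, ← h0 z]
      simp only [one_smul]
      rw [← Finset.sum_subtype (Finset.univ.filter fun q : m.divisors => strFun q (F q).1 ≠ 0)
        (by simp) fun q : m.divisors => strFun q (F q).1 z]
      refine Finset.sum_filter_of_ne fun q _ hq hq' => hq ?_
      rw [hq']
      rfl
    exact one_ne_zero (Fintype.linearIndependent_iff.1 hli (fun _ => 1) hsum ⟨q₀, hq₀⟩)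
  ext1 q
  apply Subtype.ext
  have hq1 := Nat.pos_of_mem_divisors q.2
  have hle : (q : ℕ) ≤ divDegree m q := by
    have : 0 < m / (q : ℕ) := Nat.div_pos (Nat.divisor_le q.2) hq1
    rw [divDegree]
    omega
  exact eq_zero_of_strFun_eq_zero (F q).2.1 hle (congrFun (hzero q))

/-- The multiplicity of `2 m` in the spectrum, in terms of semi-invariant binary forms. -/
theorem multiplicity_eq (G : Subgroup U2) [Finite G] {m : ℕ} (hm : 0 < m) :
    multiplicity G (2 * m) =
      (∑ q ∈ m.divisors, Module.finrank ℂ (semiInv G (divDegree m q) q) : ℕ) := by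
  rw [multiplicity, ← range_totalEigMap hm, rank_range_of_injective _ (totalEigMap_injective hm),
    ← Module.finrank_eq_rank, Module.finrank_pi_fintype,
    ← Finset.sum_coe_sort m.divisors fun q => Module.finrank ℂ (semiInv G (divDegree m q) q)]

end Eigenspaces

/-! ### Finite groups in which commuting is transitive off a central subgroup -/

section ClassSum

variable {K : Type*} [Group K]

/-- Commuting is a transitive relation outside the central subgroup `Z`, and the normalizer of the
centralizer of an element outside `Z` contains this centralizer with index at most two. -/
structure IsCA (Z : Subgroup K) : Prop where
  le_center : Z ≤ Subgroup.center K
  trans : ∀ a ∉ Z, ∀ b c, Commute a b → Commute a c → Commute b c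
  swap : ∀ a ∉ Z, ∀ g g', Commute a (g * a * g⁻¹) → Commute a (g' * a * g'⁻¹) →
    ¬Commute a g → ¬Commute a g' → Commute a (g * g')

/-- The centralizers of the elements outside `Z`. -/
abbrev CentSub (Z : Subgroup K) : Type _ :=
  {C : Subgroup K // ∃ a, a ∉ Z ∧ C = Subgroup.centralizer {a}}

lemma mem_centralizer_singleton {a b : K} : b ∈ Subgroup.centralizer {a} ↔ Commute a b := by
  rw [Subgroup.mem_centralizer_iff]
  simp [Commute, SemiconjBy]

variable {Z : Subgroup K}

lemma IsCA.conj_notMem (h : IsCA Z) {a : K} (ha : a ∉ Z) (g : K) : g * a * g⁻¹ ∉ Z := by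
  intro h1
  have h2 := Subgroup.mem_center_iff.1 (h.le_center h1) g⁻¹
  apply ha
  have : a = g * a * g⁻¹ := by
    have h3 : g⁻¹ * (g * a * g⁻¹) * g = g * a * g⁻¹ * g⁻¹ * g := by rw [h2]
    simpa [mul_assoc] using h3
  rwa [this]

lemma IsCA.centralizer_eq (h : IsCA Z) {a b : K} (ha : a ∉ Z) (hb : b ∉ Z) (hab : Commute a b) :
    Subgroup.centralizer {a} = Subgroup.centralizer {b} := by
  ext c
  rw [mem_centralizer_singleton, mem_centralizer_singleton]
  exact ⟨fun hc => h.trans a ha b c hab hc, fun hc => h.trans b hb a c hab.symm hc⟩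

lemma IsCA.le_centSub (h : IsCA Z) (C : CentSub Z) : Z ≤ C.1 := by
  obtain ⟨C, a, ha, rfl⟩ := C
  intro z hz
  rw [mem_centralizer_singleton]
  exact Subgroup.mem_center_iff.1 (h.le_center hz) a

/-- The sum of a function over a group, by centralizers. -/
lemma IsCA.sum_eq (h : IsCA Z) [Fintype K] [Fintype (CentSub Z)] [DecidableEq K]
    [∀ H : Subgroup K, DecidablePred (· ∈ H)] {E : Type*} [AddCommGroup E] (f : K → E) :
    ∑ g, f g = ∑ g with g ∈ Z, f g +
      ∑ C : CentSub Z, (∑ g with g ∈ C.1, f g - ∑ g with g ∈ Z, f g) := by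
  classical
  have h1 : ∀ C : CentSub Z, ∑ g with g ∈ C.1, f g - ∑ g with g ∈ Z, f g =
      ∑ g with g ∉ Z ∧ g ∈ C.1, f g := by
    intro C
    rw [sub_eq_iff_eq_add]
    rw [← Finset.sum_filter_add_sum_filter_not (Finset.univ.filter (· ∈ C.1)) (· ∉ Z)]
    rw [Finset.filter_filter, Finset.filter_filter]
    congr 1
    · congr 1; ext g; simp [and_comm]
    · congr 1; ext g
      simp only [Finset.mem_filter, Finset.mem_univ, true_and, not_not]
      exact ⟨fun h => h.2, fun hg => ⟨h.le_centSub C hg, hg⟩⟩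
  simp only [h1]
  rw [← Finset.sum_filter_add_sum_filter_not Finset.univ (· ∈ Z)]
  congr 1
  have h2 : ∀ C : CentSub Z, ∑ g with g ∉ Z ∧ g ∈ C.1, f g =
      ∑ g with g ∉ Z, if g ∈ C.1 then f g else 0 := by
    intro C
    rw [← Finset.sum_filter, Finset.filter_filter]
  simp only [h2]
  rw [Finset.sum_comm]
  refine Finset.sum_congr rfl fun g hg => ?_
  rw [Finset.mem_filter] at hg
  -- An element outside Z lies in exactly one of the centralizers, namely its own.
  rw [Finset.sum_eq_single (⟨Subgroup.centralizer {g}, g, hg.2, rfl⟩ : CentSub Z)]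
  · rw [if_pos (mem_centralizer_singleton.2 (Commute.refl g))]
  · rintro ⟨C, a, ha, rfl⟩ _ hne
    rw [if_neg]
    intro hmem
    rw [mem_centralizer_singleton] at hmem
    apply hne
    exact Subtype.ext (h.centralizer_eq ha hg.2 hmem)
  · simp

lemma centralizer_conj (g a : K) : Subgroup.centralizer {g * a * g⁻¹} =
    (Subgroup.centralizer {a}).map (MulAut.conj g).toMonoidHom := by
  ext b
  rw [mem_centralizer_singleton, Subgroup.mem_map]
  constructor
  · intro hb
    refine ⟨g⁻¹ * b * g, ?_, by simp [mul_assoc]⟩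
    rw [mem_centralizer_singleton]
    have := hb.map (MulAut.conj g⁻¹).toMonoidHom
    simpa [mul_assoc] using this
  · rintro ⟨c, hc, rfl⟩
    rw [mem_centralizer_singleton] at hc
    exact hc.map (MulAut.conj g).toMonoidHom

/-- Conjugation on the centralizers of the elements outside `Z`. -/
@[reducible] def centSubAction (h : IsCA Z) : MulAction K (CentSub Z) where
  smul g C := ⟨C.1.map (MulAut.conj g).toMonoidHom, by
    obtain ⟨C, a, ha, rfl⟩ := C
    exact ⟨g * a * g⁻¹, h.conj_notMem ha g, (centralizer_conj g a).symm⟩⟩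
  one_smul C := by
    apply Subtype.ext
    change C.1.map (MulAut.conj (1 : K)).toMonoidHom = C.1
    rw [map_one]
    exact Subgroup.map_id _
  mul_smul g g' C := by
    apply Subtype.ext
    change C.1.map (MulAut.conj (g * g')).toMonoidHom =
      (C.1.map (MulAut.conj g').toMonoidHom).map (MulAut.conj g).toMonoidHom
    rw [Subgroup.map_map, map_mul]
    rfl

lemma card_smul_centSub (h : IsCA Z) (g : K) (C : CentSub Z) :
    Nat.card ((centSubAction h).smul g C).1 = Nat.card C.1 :=
  Nat.card_congr (C.1.equivMapOfInjective _ (MulAut.conj g).injective).symm.toEquiv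

/-- Commuting elements outside Z have equal centralizers, so the conjugate centralizer is the
original one as soon as gag⁻¹ commutes with a. -/
lemma mem_stabilizer_centSub (h : IsCA Z) {a : K} (ha : a ∉ Z) (g : K) :
    (centSubAction h).smul g ⟨Subgroup.centralizer {a}, a, ha, rfl⟩ =
      ⟨Subgroup.centralizer {a}, a, ha, rfl⟩ ↔ Commute a (g * a * g⁻¹) := by
  constructor
  · intro h1
    have h2 := congrArg Subtype.val h1
    have h3 : g * a * g⁻¹ ∈ Subgroup.centralizer {a} := by
      refine (congrArg (g * a * g⁻¹ ∈ ·) h2).mp ?_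
      exact ⟨a, mem_centralizer_singleton.2 (Commute.refl a), rfl⟩
    exact mem_centralizer_singleton.1 h3
  · intro h1
    apply Subtype.ext
    have h2 := ((centSubAction h).smul g ⟨Subgroup.centralizer {a}, a, ha, rfl⟩).2
    obtain ⟨b, hb, hb2⟩ := h2
    have h3 : g * a * g⁻¹ ∈ Subgroup.centralizer {b} := by
      rw [← hb2]
      exact ⟨a, mem_centralizer_singleton.2 (Commute.refl a), rfl⟩
    rw [mem_centralizer_singleton] at h3
    rw [hb2, h.centralizer_eq hb (h.conj_notMem ha g) h3,
      h.centralizer_eq (h.conj_notMem ha g) ha h1.symm]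

/-- The index of a centralizer in its normalizer is one or two. -/
lemma exists_card_stabilizer (h : IsCA Z) [Finite K] (C : CentSub Z) :
    ∃ w : ℕ, Nat.card (@MulAction.stabilizer K _ _ (centSubAction h) C) = w * Nat.card C.1 ∧
      (w = 1 ∨ w = 2 ∧ ∀ a ∉ Z, C.1 = Subgroup.centralizer {a} →
        ∃ g, Commute a (g * a * g⁻¹) ∧ ¬Commute a g) := by
  let := centSubAction h
  obtain ⟨C, a, ha, rfl⟩ := C
  set x : CentSub Z := ⟨Subgroup.centralizer {a}, a, ha, rfl⟩ with hx
  have hst : ∀ g, g ∈ MulAction.stabilizer K x ↔ Commute a (g * a * g⁻¹) := fun g =>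
    MulAction.mem_stabilizer_iff.trans (mem_stabilizer_centSub h ha g)
  have hle : Subgroup.centralizer {a} ≤ MulAction.stabilizer K x := by
    intro g hg
    rw [mem_centralizer_singleton] at hg
    rw [hst, ← hg.eq, mul_inv_cancel_right]
  by_cases hg : ∃ g, Commute a (g * a * g⁻¹) ∧ ¬Commute a g
  · refine ⟨2, ?_, Or.inr ⟨rfl, ?_⟩⟩
    · have hidx : (Subgroup.centralizer {a}).relIndex (MulAction.stabilizer K x) = 2 := by
        -- By `swap` the product of two elements of the stabilizer outside the centralizer lies in
        -- the centralizer.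
        rw [Subgroup.relIndex, Subgroup.index_eq_two_iff]
        obtain ⟨g, hg1, hg2⟩ := hg
        refine ⟨⟨g, (hst g).2 hg1⟩, ?_⟩
        rintro ⟨b, hb⟩
        rw [hst] at hb
        simp only [Subgroup.mem_subgroupOf, Subgroup.coe_mul, mem_centralizer_singleton]
        by_cases hab : Commute a b
        · refine Or.inr ⟨hab, fun hc => hg2 ?_⟩
          have := (hab.inv_right).mul_right hc
          simpa using this
        · exact Or.inl ⟨h.swap a ha b g hb hg1 hab hg2, hab⟩
      have := Subgroup.card_mul_index ((Subgroup.centralizer {a}).subgroupOf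
        (MulAction.stabilizer K x))
      rw [← Subgroup.relIndex, hidx, Nat.card_congr (Subgroup.subgroupOfEquivOfLe hle).toEquiv]
        at this
      rw [← this, mul_comm]
    · intro b hb hab
      obtain ⟨g, hg1, hg2⟩ := hg
      have hab' : Commute a b := by
        have : b ∈ Subgroup.centralizer {a} := by
          rw [show Subgroup.centralizer {a} = Subgroup.centralizer {b} from hab]
          exact mem_centralizer_singleton.2 (Commute.refl b)
        exact mem_centralizer_singleton.1 this
      refine ⟨g, ?_, fun hbg => hg2 (h.trans b hb a g hab'.symm hbg)⟩
      have h1 : Commute (g * a * g⁻¹) (g * b * g⁻¹) := hab'.map (MulAut.conj g).toMonoidHom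
      have h2 := h.trans _ (h.conj_notMem ha g) a (g * b * g⁻¹) hg1.symm h1
      exact h.trans a ha b _ hab' h2
  · refine ⟨1, ?_, Or.inl rfl⟩
    rw [one_mul]
    have : MulAction.stabilizer K x = Subgroup.centralizer {a} := by
      apply le_antisymm _ hle
      intro g hgs
      rw [hst] at hgs
      rw [mem_centralizer_singleton]
      by_contra hc
      exact hg ⟨g, hgs, hc⟩
    rw [this]

/-- Transitivity of commuting is inherited by subgroups. -/
lemma IsCA.subgroupOf (h : IsCA Z) (H : Subgroup K) : IsCA (Z.subgroupOf H) where
  le_center := by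
    intro a ha
    rw [Subgroup.mem_center_iff]
    intro b
    exact Subtype.ext (Subgroup.mem_center_iff.1 (h.le_center (Subgroup.mem_subgroupOf.1 ha)) b)
  trans := by
    intro a ha b c hab hac
    exact Subtype.ext (h.trans a (fun h' => ha (Subgroup.mem_subgroupOf.2 h')) b c
      (hab.map H.subtype) (hac.map H.subtype))
  swap := by
    intro a ha g g' h1 h2 h3 h4
    exact Subtype.ext (h.swap a (fun h' => ha (Subgroup.mem_subgroupOf.2 h')) g g'
      (h1.map H.subtype) (h2.map H.subtype) (fun h' => h3 (Subtype.ext h'))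
      (fun h' => h4 (Subtype.ext h')))

/-- The order of a centralizer relative to `Z`. -/
def CentSub.relCard (C : CentSub Z) : ℕ := Nat.card C.1 / Nat.card Z

lemma IsCA.relCard_mul (h : IsCA Z) (C : CentSub Z) :
    C.relCard * Nat.card Z = Nat.card C.1 :=
  Nat.div_mul_cancel (Subgroup.card_dvd_of_le (h.le_centSub C))

lemma IsCA.two_le_relCard (h : IsCA Z) [Finite K] (C : CentSub Z) : 2 ≤ C.relCard := by
  have h1 := h.relCard_mul C
  have h2 : Nat.card Z < Nat.card C.1 := by
    apply lt_of_le_of_ne (Subgroup.card_le_of_le (h.le_centSub C))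
    intro h3
    have h4 := Subgroup.eq_of_le_of_card_ge (h.le_centSub C) h3.ge
    obtain ⟨C, a, ha, rfl⟩ := C
    apply ha
    change Z = Subgroup.centralizer {a} at h4
    rw [h4]
    exact mem_centralizer_singleton.2 (Commute.refl a)
  by_contra hc
  have : C.relCard ≤ 1 := by omega
  nlinarith

/-- The sum over the centralizers of a function of their orders, by conjugacy classes. -/
lemma IsCA.exists_multiset (h : IsCA Z) [Finite K] [Fintype (CentSub Z)] :
    ∃ M : Multiset ℕ, (∀ F : ℕ → ℚ, 2 * ∑ C : CentSub Z, (Nat.card C.1 : ℚ) * F C.relCard =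
        Nat.card K * (M.map F).sum) ∧ (∀ k ∈ M, ∃ C : CentSub Z, k = C.relCard) ∧
      ∀ C : CentSub Z, M.count C.relCard ≤ 1 → ∀ a ∉ Z, C.1 = Subgroup.centralizer {a} →
        ∃ g, Commute a (g * a * g⁻¹) ∧ ¬Commute a g := by
  classical
  have := Fintype.ofFinite K
  let := centSubAction h
  choose w hw hw2 using exists_card_stabilizer h
  have hrel : ∀ (g : K) (C : CentSub Z), (g • C).relCard = C.relCard := fun g C =>
    congrArg (· / Nat.card Z) (card_smul_centSub h g C)
  have hcard : ∀ (g : K) (C : CentSub Z), Nat.card (g • C).1 = Nat.card C.1 :=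
    fun g C => card_smul_centSub h g C
  let Ω := Quotient (MulAction.orbitRel K (CentSub Z))
  have hsum : ∀ f : CentSub Z → ℚ, (∀ (g : K) C, f (g • C) = f C) →
      ∑ C, f C = ∑ o : Ω, (Nat.card (MulAction.orbit K o.out) : ℚ) * f o.out := by
    intro f hf
    rw [← (MulAction.selfEquivSigmaOrbits K (CentSub Z)).symm.sum_comp, Fintype.sum_sigma]
    refine Finset.sum_congr rfl fun o _ => ?_
    rw [Nat.card_eq_fintype_card, ← nsmul_eq_mul, ← Finset.card_univ, ← Finset.sum_const]
    refine Finset.sum_congr rfl ?_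
    rintro ⟨_, g, rfl⟩ _
    exact hf g _
  have hw0 : ∀ C, w C = 1 ∨ w C = 2 := fun C => (hw2 C).imp_right And.left
  -- The orbit of C has |K| / (w |C|) members and contributes |K| F / w to the sum. After doubling,
  -- it accounts for 2 / w copies of its order.
  refine ⟨∑ o : Ω, Multiset.replicate (2 / w o.out) o.out.relCard, ?_, ?_, ?_⟩
  · intro F
    rw [hsum (fun C => (Nat.card C.1 : ℚ) * F C.relCard)
      (fun g C => by simp only [hrel, hcard]), ← Multiset.coe_mapAddMonoidHom, map_sum,
      ← Multiset.coe_sumAddMonoidHom, map_sum, Finset.mul_sum, Finset.mul_sum]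
    refine Finset.sum_congr rfl fun o _ => ?_
    have h1 := MulAction.card_orbit_mul_card_stabilizer_eq_card_group K o.out
    rw [← Nat.card_eq_fintype_card, ← Nat.card_eq_fintype_card, ← Nat.card_eq_fintype_card,
      hw] at h1
    rw [← h1]
    simp only [Multiset.coe_mapAddMonoidHom, Multiset.coe_sumAddMonoidHom, Multiset.map_replicate,
      Multiset.sum_replicate, nsmul_eq_mul]
    rcases hw0 o.out with h2 | h2 <;> rw [h2] <;> push_cast <;> ring
  · intro k hk
    rw [Multiset.mem_sum] at hk
    obtain ⟨o, -, ho⟩ := hk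
    exact ⟨o.out, Multiset.eq_of_mem_replicate ho⟩
  · intro C hC
    let o : Ω := Quotient.mk _ C
    have ho : (MulAction.orbitRel K (CentSub Z)).r o.out C := Quotient.mk_out C
    obtain ⟨g, hg⟩ := ho
    have hg : g • C = o.out := hg
    -- An orbit with w = 1 enters the multiset twice.
    have h1 : w o.out = 2 := by
      rcases hw0 o.out with h2 | h2
      · exfalso
        rw [Multiset.count_sum'] at hC
        have h3 := Finset.single_le_sum (f := fun o : Ω => Multiset.count C.relCard
          (Multiset.replicate (2 / w o.out) o.out.relCard)) (fun _ _ => Nat.zero_le _)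
          (Finset.mem_univ o)
        simp only [← hg, hrel, Multiset.count_replicate_self] at h3
        rw [hg, h2] at h3
        omega
      · exact h2
    have h4 : w C = 2 := by
      have h5 : Nat.card (MulAction.stabilizer K C) =
          Nat.card (MulAction.stabilizer K o.out) := by
        rw [← hg]
        exact Nat.card_congr (MulAction.stabilizerEquivStabilizer rfl).toEquiv
      rw [hw, hw, ← hg, hcard, hg, h1] at h5
      exact Nat.eq_of_mul_eq_mul_right Nat.card_pos h5
    rcases hw2 C with h5 | h5
    · omega
    · exact h5.2

/-- This is the equation for the isotropy orders of a finite rotation group of order N. The sum of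
the reciprocals exceeds 1, which forces a = 2, then b < 4, and c < 6 when b = 3. -/
lemma triple_arith {a b c N : ℕ} (ha : 2 ≤ a) (hab : a ≤ b) (hbc : b ≤ c) (hN : 0 < N)
    (h : (1 : ℚ) / a + 1 / b + 1 / c = 1 + 2 / N) :
    a = 2 ∧ b = 2 ∧ N = 2 * c ∨ a = 2 ∧ b = 3 ∧
      (c = 3 ∧ N = 12 ∨ c = 4 ∧ N = 24 ∨ c = 5 ∧ N = 60) := by
  have hNq : (0 : ℚ) < 2 / N := by positivity
  have hle : ∀ {k l : ℕ}, 0 < k → k ≤ l → (1 : ℚ) / l ≤ 1 / k := fun hk hkl =>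
    one_div_le_one_div_of_le (by exact_mod_cast hk) (by exact_mod_cast hkl)
  have ha2 : a = 2 := by
    by_contra hne
    have h1 := hle (by norm_num) (show 3 ≤ a by omega)
    have h2 := hle (by norm_num) (show 3 ≤ b by omega)
    have h3 := hle (by norm_num) (show 3 ≤ c by omega)
    norm_num at h1 h2 h3 h
    linarith
  subst ha2
  have hN' : (N : ℚ) ≠ 0 := by positivity
  have hb : b < 4 := by
    by_contra hne
    have h2 := hle (by norm_num) (show 4 ≤ b by omega)
    have h3 := hle (by norm_num) (show 4 ≤ c by omega)
    norm_num at h2 h3 h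
    linarith
  have hc0 : (c : ℚ) ≠ 0 := by exact_mod_cast (by omega : c ≠ 0)
  interval_cases b
  · left
    refine ⟨rfl, rfl, ?_⟩
    field_simp at h
    have : (N : ℚ) = 2 * c := by push_cast at h; linarith
    exact_mod_cast this
  · right
    refine ⟨rfl, rfl, ?_⟩
    have hc : c < 6 := by
      by_contra hne
      have h3 := hle (by norm_num) (show 6 ≤ c by omega)
      norm_num at h3 h
      linarith
    field_simp at h
    interval_cases c
    · refine Or.inl ⟨rfl, ?_⟩
      have : (N : ℚ) = 12 := by push_cast at h; linarith
      exact_mod_cast this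
    · refine Or.inr (Or.inl ⟨rfl, ?_⟩)
      have : (N : ℚ) = 24 := by push_cast at h; linarith
      exact_mod_cast this
    · refine Or.inr (Or.inr ⟨rfl, ?_⟩)
      have : (N : ℚ) = 60 := by push_cast at h; linarith
      exact_mod_cast this

lemma exists_sorted_triple {M : Multiset ℕ} (hM : Multiset.card M = 3) :
    ∃ a b c, a ≤ b ∧ b ≤ c ∧ M = {a, b, c} := by
  have h1 := Multiset.sort_eq M (· ≤ ·)
  have h2 := Multiset.pairwise_sort M (· ≤ ·)
  have h3 : (M.sort (· ≤ ·)).length = 3 := by rw [Multiset.length_sort, hM]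
  obtain ⟨a, b, c, habc⟩ := List.length_eq_three.1 h3
  rw [habc] at h1 h2
  simp only [List.pairwise_cons, List.mem_cons, List.not_mem_nil, or_false] at h2
  exact ⟨a, b, c, h2.1 b (Or.inl rfl), h2.2.1 c rfl, h1.symm⟩

/-- The orders, relative to `Z`, of the centralizers in a noncommutative group in which commuting
is transitive outside `Z`: up to conjugacy these are the isotropy orders of a finite rotation
group. -/
theorem IsCA.exists_triple (h : IsCA Z) [Finite K] [Fintype (CentSub Z)]
    (hK : ∃ a b : K, ¬Commute a b) : ∃ k₁ k₂ k₃ : ℕ,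
      (∀ F : ℕ → ℚ, 2 * ∑ C : CentSub Z, (Nat.card C.1 : ℚ) * F C.relCard =
        Nat.card K * (F k₁ + F k₂ + F k₃)) ∧
      (1 : ℚ) / k₁ + 1 / k₂ + 1 / k₃ = 1 + 2 / Z.index ∧
      (k₁ = 2 ∧ k₂ = 2 ∧ Z.index = 2 * k₃ ∨ k₁ = 2 ∧ k₂ = 3 ∧
        (k₃ = 3 ∧ Z.index = 12 ∨ k₃ = 4 ∧ Z.index = 24 ∨ k₃ = 5 ∧ Z.index = 60)) ∧
      ∀ C : CentSub Z, Multiset.count C.relCard {k₁, k₂, k₃} ≤ 1 →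
        ∀ a ∉ Z, C.1 = Subgroup.centralizer {a} → ∃ g, Commute a (g * a * g⁻¹) ∧ ¬Commute a g := by
  classical
  have := Fintype.ofFinite K
  obtain ⟨M, hM1, hM2, hM3⟩ := h.exists_multiset
  have hz : (0 : ℚ) < Nat.card Z := by exact_mod_cast Nat.card_pos
  have hzN : (Nat.card Z : ℚ) * Z.index = Nat.card K := by exact_mod_cast Z.card_mul_index
  have hN0 : 0 < Z.index := Nat.pos_of_ne_zero Subgroup.index_ne_zero_of_finite
  have hNq : (0 : ℚ) < Z.index := by exact_mod_cast hN0
  have hC2 : ∀ C : CentSub Z, 2 ≤ C.relCard := h.two_le_relCard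
  have hCN : ∀ C : CentSub Z, C.relCard < Z.index := by
    intro C
    have h1 : Nat.card C.1 < Nat.card K := by
      apply lt_of_le_of_ne (Subgroup.card_le_card_group _)
      intro h3
      have h4 := Subgroup.eq_top_of_card_eq _ h3
      obtain ⟨C, a, ha, rfl⟩ := C
      change Subgroup.centralizer {a} = ⊤ at h4
      obtain ⟨b, c, hbc⟩ := hK
      have h5 : ∀ b, Commute a b := fun b => by
        rw [← mem_centralizer_singleton, h4]; trivial
      exact hbc (h.trans a ha b c (h5 b) (h5 c))
    rw [← h.relCard_mul, ← Z.card_mul_index, mul_comm] at h1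
    exact Nat.lt_of_mul_lt_mul_left h1
  -- Class equation: C has |C| - |Z| = |C|(1 - 1/k) elements outside Z, where k is its relative
  -- order.
  have h1 : (M.map fun k : ℕ => (1 : ℚ) - 1 / k).sum = 2 - 2 / Z.index := by
    have h2 := h.sum_eq (fun _ => (1 : ℚ))
    have h3 : ∀ H : Subgroup K, ∑ g with g ∈ H, (1 : ℚ) = Nat.card H := by
      intro H
      rw [Finset.sum_const, nsmul_one, Nat.card_eq_fintype_card, Fintype.card_subtype]
    simp only [h3] at h2
    rw [Finset.sum_const, nsmul_one, Finset.card_univ, ← Nat.card_eq_fintype_card] at h2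
    have h4 := hM1 (fun k => (1 : ℚ) - 1 / k)
    have h5 : ∀ C : CentSub Z, (Nat.card C.1 : ℚ) * (1 - 1 / C.relCard) =
        Nat.card C.1 - Nat.card Z := by
      intro C
      have : (0 : ℚ) < C.relCard := by exact_mod_cast (by have := hC2 C; omega)
      rw [← h.relCard_mul C]
      push_cast
      field_simp
    simp only [h5] at h4
    rw [eq_sub_of_add_eq' h2.symm, ← hzN] at h4
    field_simp at h4 ⊢
    linarith
  have hMb : ∀ k ∈ M, 2 ≤ k ∧ k < Z.index := by
    intro k hk
    obtain ⟨C, rfl⟩ := hM2 k hk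
    exact ⟨hC2 C, hCN C⟩
  -- Each term 1 - 1/k is at least 1/2 and less than 1 - 1/N. Four terms would sum to at least 2,
  -- and two or fewer would stay below 2 - 2/N.
  have hcard : Multiset.card M = 3 := by
    have hup : (Multiset.card M : ℚ) * (1 / 2) ≤ (M.map fun k : ℕ => (1 : ℚ) - 1 / k).sum := by
      rw [← nsmul_eq_mul]
      have := Multiset.card_nsmul_le_sum (s := M.map fun k : ℕ => (1 : ℚ) - 1 / k) (a := 1 / 2) ?_
      · rwa [Multiset.card_map] at this
      · intro x hx
        obtain ⟨k, hk, rfl⟩ := Multiset.mem_map.1 hx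
        have : (1 : ℚ) / k ≤ 1 / 2 :=
          one_div_le_one_div_of_le (by norm_num) (by exact_mod_cast (hMb k hk).1)
        linarith
    have hlo : Multiset.card M ≤ 2 → (M.map fun k : ℕ => (1 : ℚ) - 1 / k).sum < 2 - 2 / Z.index := by
      intro hle
      have hlt : ∀ k ∈ M, (1 : ℚ) - 1 / k < 1 - 1 / Z.index := by
        intro k hk
        have h2 : (0 : ℚ) < k := by exact_mod_cast (by have := (hMb k hk).1; omega)
        have : (1 : ℚ) / Z.index < 1 / k :=
          one_div_lt_one_div_of_lt h2 (by exact_mod_cast (hMb k hk).2)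
        linarith
      have hN2 : (2 : ℚ) / Z.index = 1 / Z.index + 1 / Z.index := by ring
      have hN3 : (1 : ℚ) / Z.index < 1 := by
        obtain ⟨b, c, hbc⟩ := hK
        have hb : b ∉ Z := fun hb => hbc (Subgroup.mem_center_iff.1 (h.le_center hb) c).symm
        have h5 := hCN ⟨_, b, hb, rfl⟩
        have h6 := hC2 ⟨_, b, hb, rfl⟩
        rw [div_lt_one hNq]
        exact_mod_cast (by omega : 1 < Z.index)
      interval_cases hc : Multiset.card M
      · rw [Multiset.card_eq_zero] at hc
        subst hc
        simp only [Multiset.map_zero, Multiset.sum_zero]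
        linarith
      · obtain ⟨a, rfl⟩ := Multiset.card_eq_one.1 hc
        have := hlt a (by simp)
        simp only [Multiset.map_singleton, Multiset.sum_singleton]
        linarith
      · obtain ⟨a, b, rfl⟩ := Multiset.card_eq_two.1 hc
        have := hlt a (by simp)
        have := hlt b (by simp)
        simp only [Multiset.insert_eq_cons, Multiset.map_cons, Multiset.map_singleton,
          Multiset.sum_cons, Multiset.sum_singleton]
        linarith
    have h5 : ¬Multiset.card M ≤ 2 := fun hle => (hlo hle).ne h1
    have h6 : (0 : ℚ) < 2 / Z.index := by positivity
    have h7 : (Multiset.card M : ℚ) < 4 := by rw [h1] at hup; linarith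
    have h8 : Multiset.card M < 4 := by exact_mod_cast h7
    omega
  obtain ⟨a, b, c, hab, hbc, rfl⟩ := exists_sorted_triple hcard
  have h2 : (1 : ℚ) / a + 1 / b + 1 / c = 1 + 2 / Z.index := by
    simp only [Multiset.insert_eq_cons, Multiset.map_cons, Multiset.map_singleton,
      Multiset.sum_cons, Multiset.sum_singleton] at h1
    linarith
  refine ⟨a, b, c, ?_, h2, triple_arith (hMb a (by simp)).1 hab hbc hN0 h2, hM3⟩
  intro F
  rw [hM1 F]
  simp [Multiset.insert_eq_cons, add_assoc]

/-- The sum over the group of a function whose sums over the centralizers depend only on their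
orders. -/
lemma IsCA.two_mul_sum (h : IsCA Z) [Fintype K] [Fintype (CentSub Z)] [DecidableEq K]
    [∀ H : Subgroup K, DecidablePred (· ∈ H)] {k₁ k₂ k₃ : ℕ}
    (hk : ∀ F : ℕ → ℚ, 2 * ∑ C : CentSub Z, (Nat.card C.1 : ℚ) * F C.relCard =
        Nat.card K * (F k₁ + F k₂ + F k₃))
    (hk' : (1 : ℚ) / k₁ + 1 / k₂ + 1 / k₃ = 1 + 2 / Z.index) (f : K → ℂ) (D : ℕ → ℚ) (d : ℚ)
    (hZ : ∑ g with g ∈ Z, f g = ((Nat.card Z * d : ℚ) : ℂ))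
    (hC : ∀ C : CentSub Z, ∑ g with g ∈ C.1, f g = ((Nat.card C.1 * D C.relCard : ℚ) : ℂ)) :
    2 * ∑ g, f g = ((Nat.card K * (D k₁ + D k₂ + D k₃ - d) : ℚ) : ℂ) := by
  have hN0 : 0 < Z.index := Nat.pos_of_ne_zero Subgroup.index_ne_zero_of_finite
  have hNq : (0 : ℚ) < Z.index := by exact_mod_cast hN0
  have hzN : (Nat.card Z : ℚ) * Z.index = Nat.card K := by exact_mod_cast Z.card_mul_index
  rw [h.sum_eq f, hZ]
  simp only [hC]
  have h1 := hk (fun k => D k - d / k)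
  have h5 : ∀ C : CentSub Z, (Nat.card C.1 : ℚ) * (D C.relCard - d / C.relCard) =
      Nat.card C.1 * D C.relCard - Nat.card Z * d := by
    intro C
    have : (0 : ℚ) < C.relCard := by exact_mod_cast (by have := h.two_le_relCard C; omega)
    rw [← h.relCard_mul C]
    push_cast
    field_simp
  simp only [h5] at h1
  have h6 : 2 * (Nat.card Z * d + ∑ C : CentSub Z, (Nat.card C.1 * D C.relCard - Nat.card Z * d)) =
      Nat.card K * (D k₁ + D k₂ + D k₃ - d) := by
    rw [mul_add, h1]
    have h7 : d / k₁ + d / k₂ + d / k₃ = d * (1 + 2 / Z.index) := by rw [← hk']; ring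
    have h8 : D k₁ - d / k₁ + (D k₂ - d / k₂) + (D k₃ - d / k₃) =
      D k₁ + D k₂ + D k₃ - d * (1 + 2 / Z.index) := by rw [← h7]; ring
    rw [h8, ← hzN]
    field_simp
    ring
  rw [← h6]
  push_cast
  rfl

end ClassSum

/-! ### Two by two matrices -/

section MatrixFacts

open Matrix

lemma sq_eq_trace_smul_sub (A : Matrix (Fin 2) (Fin 2) ℂ) :
    A * A = A.trace • A - A.det • (1 : Matrix (Fin 2) (Fin 2) ℂ) := by
  ext i j
  fin_cases i <;> fin_cases j <;>
    simp [Matrix.mul_apply, Matrix.trace, Matrix.det_fin_two, Fin.sum_univ_two] <;> ring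

lemma unitary_entries (g : U2) :
    (g : Matrix (Fin 2) (Fin 2) ℂ) 1 1 = (g : Matrix (Fin 2) (Fin 2) ℂ).det *
      conj ((g : Matrix (Fin 2) (Fin 2) ℂ) 0 0) ∧
    (g : Matrix (Fin 2) (Fin 2) ℂ) 0 0 = (g : Matrix (Fin 2) (Fin 2) ℂ).det *
      conj ((g : Matrix (Fin 2) (Fin 2) ℂ) 1 1) ∧
    (g : Matrix (Fin 2) (Fin 2) ℂ) 1 0 = -(g : Matrix (Fin 2) (Fin 2) ℂ).det *
      conj ((g : Matrix (Fin 2) (Fin 2) ℂ) 0 1) ∧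
    (g : Matrix (Fin 2) (Fin 2) ℂ) 0 1 = -(g : Matrix (Fin 2) (Fin 2) ℂ).det *
      conj ((g : Matrix (Fin 2) (Fin 2) ℂ) 1 0) := by
  obtain ⟨A, hA⟩ := g
  have h1 : A * Aᴴ = 1 := Matrix.mem_unitaryGroup_iff.1 hA
  have h2 : A.adjugate = A.det • Aᴴ := by
    calc A.adjugate = A.adjugate * (A * Aᴴ) := by rw [h1, mul_one]
      _ = A.det • Aᴴ := by rw [← mul_assoc, Matrix.adjugate_mul, smul_mul_assoc, one_mul]
  rw [Matrix.adjugate_fin_two] at h2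
  have e := fun i j => congrFun (congrFun h2 i) j
  have e00 := e 0 0
  have e01 := e 0 1
  have e10 := e 1 0
  have e11 := e 1 1
  simp [Matrix.conjTranspose_apply] at e00 e01 e10 e11
  refine ⟨e00, e11, ?_, ?_⟩
  · simp only [neg_mul, ← e10, neg_neg]
  · simp only [neg_mul, ← e01, neg_neg]

/-- The columns of the invertible matrix `P` are eigenvectors of `A` for `α` and `β`. -/
structure IsDiag (P A : Matrix (Fin 2) (Fin 2) ℂ) (α β : ℂ) : Prop where
  det_ne : P.det ≠ 0
  eq : A * P = P * Matrix.diagonal ![α, β]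

namespace IsDiag

variable {P A B : Matrix (Fin 2) (Fin 2) ℂ} {α β γ δ : ℂ}

lemma eq_conj (h : IsDiag P A α β) : A = P * Matrix.diagonal ![α, β] * P⁻¹ := by
  rw [← h.eq, Matrix.mul_nonsing_inv_cancel_right _ _ (isUnit_iff_ne_zero.2 h.det_ne)]

lemma congr (h : IsDiag P A α β) (h' : IsDiag P B α β) : A = B := by
  rw [h.eq_conj, h'.eq_conj]

lemma mul (h : IsDiag P A α β) (h' : IsDiag P B γ δ) : IsDiag P (A * B) (α * γ) (β * δ) := by
  refine ⟨h.det_ne, ?_⟩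
  rw [mul_assoc, h'.eq, ← mul_assoc, h.eq, mul_assoc, Matrix.diagonal_mul_diagonal]
  congr 2
  ext i; fin_cases i <;> rfl

lemma smul_one (hP : P.det ≠ 0) (c : ℂ) : IsDiag P (c • (1 : Matrix (Fin 2) (Fin 2) ℂ)) c c := by
  refine ⟨hP, ?_⟩
  have : Matrix.diagonal ![c, c] = c • (1 : Matrix (Fin 2) (Fin 2) ℂ) := by
    ext i j; fin_cases i <;> fin_cases j <;> simp
  rw [this]; simp

lemma pow (h : IsDiag P A α β) (n : ℕ) : IsDiag P (A ^ n) (α ^ n) (β ^ n) := by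
  induction n with
  | zero => simpa using smul_one h.det_ne 1
  | succ n ih => simpa only [pow_succ] using ih.mul h

lemma trace_eq (h : IsDiag P A α β) : A.trace = α + β := by
  rw [h.eq_conj, Matrix.trace_mul_comm, ← mul_assoc,
    Matrix.nonsing_inv_mul _ (isUnit_iff_ne_zero.2 h.det_ne), one_mul]
  simp [Matrix.trace, Fin.sum_univ_two]

lemma det_eq (h : IsDiag P A α β) : A.det = α * β := by
  have h1 := congrArg Matrix.det h.eq
  rw [Matrix.det_mul, Matrix.det_mul, mul_comm] at h1
  rw [mul_left_cancel₀ h.det_ne h1, Matrix.det_diagonal, Fin.prod_univ_two]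
  rfl

lemma commute (h : IsDiag P A α β) (h' : IsDiag P B γ δ) : A * B = B * A := by
  apply (h.mul h').congr
  rw [mul_comm α, mul_comm β]
  exact h'.mul h

lemma eq_smul_one (h : IsDiag P A α α) : A = α • (1 : Matrix (Fin 2) (Fin 2) ℂ) :=
  h.congr (smul_one h.det_ne α)

lemma unique (h : IsDiag P A α β) (h' : IsDiag P A γ δ) : α = γ ∧ β = δ := by
  have h1 : P * Matrix.diagonal ![α, β] = P * Matrix.diagonal ![γ, δ] := by rw [← h.eq, h'.eq]
  have h2 := congrArg (P⁻¹ * ·) h1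
  simp only [Matrix.nonsing_inv_mul_cancel_left _ _ (isUnit_iff_ne_zero.2 h.det_ne)] at h2
  have h3 := Matrix.diagonal_injective h2
  exact ⟨congrFun h3 0, congrFun h3 1⟩

/-- What commutes with a diagonalizable nonscalar matrix is diagonal in the same basis. -/
lemma exists_of_commute (h : IsDiag P A α β) (hne : α ≠ β) (hAB : A * B = B * A) :
    ∃ γ δ, IsDiag P B γ δ := by
  have hu := isUnit_iff_ne_zero.2 h.det_ne
  set M := P⁻¹ * B * P with hM
  have hPM : P * M = B * P := by
    rw [hM, mul_assoc, Matrix.mul_nonsing_inv_cancel_left _ _ hu]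
  have h1 : Matrix.diagonal ![α, β] * M = M * Matrix.diagonal ![α, β] := by
    have h2 : P * (Matrix.diagonal ![α, β] * M) = P * (M * Matrix.diagonal ![α, β]) := by
      rw [← mul_assoc, ← h.eq, mul_assoc, hPM, ← mul_assoc, hAB, mul_assoc, h.eq, ← mul_assoc,
        ← hPM, mul_assoc]
    have h3 := congrArg (P⁻¹ * ·) h2
    simpa only [Matrix.nonsing_inv_mul_cancel_left _ _ hu] using h3
  have e01 := congrFun (congrFun h1 0) 1
  have e10 := congrFun (congrFun h1 1) 0
  simp only [Matrix.diagonal_mul, Matrix.mul_diagonal, Matrix.cons_val_zero,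
    Matrix.cons_val_one] at e01 e10
  have m01 : M 0 1 = 0 := by
    have : (α - β) * M 0 1 = 0 := by linear_combination e01
    exact (mul_eq_zero.1 this).resolve_left (sub_ne_zero.2 hne)
  have m10 : M 1 0 = 0 := by
    have : (α - β) * M 1 0 = 0 := by linear_combination -e10
    exact (mul_eq_zero.1 this).resolve_left (sub_ne_zero.2 hne)
  refine ⟨M 0 0, M 1 1, h.det_ne, ?_⟩
  rw [← hPM]
  congr 1
  ext i j
  fin_cases i <;> fin_cases j <;> simp [m01, m10]

end IsDiag

/-- Unitary matrices are diagonalizable. -/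
lemma exists_isDiag (g : U2) : ∃ (P : Matrix (Fin 2) (Fin 2) ℂ) (α β : ℂ),
    IsDiag P (g : Matrix (Fin 2) (Fin 2) ℂ) α β ∧ ‖α‖ = 1 ∧ ‖β‖ = 1 := by
  obtain ⟨e11, e00, e10, e01⟩ := unitary_entries g
  have hdet : ‖(g : Matrix (Fin 2) (Fin 2) ℂ).det‖ = 1 := by
    have := Matrix.det_of_mem_unitary g.2
    exact CStarRing.norm_of_mem_unitary this
  have hdet0 := det_ne_zero g
  set A := (g : Matrix (Fin 2) (Fin 2) ℂ) with hA
  obtain ⟨α, hα⟩ : ∃ α : ℂ, α * α - A.trace * α + A.det = 0 := by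
    obtain ⟨s, hs⟩ := IsAlgClosed.exists_pow_nat_eq (A.trace ^ 2 - 4 * A.det) (n := 2) (by norm_num)
    refine ⟨(A.trace + s) / 2, ?_⟩
    linear_combination (1 / 4) * hs
  have hdet' : (A - α • (1 : Matrix (Fin 2) (Fin 2) ℂ)).det = 0 := by
    rw [← hα]
    simp only [Matrix.det_fin_two, Matrix.trace, Fin.sum_univ_two, Matrix.sub_apply,
      Matrix.smul_apply, Matrix.diag_apply, smul_eq_mul, Matrix.one_apply_eq]
    simp
    ring
  obtain ⟨v, hv0, hv⟩ := Matrix.exists_mulVec_eq_zero_iff.2 hdet'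
  have hv' : A *ᵥ v = α • v := by
    rw [Matrix.sub_mulVec, Matrix.smul_mulVec, Matrix.one_mulVec, sub_eq_zero] at hv
    exact hv
  have r0 : A 0 0 * v 0 + A 0 1 * v 1 = α * v 0 := by
    simpa [Matrix.mulVec, dotProduct, Fin.sum_univ_two] using congrFun hv' 0
  have r1 : A 1 0 * v 0 + A 1 1 * v 1 = α * v 1 := by
    simpa [Matrix.mulVec, dotProduct, Fin.sum_univ_two] using congrFun hv' 1
  have c0 := congrArg conj r0
  have c1 := congrArg conj r1
  simp only [map_add, map_mul] at c0 c1
  have hP : (!![v 0, -conj (v 1); v 1, conj (v 0)]).det ≠ 0 := by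
    rw [Matrix.det_fin_two_of]
    have h1 : v 0 * conj (v 0) - -conj (v 1) * v 1 = ((‖v 0‖ ^ 2 + ‖v 1‖ ^ 2 : ℝ) : ℂ) := by
      rw [Complex.mul_conj', neg_mul, sub_neg_eq_add, Complex.conj_mul']
      push_cast; ring
    rw [h1]
    norm_cast
    intro h2
    apply hv0
    have h3 : ‖v 0‖ = 0 := by nlinarith [sq_nonneg ‖v 0‖, sq_nonneg ‖v 1‖]
    have h4 : ‖v 1‖ = 0 := by nlinarith [sq_nonneg ‖v 0‖, sq_nonneg ‖v 1‖]
    ext i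
    fin_cases i
    · simpa using h3
    · simpa using h4
  -- The second column is Jv, for which A Jv = det(A) J(Av) = det(A) ᾱ Jv. Comparing determinants
  -- then gives |α| = 1.
  have hD : IsDiag !![v 0, -conj (v 1); v 1, conj (v 0)] A α (A.det * conj α) := by
    refine ⟨hP, ?_⟩
    ext i j
    fin_cases i <;> fin_cases j <;>
      simp only [Fin.zero_eta, Fin.mk_one, Matrix.mul_apply, Fin.sum_univ_two, Matrix.diagonal_apply,
        Matrix.of_apply, Matrix.cons_val', Matrix.cons_val_zero, Matrix.cons_val_one,
        Matrix.cons_val_fin_one, if_true, if_false, zero_ne_one, one_ne_zero, mul_zero, add_zero,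
        zero_add]
    · rw [r0]; ring
    · linear_combination (-A.det) * c1 - conj (v 1) * e00 + conj (v 0) * e01
    · rw [r1]; ring
    · linear_combination A.det * c0 - conj (v 1) * e10 + conj (v 0) * e11
  have h1 := hD.det_eq
  have h2 : ‖α‖ = 1 := by
    have h3 : A.det * (α * conj α - 1) = 0 := by linear_combination -h1
    have h4 : α * conj α = 1 := by
      rcases mul_eq_zero.1 h3 with h5 | h5
      · exact absurd h5 hdet0
      · linear_combination h5
    rw [Complex.mul_conj'] at h4
    have h6 : ‖α‖ ^ 2 = 1 := by exact_mod_cast h4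
    nlinarith [norm_nonneg α]
  refine ⟨_, α, _, hD, h2, ?_⟩
  rw [norm_mul, hdet, RCLike.norm_conj, h2, one_mul]

end MatrixFacts

/-! ### Finite subgroups of `U(2)` acting freely on the sphere -/

section Free

open Matrix

/-- Complex two by two matrices. -/
abbrev M2 : Type := Matrix (Fin 2) (Fin 2) ℂ

variable {G : Subgroup U2}

/-- The matrix of an element of a subgroup of `U(2)`. -/
def mat (a : G) : M2 := ((a : U2) : M2)

lemma mat_mul (a b : G) : mat (a * b) = mat a * mat b := rfl
lemma mat_one : mat (1 : G) = 1 := rfl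
lemma mat_pow (a : G) (n : ℕ) : mat (a ^ n) = mat a ^ n := by
  induction n with
  | zero => rfl
  | succ n ih => rw [pow_succ, mat_mul, ih, pow_succ]
lemma mat_injective : Function.Injective (mat : G → M2) :=
  fun _ _ h => Subtype.ext (Subtype.ext h)
lemma mat_det_ne (a : G) : (mat a).det ≠ 0 := det_ne_zero _
lemma mat_mul_inv (a : G) : mat a * mat a⁻¹ = 1 := by rw [← mat_mul, mul_inv_cancel, mat_one]
lemma mat_inv_mul (a : G) : mat a⁻¹ * mat a = 1 := by rw [← mat_mul, inv_mul_cancel, mat_one]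
lemma commute_iff_mat (a b : G) : Commute a b ↔ mat a * mat b = mat b * mat a :=
  ⟨fun h => by rw [← mat_mul, h.eq, mat_mul], fun h => mat_injective (by rwa [mat_mul, mat_mul])⟩
lemma trace_mat_conj (g a : G) : (mat (g * a * g⁻¹)).trace = (mat a).trace := by
  rw [mat_mul, Matrix.trace_mul_comm, ← mat_mul]
  congr 2
  group
lemma det_mat_conj (g a : G) : (mat (g * a * g⁻¹)).det = (mat a).det := by
  rw [mat_mul, Matrix.det_mul, mul_comm, ← Matrix.det_mul, ← mat_mul]
  congr 2
  group

/-- The scalar matrices in `G`. -/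
def scal (G : Subgroup U2) : Subgroup G where
  carrier := {a | ∃ c : ℂ, mat a = c • (1 : M2)}
  one_mem' := ⟨1, by rw [mat_one, one_smul]⟩
  mul_mem' := by
    rintro a b ⟨c, hc⟩ ⟨d, hd⟩
    exact ⟨c * d, by rw [mat_mul, hc, hd, smul_mul_smul_comm, one_mul]⟩
  inv_mem' := by
    rintro a ⟨c, hc⟩
    refine ⟨c⁻¹, ?_⟩
    have hc0 : c ≠ 0 := by
      rintro rfl
      apply mat_det_ne a
      rw [hc, zero_smul, Matrix.det_zero]
    have h1 := mat_mul_inv a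
    rw [hc, smul_mul_assoc, one_mul] at h1
    rw [← h1, smul_smul, inv_mul_cancel₀ hc0, one_smul]

lemma exists_isDiag_mat (a : G) : ∃ (P : M2) (α β : ℂ), IsDiag P (mat a) α β ∧ ‖α‖ = 1 ∧ ‖β‖ = 1 :=
  exists_isDiag _

lemma IsDiag.ne_of_notMem {P : M2} {a : G} {α β : ℂ} (h : IsDiag P (mat a) α β) (ha : a ∉ scal G) :
    α ≠ β := by
  rintro rfl
  exact ha ⟨α, h.eq_smul_one⟩

/-- Conjugation of `a` to another element of its centralizer interchanges the eigenvalues. -/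
lemma mat_conj_eq_of_swap {a g : G} (ha : a ∉ scal G) (h1 : Commute a (g * a * g⁻¹))
    (h2 : ¬Commute a g) : mat (g * a * g⁻¹) = (mat a).trace • (1 : M2) - mat a := by
  obtain ⟨P, α, β, hD, -, -⟩ := exists_isDiag_mat a
  have hne := hD.ne_of_notMem ha
  obtain ⟨γ, δ, hD'⟩ := hD.exists_of_commute hne ((commute_iff_mat _ _).1 h1)
  have ht := trace_mat_conj g a
  have hd := det_mat_conj g a
  rw [hD.trace_eq, hD'.trace_eq] at ht
  rw [hD.det_eq, hD'.det_eq] at hd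
  have h3 : (γ - α) * (γ - β) = 0 := by linear_combination γ * ht - hd
  rcases mul_eq_zero.1 h3 with h4 | h4
  · exfalso
    apply h2
    have h5 : γ = α := sub_eq_zero.1 h4
    have h6 : δ = β := by linear_combination ht - h5
    subst h5 h6
    have h7 : g * a * g⁻¹ = a := mat_injective (hD'.congr hD)
    have h8 : g * a = a * g := by
      nth_rewrite 2 [← h7]
      group
    exact h8.symm
  · have h5 : γ = β := sub_eq_zero.1 h4
    have h6 : δ = α := by linear_combination ht - h5
    subst h5 h6
    apply hD'.congr
    have h7 := (IsDiag.smul_one hD.det_ne (δ + γ))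
    refine ⟨hD.det_ne, ?_⟩
    rw [hD.trace_eq, sub_mul, h7.eq, hD.eq, ← mul_sub, Matrix.diagonal_sub]
    congr 2
    ext i
    fin_cases i <;> simp

/-- A nonscalar element has two distinct eigenvalues, so whatever commutes with it is diagonal in
its eigenbasis, and diagonal matrices commute. An element that normalizes this centralizer without
lying in it interchanges the two eigenvalues, taking a to tr(a) - a; two such interchanges compose
to fix a. -/
lemma isCA_scal (G : Subgroup U2) : IsCA (scal G) where
  le_center := by
    rintro a ⟨c, hc⟩
    rw [Subgroup.mem_center_iff]
    intro b
    apply mat_injective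
    rw [mat_mul, mat_mul, hc, mul_smul_comm, smul_mul_assoc, mul_one, one_mul]
  trans := by
    intro a ha b c hab hac
    obtain ⟨P, α, β, hD, -, -⟩ := exists_isDiag_mat a
    have hne := hD.ne_of_notMem ha
    obtain ⟨_, _, h1⟩ := hD.exists_of_commute hne ((commute_iff_mat _ _).1 hab)
    obtain ⟨_, _, h2⟩ := hD.exists_of_commute hne ((commute_iff_mat _ _).1 hac)
    exact (commute_iff_mat _ _).2 (h1.commute h2)
  swap := by
    intro a ha g g' h1 h1' h2 h2'
    have e := mat_conj_eq_of_swap ha h1 h2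
    have e' := mat_conj_eq_of_swap ha h1' h2'
    have h3 : g * g' * a * (g * g')⁻¹ = a := by
      apply mat_injective
      have h4 : g * g' * a * (g * g')⁻¹ = g * (g' * a * g'⁻¹) * g⁻¹ := by group
      rw [h4, mat_mul, mat_mul, e', mul_sub, sub_mul, ← mat_mul, ← mat_mul, e, mul_smul_comm,
        mul_one, smul_mul_assoc, mat_mul_inv]
      abel
    have h5 : g * g' * a = a * (g * g') := by
      nth_rewrite 2 [← h3]
      group
    exact h5.symm

/-- Elements of a freely acting group that agree at a nonzero vector are equal. -/
lemma ActsFreely.eq_of_mulVec (hG : ActsFreely G) {g h : G} {v : Fin 2 → ℂ} (hv : v ≠ 0)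
    (e : mat g *ᵥ v = mat h *ᵥ v) : g = h := by
  have h1 : mat (h⁻¹ * g) *ᵥ v = v := by
    rw [mat_mul, ← Matrix.mulVec_mulVec, e, Matrix.mulVec_mulVec, mat_inv_mul, Matrix.one_mulVec]
  have hw : (WithLp.toLp 2 v : C2) ≠ 0 := by
    intro h2
    apply hv
    have := congrArg (WithLp.ofLp) h2
    simpa using this
  have hn : ‖(WithLp.toLp 2 v : C2)‖ ≠ 0 := norm_ne_zero_iff.2 hw
  have h3 := hG (h⁻¹ * g : G) (h⁻¹ * g).2
    ⟨((‖(WithLp.toLp 2 v : C2)‖⁻¹ : ℝ) : ℂ) • WithLp.toLp 2 v, by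
      rw [mem_sphere_zero_iff_norm, norm_smul]
      simp [hn]⟩ (by
      apply Subtype.ext
      change Matrix.toEuclideanLin (mat (h⁻¹ * g)) _ = _
      rw [map_smul]
      congr 1
      rw [Matrix.toLpLin_apply]
      change WithLp.toLp 2 (mat (h⁻¹ * g) *ᵥ v) = _
      rw [h1])
  have h4 : h⁻¹ * g = 1 := Subtype.ext h3
  exact (inv_mul_eq_one.1 h4).symm

lemma IsDiag.mulVec_single {P A : M2} {α β : ℂ} (h : IsDiag P A α β) (i : Fin 2) :
    A *ᵥ (P *ᵥ Pi.single i 1) = (![α, β] i) • (P *ᵥ Pi.single i 1) := by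
  rw [Matrix.mulVec_mulVec, h.eq, ← Matrix.mulVec_mulVec, Matrix.diagonal_mulVec_single,
    mul_one, ← Matrix.mulVec_smul, ← Pi.single_smul]
  simp

lemma IsDiag.mulVec_single_ne {P A : M2} {α β : ℂ} (h : IsDiag P A α β) (i : Fin 2) :
    P *ᵥ Pi.single i 1 ≠ 0 := by
  intro h0
  have h1 := Matrix.mulVec_injective_of_isUnit ((Matrix.isUnit_iff_isUnit_det P).2
    (isUnit_iff_ne_zero.2 h.det_ne)) (h0.trans (Matrix.mulVec_zero P).symm)
  have h2 := congrFun h1 i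
  simp at h2

/-- The two elements agree at the first column of P. Consequently each eigenvalue is a faithful
character on a simultaneously diagonalized subgroup. -/
lemma ActsFreely.eq_of_left (hG : ActsFreely G) {g h : G} {P : M2} {α β δ : ℂ}
    (hg : IsDiag P (mat g) α β) (hh : IsDiag P (mat h) α δ) : g = h :=
  hG.eq_of_mulVec (hg.mulVec_single_ne 0) (by
    rw [hg.mulVec_single, hh.mulVec_single]; rfl)

lemma ActsFreely.eq_of_right (hG : ActsFreely G) {g h : G} {P : M2} {α β γ : ℂ}
    (hg : IsDiag P (mat g) α β) (hh : IsDiag P (mat h) γ β) : g = h :=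
  hG.eq_of_mulVec (hg.mulVec_single_ne 1) (by
    rw [hg.mulVec_single, hh.mulVec_single]; rfl)

/-- A finite group with a faithful linear character has a generator with prescribed character
value. -/
lemma exists_generator {H : Type*} [Group H] [Finite H] (f : H →* ℂ) (hf : Function.Injective f)
    {η : ℂ} (hη : IsPrimitiveRoot η (Nat.card H)) :
    ∃ s, f s = η ∧ ∀ x, ∃ j < Nat.card H, s ^ j = x := by
  have hcyc := isCyclic_of_injective_ringHom f hf
  obtain ⟨t, ht⟩ := hcyc.exists_generator
  have hord : orderOf t = Nat.card H := orderOf_eq_card_of_forall_mem_zpowers ht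
  have hprim : IsPrimitiveRoot (f t) (Nat.card H) := by
    rw [← hord, ← orderOf_injective f hf t]
    exact IsPrimitiveRoot.orderOf _
  have hpos : 0 < Nat.card H := Nat.card_pos
  have : NeZero (Nat.card H) := ⟨hpos.ne'⟩
  obtain ⟨i, -, hi⟩ := hprim.eq_pow_of_pow_eq_one hη.pow_eq_one
  refine ⟨t ^ i, by rw [map_pow, hi], fun x => ?_⟩
  obtain ⟨j, hj, hj'⟩ := hη.eq_pow_of_pow_eq_one (ξ := f x)
    (by rw [← map_pow, pow_card_eq_one', map_one])
  refine ⟨j, hj, hf ?_⟩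
  rw [map_pow, map_pow, hi, hj']

/-- The number of scalar matrices in `G`. -/
def zc (G : Subgroup U2) : ℕ := Nat.card (scal G)

lemma zc_pos [Finite G] : 0 < zc G := Nat.card_pos

/-- The scalar matrices in a finite group are those of a group of roots of unity. -/
lemma exists_scalar_iff [Finite G] (c : ℂ) : (∃ g : G, mat g = c • (1 : M2)) ↔ c ^ zc G = 1 := by
  let f : scal G →* ℂ :=
    { toFun := fun g => mat (g : G) 0 0
      map_one' := by simp [mat_one]
      map_mul' := by
        rintro ⟨a, c, hc⟩ ⟨b, d, hd⟩
        change mat (a * b) 0 0 = mat a 0 0 * mat b 0 0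
        rw [mat_mul, hc, hd]
        simp [mul_comm] }
  have hf : ∀ (g : G) (hg : g ∈ scal G) (c : ℂ), mat g = c • (1 : M2) → f ⟨g, hg⟩ = c := by
    intro g hg c hc
    change mat g 0 0 = c
    rw [hc]
    simp
  have hinj : Function.Injective f := by
    rintro ⟨a, ha⟩ ⟨b, hb⟩ h
    obtain ⟨c, hc⟩ := id ha
    obtain ⟨d, hd⟩ := id hb
    rw [hf a _ c hc, hf b _ d hd] at h
    apply Subtype.ext
    apply mat_injective
    change mat a = mat b
    rw [hc, hd, h]
  have hη := Complex.isPrimitiveRoot_exp (zc G) zc_pos.ne'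
  obtain ⟨⟨s, hs⟩, hs1, hs2⟩ := exists_generator f hinj hη
  obtain ⟨ζ, hζ⟩ := id hs
  rw [hf s hs ζ hζ] at hs1
  constructor
  · rintro ⟨g, hg⟩
    have hgs : g ∈ scal G := ⟨c, hg⟩
    have := congrArg f (pow_card_eq_one' (x := (⟨g, hgs⟩ : scal G)))
    rwa [map_pow, map_one, hf g hgs c hg] at this
  · intro hc
    have : NeZero (zc G) := ⟨zc_pos.ne'⟩
    rw [← hs1] at hη
    obtain ⟨j, -, hj⟩ := hη.eq_pow_of_pow_eq_one hc
    refine ⟨s ^ j, ?_⟩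
    rw [mat_pow, hζ, smul_pow, one_pow, hj]

/-- The order of the centralizer of `a` in `G`, relative to the scalar matrices. -/
def relOrd (a : G) : ℕ := Nat.card (Subgroup.centralizer {a}) / zc G

lemma relOrd_mul_zc [Finite G] {a : G} (ha : a ∉ scal G) :
    relOrd a * zc G = Nat.card (Subgroup.centralizer {a}) :=
  (isCA_scal G).relCard_mul ⟨_, a, ha, rfl⟩

lemma two_le_relOrd [Finite G] {a : G} (ha : a ∉ scal G) : 2 ≤ relOrd a :=
  (isCA_scal G).two_le_relCard ⟨_, a, ha, rfl⟩

/-- A generator of the centralizer of an element that is not scalar. -/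
structure IsGen (a g : G) (P : M2) (α β : ℂ) : Prop where
  diag : IsDiag P (mat g) α β
  comm : Commute a g
  exists_pow : ∀ b, Commute a b → ∃ j < relOrd a * zc G, g ^ j = b
  left : IsPrimitiveRoot α (relOrd a * zc G)
  right : IsPrimitiveRoot β (relOrd a * zc G)
  ratio : IsPrimitiveRoot (β / α) (relOrd a)

/-- The first eigenvalue is a faithful character of the centralizer, which is therefore cyclic and
has a generator with first eigenvalue any given primitive root. The second eigenvalue is faithful
too, so it has the same order. A power of the generator is scalar exactly when its eigenvalues
agree, which gives the order of the ratio. -/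
lemma ActsFreely.exists_isGen [Finite G] (hG : ActsFreely G) {a : G} (ha : a ∉ scal G) {η : ℂ}
    (hη : IsPrimitiveRoot η (relOrd a * zc G)) : ∃ g P β, IsGen a g P η β := by
  obtain ⟨P, α₀, β₀, hD, -, -⟩ := exists_isDiag_mat a
  have hne := hD.ne_of_notMem ha
  have hex : ∀ b : Subgroup.centralizer {a}, ∃ γ δ, IsDiag P (mat (b : G)) γ δ := fun b =>
    hD.exists_of_commute hne ((commute_iff_mat _ _).1 (mem_centralizer_singleton.1 b.2))
  choose γ δ hγ using hex
  let f : Subgroup.centralizer {a} →* ℂ :=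
    { toFun := γ
      map_one' := by
        have h1 : IsDiag P (mat ((1 : Subgroup.centralizer {a}) : G)) 1 1 := by
          have := IsDiag.smul_one hD.det_ne 1
          rwa [one_smul] at this
        exact ((hγ 1).unique h1).1
      map_mul' := fun b c => ((hγ (b * c)).unique ((hγ b).mul (hγ c))).1 }
  have hinj : Function.Injective f := by
    intro b c hbc
    have hbc : γ b = γ c := hbc
    apply Subtype.ext
    have h1 := hγ b
    rw [hbc] at h1
    exact hG.eq_of_left h1 (hγ c)
  have hη' := hη
  rw [relOrd_mul_zc ha] at hη'
  obtain ⟨s, hs1, hs2⟩ := exists_generator f hinj hη'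
  have hs1 : γ s = η := hs1
  have hgen : IsDiag P (mat (s : G)) η (δ s) := hs1 ▸ hγ s
  have hpos : 0 < relOrd a * zc G := by rw [relOrd_mul_zc ha]; exact Nat.card_pos
  have hη0 : η ≠ 0 := hη.ne_zero hpos.ne'
  have hone : IsDiag P (mat (1 : G)) 1 1 := by
    have := IsDiag.smul_one hD.det_ne 1
    rwa [one_smul] at this
  refine ⟨s, P, δ s, hgen, mem_centralizer_singleton.1 s.2, ?_, hη, ?_, ?_⟩
  · intro b hb
    obtain ⟨j, hj, hj'⟩ := hs2 ⟨b, mem_centralizer_singleton.2 hb⟩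
    rw [relOrd_mul_zc ha]
    exact ⟨j, hj, congrArg Subtype.val hj'⟩
  · have hpow : ∀ j : ℕ, δ s ^ j = 1 ↔ η ^ j = 1 := by
      intro j
      have h1 := hgen.pow j
      rw [← mat_pow] at h1
      constructor
      · intro h2
        rw [h2] at h1
        have h3 := hG.eq_of_right h1 hone
        rw [h3] at h1
        exact (h1.unique hone).1
      · intro h2
        rw [h2] at h1
        have h3 := hG.eq_of_left h1 hone
        rw [h3] at h1
        exact (h1.unique hone).2
    exact ⟨(hpow _).2 hη.pow_eq_one, fun l hl => hη.dvd_of_pow_eq_one l ((hpow l).1 hl)⟩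
  · constructor
    -- η ^ relOrd a is a `zc G`-th root of unity, hence a scalar of G. The corresponding power of
    -- the generator shares its first eigenvalue and so equals it.
    · obtain ⟨t, ht⟩ := (exists_scalar_iff (G := G) (η ^ relOrd a)).2 (by
        rw [← pow_mul, hη.pow_eq_one])
      have h1 := hgen.pow (relOrd a)
      rw [← mat_pow] at h1
      have h2 := IsDiag.smul_one hD.det_ne (η ^ relOrd a)
      rw [← ht] at h2
      have h3 := hG.eq_of_left h1 h2
      rw [h3] at h1
      rw [div_pow, (h1.unique h2).2, div_self (pow_ne_zero _ hη0)]
    · intro l hl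
      rw [div_pow, div_eq_one_iff_eq (pow_ne_zero _ hη0)] at hl
      have h1 := hgen.pow l
      rw [hl, ← mat_pow] at h1
      have h2 := (exists_scalar_iff (G := G) (η ^ l)).1 ⟨_, h1.eq_smul_one⟩
      rw [← pow_mul] at h2
      exact Nat.dvd_of_mul_dvd_mul_right zc_pos (hη.dvd_of_pow_eq_one _ h2)

lemma ActsFreely.exists_isGen' [Finite G] (hG : ActsFreely G) {a : G} (ha : a ∉ scal G) :
    ∃ g P α β, IsGen a g P α β := by
  have hpos : relOrd a * zc G ≠ 0 := by rw [relOrd_mul_zc ha]; exact Nat.card_pos.ne'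
  obtain ⟨g, P, β, h⟩ := hG.exists_isGen ha (Complex.isPrimitiveRoot_exp _ hpos)
  exact ⟨g, P, _, β, h⟩

lemma IsGen.self_pow_mem [Finite G] {a g : G} {P : M2} {α β : ℂ} (h : IsGen a g P α β) {b : G}
    (hb : Commute a b) : b ^ relOrd a ∈ scal G := by
  obtain ⟨j, -, rfl⟩ := h.exists_pow b hb
  have hα : α ≠ 0 := by
    intro h0
    apply mat_det_ne g
    rw [h.diag.det_eq, h0, zero_mul]
  have h1 := h.diag.pow (j * relOrd a)
  have h2 : β ^ (j * relOrd a) = α ^ (j * relOrd a) := by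
    rw [← div_eq_one_iff_eq (pow_ne_zero _ hα), ← div_pow, mul_comm, pow_mul,
      h.ratio.pow_eq_one, one_pow]
  rw [h2] at h1
  rw [← pow_mul]
  exact ⟨_, by rw [mat_pow]; exact h1.eq_smul_one⟩

/-- A nonscalar element with scalar square has trace zero, and its square is not a square of a
scalar in `G`. -/
lemma ActsFreely.of_sq_scalar [Finite G] (hG : ActsFreely G) {a : G} (ha : a ∉ scal G)
    (h2 : a ^ 2 ∈ scal G) : Even (zc G) ∧ (mat a).trace = 0 ∧
      (-(mat a).det) ^ (zc G / 2) = -1 := by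
  obtain ⟨c, hc⟩ := h2
  rw [mat_pow, pow_two] at hc
  have htr : (mat a).trace = 0 := by
    by_contra hne
    apply ha
    have h1 := sq_eq_trace_smul_sub (mat a)
    rw [hc, eq_sub_iff_add_eq, ← add_smul] at h1
    refine ⟨(mat a).trace⁻¹ * (c + (mat a).det), ?_⟩
    rw [mul_smul, h1, smul_smul, inv_mul_cancel₀ hne, one_smul]
  have hdet : -(mat a).det = c := by
    have h1 := sq_eq_trace_smul_sub (mat a)
    rw [hc, htr, zero_smul, zero_sub, ← neg_smul] at h1
    have := congrFun (congrFun h1 0) 0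
    simpa using this.symm
  obtain ⟨P, α, β, hD, -, -⟩ := exists_isDiag_mat a
  have hβ : β = -α := by
    have := hD.trace_eq
    rw [htr] at this
    linear_combination -this
  have hα2 : α ^ 2 = c := by
    have := hD.det_eq
    rw [← hdet, this, hβ]; ring
  -- The eigenvalues of a are ±μ, so a scalar μ in G would agree with a on an eigenvector, against
  -- freeness.
  have key : ∀ μ : ℂ, μ ^ 2 = c → μ ^ zc G ≠ 1 := by
    intro μ hμ hz
    obtain ⟨t, ht⟩ := (exists_scalar_iff (G := G) μ).2 hz
    have h3 := IsDiag.smul_one hD.det_ne μ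
    rw [← ht] at h3
    have h4 : (α - μ) * (α + μ) = 0 := by linear_combination hα2 - hμ
    rcases mul_eq_zero.1 h4 with h5 | h5
    · have h6 : α = μ := sub_eq_zero.1 h5
      rw [h6] at hD
      exact ha ⟨μ, by rw [hG.eq_of_left hD h3, ht]⟩
    · have h6 : β = μ := by rw [hβ]; linear_combination -h5
      rw [h6] at hD
      exact ha ⟨μ, by rw [hG.eq_of_right hD h3, ht]⟩
  have hcz : c ^ zc G = 1 := (exists_scalar_iff (G := G) c).1 ⟨a ^ 2, by rw [mat_pow, pow_two, hc]⟩
  have heven : Even (zc G) := by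
    by_contra hodd
    rw [Nat.not_even_iff_odd] at hodd
    obtain ⟨k, hk⟩ := hodd
    -- When the scalars form a group of odd order 2k + 1, c^(k+1) is a square root of c among them.
    refine key (c ^ (k + 1)) ?_ (by rw [← pow_mul, mul_comm, pow_mul, hcz, one_pow])
    rw [← pow_mul, show (k + 1) * 2 = zc G + 1 by omega, pow_succ, hcz, one_mul]
  refine ⟨heven, htr, ?_⟩
  rw [hdet]
  obtain ⟨k, hk⟩ := heven
  have hk2 : zc G / 2 = k := by omega
  rw [hk2]
  have h5 : c ^ k * c ^ k = 1 := by rw [← pow_add, ← hk, hcz]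
  -- The value 1 would make the eigenvalue α itself a scalar of G with α² = c.
  rcases mul_self_eq_one_iff.1 h5 with h6 | h6
  · exfalso
    apply key α hα2
    rw [hk, ← two_mul, pow_mul, hα2, h6]
  · exact h6

end Free

/-! ### The dimension of the space of semi-invariants -/

section Character

open MvPolynomial

/-- Binary forms of degree `n`. -/
abbrev Forms (n : ℕ) : Type := homogeneousSubmodule (Fin 2) ℂ n

instance (n : ℕ) : FiniteDimensional ℂ (Forms n) :=
  Module.Finite.iff_fg.2 (homogeneousSubmodule_fg (R := ℂ) (Fin 2) n)

/-- The exponent of `x^i y^(n-i)`. -/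
def formExp (n : ℕ) (i : Fin (n + 1)) : Fin 2 →₀ ℕ :=
  Finsupp.single 0 (i : ℕ) + Finsupp.single 1 (n - i)

lemma formExp_zero (n : ℕ) (i : Fin (n + 1)) : formExp n i 0 = i := by simp [formExp]

lemma formExp_one (n : ℕ) (i : Fin (n + 1)) : formExp n i 1 = n - i := by simp [formExp]

lemma formExp_injective (n : ℕ) : Function.Injective (formExp n) := by
  intro i j h
  apply Fin.ext
  rw [← formExp_zero, ← formExp_zero, h]

lemma degree_formExp (n : ℕ) (i : Fin (n + 1)) : (formExp n i).degree = n := by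
  rw [Finsupp.degree_eq_sum, Fin.sum_univ_two, formExp_zero, formExp_one]
  omega

/-- The monomials `x^i y^(n-i)` form a basis of the forms of degree `n`. -/
def formBasis (n : ℕ) : Module.Basis (Fin (n + 1)) ℂ (Forms n) :=
  Module.Basis.mk (v := fun i => (⟨monomial (formExp n i) 1, by
      rw [mem_homogeneousSubmodule]
      exact isHomogeneous_monomial _ (degree_formExp n i)⟩ : Forms n))
    (by
      apply LinearIndependent.of_comp (homogeneousSubmodule (Fin 2) ℂ n).subtype
      have := (basisMonomials (Fin 2) ℂ).linearIndependent.comp _ (formExp_injective n)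
      simpa [Function.comp_def] using this)
    (by
      rintro ⟨F, hF⟩ -
      have h1 : F ∈ Submodule.span ℂ (Set.range fun i => monomial (formExp n i) (1 : ℂ)) := by
        rw [F.as_sum]
        apply Submodule.sum_mem
        intro d hd
        have hdeg : d.degree = n := by
          rw [mem_homogeneousSubmodule] at hF
          by_contra hne
          exact (mem_support_iff.1 hd) (hF.coeff_eq_zero hne)
        rw [Finsupp.degree_eq_sum, Fin.sum_univ_two] at hdeg
        have h2 : d = formExp n ⟨d 0, by omega⟩ := by
          ext i
          fin_cases i
          · exact (formExp_zero n ⟨d 0, by omega⟩).symm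
          · refine Eq.trans ?_ (formExp_one n ⟨d 0, by omega⟩).symm
            change d 1 = n - d 0
            omega
        have h3 : monomial d (coeff d F) = coeff d F • monomial (formExp n ⟨d 0, by omega⟩) (1 : ℂ) := by
          rw [← h2, smul_monomial, smul_eq_mul, mul_one]
        rw [h3]
        exact Submodule.smul_mem _ _ (Submodule.subset_span ⟨_, rfl⟩)
      have h4 : (Submodule.span ℂ (Set.range fun i => (⟨monomial (formExp n i) 1, by
          rw [mem_homogeneousSubmodule]
          exact isHomogeneous_monomial _ (degree_formExp n i)⟩ : Forms n))).map
          (homogeneousSubmodule (Fin 2) ℂ n).subtype =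
          Submodule.span ℂ (Set.range fun i => monomial (formExp n i) (1 : ℂ)) := by
        rw [Submodule.map_span, ← Set.range_comp]
        rfl
      rw [← h4] at h1
      obtain ⟨F', hF', rfl⟩ := h1
      exact hF')

lemma formBasis_apply (n : ℕ) (i : Fin (n + 1)) :
    (formBasis n i : MvPolynomial (Fin 2) ℂ) = monomial (formExp n i) 1 := by
  rw [formBasis, Module.Basis.mk_apply]

/-- Composition of forms of degree `n` with a linear map. -/
def formsComp (n : ℕ) (A : M2) : Forms n →ₗ[ℂ] Forms n :=
  (formComp A).toLinearMap.restrict fun _ hF => formComp_isHomogeneous A hF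

lemma formsComp_apply (n : ℕ) (A : M2) (F : Forms n) :
    (formsComp n A F : MvPolynomial (Fin 2) ℂ) = formComp A F := rfl

lemma formsComp_mul (n : ℕ) (A B : M2) : formsComp n (A * B) = formsComp n B * formsComp n A := by
  ext1 F
  exact Subtype.ext (formComp_mul A B F)

lemma formsComp_one (n : ℕ) : formsComp n 1 = 1 := by
  ext1 F
  exact Subtype.ext (formComp_one _)

lemma trace_formsComp {P A : M2} {α β : ℂ} (h : IsDiag P A α β) (n : ℕ) :
    LinearMap.trace ℂ _ (formsComp n A) = ∑ i ∈ Finset.range (n + 1), α ^ i * β ^ (n - i) := by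
  rw [h.eq_conj, mul_assoc, formsComp_mul, LinearMap.trace_mul_comm, ← formsComp_mul, mul_assoc,
    Matrix.nonsing_inv_mul _ (isUnit_iff_ne_zero.2 h.det_ne), mul_one,
    LinearMap.trace_eq_matrix_trace ℂ (formBasis n), Matrix.trace, Finset.sum_range]
  refine Finset.sum_congr rfl fun i _ => ?_
  have h1 : formsComp n (Matrix.diagonal ![α, β]) (formBasis n i) =
      (α ^ (i : ℕ) * β ^ (n - i)) • formBasis n i := by
    apply Subtype.ext
    rw [formsComp_apply, formBasis_apply, formComp_diagonal_monomial, formExp_zero, formExp_one,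
      Submodule.coe_smul, formBasis_apply]
    rfl
  rw [Matrix.diag_apply, LinearMap.toMatrix_apply, h1, map_smul]
  simp

variable (G : Subgroup U2)

/-- The action of `G` on forms of degree `n` twisted by a power of the determinant. -/
def formRep (n q : ℕ) : Representation ℂ G (Forms n) where
  toFun g := (mat g).det ^ q • formsComp n (mat g⁻¹)
  map_one' := by rw [inv_one, mat_one, formsComp_one, Matrix.det_one, one_pow, one_smul]
  map_mul' g h := by
    rw [mul_inv_rev, mat_mul, mat_mul, formsComp_mul, Matrix.det_mul, mul_pow,
      smul_mul_smul_comm]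

lemma finrank_invariants (n q : ℕ) :
    Module.finrank ℂ (formRep G n q).invariants = Module.finrank ℂ (semiInv G n q) := by
  have h1 : (formRep G n q).invariants.map (homogeneousSubmodule (Fin 2) ℂ n).subtype =
      semiInv G n q := by
    ext F
    constructor
    · rintro ⟨F, hF, rfl⟩
      refine ⟨F.2, fun g hg => ?_⟩
      have h2 := hF (⟨g, hg⟩ : G)⁻¹
      have h3 := congrArg Subtype.val h2
      have h4 : (mat (⟨g, hg⟩ : G)⁻¹).det ^ q • formComp (mat (⟨g, hg⟩ : G)⁻¹⁻¹) (F : MvPolynomial _ ℂ) = F := h3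
      rw [inv_inv] at h4
      have h5 : (mat (⟨g, hg⟩ : G)).det ^ q * (mat (⟨g, hg⟩ : G)⁻¹).det ^ q = 1 := by
        rw [← mul_pow, ← Matrix.det_mul, mat_mul_inv, Matrix.det_one, one_pow]
      change formComp (mat (⟨g, hg⟩ : G)) (F : MvPolynomial _ ℂ) = (mat (⟨g, hg⟩ : G)).det ^ q • (F : MvPolynomial _ ℂ)
      nth_rewrite 2 [← h4]
      rw [smul_smul, h5, one_smul]
    · rintro ⟨hF, hF'⟩
      refine ⟨⟨F, hF⟩, fun g => ?_, rfl⟩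
      apply Subtype.ext
      change (mat g).det ^ q • formComp (mat g⁻¹) F = F
      rw [show formComp (mat g⁻¹) F = (mat g⁻¹).det ^ q • F from hF' _ (g⁻¹).2, smul_smul,
        ← mul_pow, ← Matrix.det_mul, mat_mul_inv, Matrix.det_one, one_pow, one_smul]
  rw [← h1]
  exact (LinearEquiv.finrank_eq (Submodule.equivMapOfInjective _ (Submodule.injective_subtype _) _))

variable {G}

/-- The character of `G` on forms of degree `n`, twisted by a power of the determinant. -/
def formChar (n q : ℕ) (g : G) : ℂ := ((mat g).det ^ q)⁻¹ * LinearMap.trace ℂ _ (formsComp n (mat g))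

lemma formChar_eq {g : G} {P : M2} {α β : ℂ} (h : IsDiag P (mat g) α β) (n q : ℕ) :
    formChar n q g = ∑ i ∈ Finset.range (n + 1), α ^ i * β ^ (n - i) / (α * β) ^ q := by
  rw [formChar, trace_formsComp h, h.det_eq, Finset.mul_sum]
  exact Finset.sum_congr rfl fun i _ => by ring

/-- The dimension of the invariants is the average of the character; g is replaced by g⁻¹ because
composition of forms is a right action. -/
lemma card_mul_finrank [Fintype G] (n q : ℕ) :
    (Nat.card G : ℂ) * Module.finrank ℂ (semiInv G n q) = ∑ g : G, formChar n q g := by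
  have h0 : (Nat.card G : ℂ) ≠ 0 := by exact_mod_cast Nat.card_pos.ne'
  have := invertibleOfNonzero h0
  rw [← finrank_invariants, ← Representation.card_inv_mul_sum_char_eq_finrank, ← mul_assoc,
    mul_inv_cancel₀ h0, one_mul,
    ← Equiv.sum_comp (Equiv.inv G)]
  refine Finset.sum_congr rfl fun g _ => ?_
  change LinearMap.trace ℂ _ ((mat g⁻¹).det ^ q • formsComp n (mat g⁻¹⁻¹)) = _
  rw [inv_inv, map_smul, formChar, smul_eq_mul]
  congr 1
  rw [← inv_pow]
  congr 1
  apply eq_inv_of_mul_eq_one_left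
  rw [← Matrix.det_mul, mat_inv_mul, Matrix.det_one]

/-- The dimension of the semi-invariants of a cyclic group generated by `diag(α, β)`. -/
def cycDim (α β : ℂ) (n q : ℕ) : ℕ :=
  ((Finset.range (n + 1)).filter fun i => α ^ i * β ^ (n - i) = (α * β) ^ q).card

/-- Every monomial contributes the sum of the powers of an m-th root of unity, which is m or 0. -/
lemma sum_pow_formChar {g : G} {P : M2} {α β : ℂ} (h : IsDiag P (mat g) α β) (n q m : ℕ)
    (hα : α ^ m = 1) (hβ : β ^ m = 1) :
    ∑ j ∈ Finset.range m, formChar n q (g ^ j) = m * cycDim α β n q := by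
  have hα0 : α * β ≠ 0 := by rw [← h.det_eq]; exact mat_det_ne g
  have h1 : ∀ j, formChar n q (g ^ j) =
      ∑ i ∈ Finset.range (n + 1), (α ^ i * β ^ (n - i) / (α * β) ^ q) ^ j := by
    intro j
    have h2 := h.pow j
    rw [← mat_pow] at h2
    rw [formChar_eq h2]
    refine Finset.sum_congr rfl fun i _ => ?_
    rw [div_pow, mul_pow]
    ring
  simp only [h1]
  rw [Finset.sum_comm, cycDim, Finset.card_filter, Nat.cast_sum, Finset.mul_sum]
  refine Finset.sum_congr rfl fun i _ => ?_
  set t := α ^ i * β ^ (n - i) / (α * β) ^ q with ht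
  have ht1 : t = 1 ↔ α ^ i * β ^ (n - i) = (α * β) ^ q := by
    rw [ht, div_eq_one_iff_eq (pow_ne_zero _ hα0)]
  have htm : t ^ m = 1 := by
    rw [ht, div_pow, mul_pow, ← pow_mul, ← pow_mul, ← pow_mul, mul_comm i, mul_comm _ m, mul_comm q,
      pow_mul, pow_mul, pow_mul, hα, hβ, mul_pow, hα, hβ]
    simp
  split_ifs with h3
  · rw [ht1.2 h3]; simp
  · have h3 := mt ht1.1 h3
    have h4 := mul_geom_sum t m
    rw [htm, sub_self] at h4
    rw [(mul_eq_zero.1 h4).resolve_left (sub_ne_zero.2 h3)]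
    simp

lemma formChar_scalar {g : G} {c : ℂ} (h : mat g = c • (1 : M2)) (n q : ℕ) :
    formChar n q g = (n + 1) * (c ^ n / (c * c) ^ q) := by
  have h1 : IsDiag 1 (mat g) c c := by rw [h]; exact IsDiag.smul_one (by simp) c
  rw [formChar_eq h1, Finset.sum_congr rfl (g := fun _ => c ^ n / (c * c) ^ q)]
  · simp
  · intro i hi
    rw [Finset.mem_range] at hi
    rw [← pow_add]
    congr 2
    omega

/-- For eigenvalues α ≠ β of modulus one the trace is the geometric quotient (α^(n+1) - β^(n+1)) /
(α - β), bounded independently of n. -/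
lemma norm_formChar_le {g : G} (hg : g ∉ scal G) :
    ∃ B : ℝ, 0 ≤ B ∧ ∀ n q : ℕ, ‖formChar n q g‖ ≤ B := by
  obtain ⟨P, α, β, h, hα, hβ⟩ := exists_isDiag_mat g
  have hne := h.ne_of_notMem hg
  have hpos : 0 < ‖α - β‖ := norm_pos_iff.2 (sub_ne_zero.2 hne)
  refine ⟨2 / ‖α - β‖, by positivity, fun n q => ?_⟩
  rw [formChar, trace_formsComp h, h.det_eq, norm_mul, norm_inv, norm_pow, norm_mul, hα, hβ,
    mul_one, one_pow, inv_one, one_mul, le_div_iff₀ hpos, ← norm_mul]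
  have h1 := geom_sum₂_mul α β (n + 1)
  have h2 : ∀ i, n + 1 - 1 - i = n - i := fun i => by omega
  simp only [h2] at h1
  rw [h1]
  refine (norm_sub_le _ _).trans ?_
  rw [norm_pow, norm_pow, hα, hβ]
  norm_num

/-- A scalar η of order `zc G` multiplies forms by η^n, while its determinant demands the factor
η^(2q). -/
lemma finrank_semiInv_eq_zero [Finite G] {n q : ℕ} (h : ¬(zc G : ℤ) ∣ n - 2 * q) :
    Module.finrank ℂ (semiInv G n q) = 0 := by
  have hη := Complex.isPrimitiveRoot_exp (zc G) zc_pos.ne'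
  set η := Complex.exp (2 * Real.pi * Complex.I / zc G) with hηdef
  obtain ⟨g, hg⟩ := (exists_scalar_iff (G := G) η).2 hη.pow_eq_one
  have hη0 : η ≠ 0 := hη.ne_zero zc_pos.ne'
  have hbot : semiInv G n q = ⊥ := by
    rw [eq_bot_iff]
    rintro F ⟨hF, hF'⟩
    have h1 : formComp (mat g) F = (mat g).det ^ q • F := hF' g g.2
    rw [hg, formComp_smul_one _ hF, Matrix.det_smul, Matrix.det_one, mul_one, Fintype.card_fin,
      ← sub_eq_zero, ← sub_smul] at h1
    rcases smul_eq_zero.1 h1 with h2 | h2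
    · exfalso
      apply h
      rw [← hη.zpow_eq_one_iff_dvd, zpow_sub₀ hη0, zpow_mul]
      rw [sub_eq_zero] at h2
      rw [div_eq_one_iff_eq (by positivity)]
      simpa using h2
    · simpa using h2
  rw [hbot, finrank_bot]

end Character

/-! ### Asymptotics of the multiplicities -/

section Asymptotics

/-- The multiplicity of the eigenvalue `2 m`. -/
def specMult (G : Subgroup U2) (m : ℕ) : ℕ :=
  ∑ q ∈ m.divisors, Module.finrank ℂ (semiInv G (divDegree m q) q)

/-- The sum over the pairs of positive integers with product at most `X`. -/
def hypSum {E : Type*} [AddCommMonoid E] (f : ℕ → ℕ → E) (X : ℕ) : E :=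
  ∑ q ∈ Finset.Icc 1 X, ∑ b ∈ Finset.Icc 1 (X / q), f q b

lemma hypSum_eq_divisors {E : Type*} [AddCommMonoid E] (f : ℕ → ℕ → E) (X : ℕ) :
    ∑ m ∈ Finset.Icc 1 X, ∑ q ∈ m.divisors, f q (m / q) = hypSum f X := by
  rw [hypSum, Finset.sum_sigma', Finset.sum_sigma']
  refine Finset.sum_bij' (fun p _ => ⟨p.2, p.1 / p.2⟩) (fun p _ => ⟨p.1 * p.2, p.1⟩) ?_ ?_ ?_ ?_ ?_
  · rintro ⟨m, q⟩ h
    simp only [Finset.mem_sigma, Finset.mem_Icc, Nat.mem_divisors] at h ⊢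
    obtain ⟨⟨h1, h2⟩, h3, h4⟩ := h
    have hq : 0 < q := Nat.pos_of_dvd_of_pos h3 (by omega)
    exact ⟨⟨hq, (Nat.le_of_dvd (by omega) h3).trans h2⟩,
      Nat.div_pos (Nat.le_of_dvd (by omega) h3) hq, Nat.div_le_div_right h2⟩
  · rintro ⟨q, b⟩ h
    simp only [Finset.mem_sigma, Finset.mem_Icc, Nat.mem_divisors] at h ⊢
    obtain ⟨⟨h1, h2⟩, h3, h4⟩ := h
    have h5 : q * b ≤ X := by
      rw [mul_comm]
      exact (Nat.le_div_iff_mul_le (by omega)).1 h4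
    have h6 : 0 < q * b := Nat.mul_pos (by omega) (by omega)
    exact ⟨⟨h6, h5⟩, Dvd.intro _ rfl, by omega⟩
  · rintro ⟨m, q⟩ h
    simp only [Finset.mem_sigma, Nat.mem_divisors] at h
    simp only [Nat.mul_div_cancel' h.2.1]
  · rintro ⟨q, b⟩ h
    simp only [Finset.mem_sigma, Finset.mem_Icc] at h
    simp only [Nat.mul_div_cancel_left b (show 0 < q by omega)]
  · rintro ⟨m, q⟩ _
    rfl

lemma hypSum_swap {E : Type*} [AddCommMonoid E] (f : ℕ → ℕ → E) (X : ℕ) :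
    hypSum f X = hypSum (fun b q => f q b) X := by
  unfold hypSum
  refine Finset.sum_comm' ?_
  intro q b
  simp only [Finset.mem_Icc]
  constructor
  · rintro ⟨⟨h1, h2⟩, h3, h4⟩
    have h5 := (Nat.le_div_iff_mul_le (by omega)).1 h4
    exact ⟨⟨h1, (Nat.le_div_iff_mul_le (by omega)).2 (by rwa [mul_comm])⟩, h3,
      h4.trans (Nat.div_le_self _ _)⟩
  · rintro ⟨⟨h1, h2⟩, h3, h4⟩
    have h5 := (Nat.le_div_iff_mul_le (by omega)).1 h2
    exact ⟨⟨h1, h2.trans (Nat.div_le_self _ _)⟩, h3,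
      (Nat.le_div_iff_mul_le (by omega)).2 (by rwa [mul_comm])⟩

lemma norm_hypSum_le (f : ℕ → ℕ → ℂ) (X : ℕ) (B : ℝ)
    (h : ∀ q k, ‖∑ b ∈ Finset.Icc 1 k, f q b‖ ≤ B * k) :
    ‖hypSum f X‖ ≤ B * ∑ q ∈ Finset.Icc 1 X, ((X / q : ℕ) : ℝ) := by
  rw [hypSum, Finset.mul_sum]
  exact (norm_sum_le _ _).trans (Finset.sum_le_sum fun q _ => h q _)

/-- Summation by parts: oscillation of c^b reduces the trivial bound of order k² to one of order k.
-/
lemma norm_sum_mul_pow_le {c : ℂ} (hc : ‖c‖ = 1) (hc1 : c ≠ 1) (k : ℕ) :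
    ‖∑ b ∈ Finset.Icc 1 k, (b : ℂ) * c ^ b‖ ≤ 2 / ‖c - 1‖ * k := by
  have hpos : 0 < ‖c - 1‖ := norm_pos_iff.2 (sub_ne_zero.2 hc1)
  rw [div_mul_eq_mul_div, le_div_iff₀ hpos, ← norm_mul]
  have h1 : (∑ b ∈ Finset.Icc 1 k, (b : ℂ) * c ^ b) * (c - 1) =
      k * c ^ (k + 1) - ∑ b ∈ Finset.Icc 1 k, c ^ b := by
    induction k with
    | zero => simp
    | succ k ih =>
      rw [Finset.sum_Icc_succ_top (by omega), Finset.sum_Icc_succ_top (by omega), add_mul, ih]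
      push_cast
      ring
  rw [h1]
  refine (norm_sub_le _ _).trans ?_
  have h2 : ‖∑ b ∈ Finset.Icc 1 k, c ^ b‖ ≤ k := by
    refine (norm_sum_le _ _).trans ?_
    simp [norm_pow, hc]
  rw [norm_mul, norm_pow, hc, one_pow, mul_one, Complex.norm_natCast]
  linarith

variable {G : Subgroup U2}

/-- For a scalar c ≠ 1 the character is (b + q) c^(b - q - 1). The part with b is summed over b
first and the part with q over q first, so that in each the oscillation meets the linear factor. For
nonscalar g the character is bounded. -/
lemma norm_hypSum_formChar_le {g : G} (hg : g ≠ 1) : ∃ B : ℝ, 0 ≤ B ∧ ∀ X,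
    ‖hypSum (fun q b => formChar (b + q - 1) q g) X‖ ≤
      B * ∑ q ∈ Finset.Icc 1 X, ((X / q : ℕ) : ℝ) := by
  by_cases hs : g ∈ scal G
  · obtain ⟨c, hc⟩ := hs
    obtain ⟨P, α, β, hD, hα, -⟩ := exists_isDiag_mat g
    have hcα : α = c := by
      have h1 := IsDiag.smul_one hD.det_ne c
      rw [← hc] at h1
      exact (hD.unique h1).1
    rw [hcα] at hα
    have hc0 : c ≠ 0 := by rw [← norm_pos_iff, hα]; norm_num
    have hc1 : c ≠ 1 := by
      rintro rfl
      apply hg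
      apply mat_injective
      rw [hc, one_smul, mat_one]
    have hα' : ‖c⁻¹‖ = 1 := by rw [norm_inv, hα, inv_one]
    have hc1' : c⁻¹ ≠ 1 := by rwa [Ne, inv_eq_one]
    refine ⟨2 / ‖c - 1‖ + 2 / ‖c⁻¹ - 1‖, by positivity, fun X => ?_⟩
    have h1 : hypSum (fun q b => formChar (b + q - 1) q g) X =
        hypSum (fun q b => c⁻¹ ^ (q + 1) * ((b : ℂ) * c ^ b)) X +
          hypSum (fun b q => c⁻¹ * c ^ b * ((q : ℂ) * c⁻¹ ^ q)) X := by
      rw [← hypSum_swap (fun q b => c⁻¹ * c ^ b * ((q : ℂ) * c⁻¹ ^ q))]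
      simp only [hypSum, ← Finset.sum_add_distrib]
      refine Finset.sum_congr rfl fun q hq => Finset.sum_congr rfl fun b hb => ?_
      rw [Finset.mem_Icc] at hq hb
      rw [formChar_scalar hc]
      obtain ⟨q, rfl⟩ : ∃ q', q = q' + 1 := ⟨q - 1, by omega⟩
      rw [show b + (q + 1) - 1 = b + q by omega]
      push_cast
      rw [mul_pow, pow_add, pow_succ, pow_succ, pow_succ, inv_pow]
      field_simp
      ring
    rw [h1, add_mul]
    refine (norm_add_le _ _).trans (add_le_add (norm_hypSum_le _ _ _ fun q k => ?_)
      (norm_hypSum_le _ _ _ fun q k => ?_))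
    · rw [← Finset.mul_sum, norm_mul, norm_pow, hα', one_pow, one_mul]
      exact norm_sum_mul_pow_le hα hc1 k
    · rw [← Finset.mul_sum, norm_mul, norm_mul, norm_pow, hα, hα', one_pow, one_mul, one_mul]
      exact norm_sum_mul_pow_le hα' hc1' k
  · obtain ⟨B, hB0, hB⟩ := norm_formChar_le hs
    refine ⟨B, hB0, fun X => norm_hypSum_le _ _ _ fun q k => ?_⟩
    refine (norm_sum_le _ _).trans ((Finset.sum_le_sum fun b _ => hB _ _).trans ?_)
    simp [mul_comm]

/-- By the character formula |G| times the counting function is a sum over g in G. The identity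
gives the main term, because n + 1 = b + q for n = b + q - 1; all other elements give only O(∑ X/q).
-/
lemma exists_weyl_bound (G : Subgroup U2) [Finite G] : ∃ B : ℝ, 0 ≤ B ∧ ∀ X : ℕ,
    |(Nat.card G : ℝ) * ∑ m ∈ Finset.Icc 1 X, (specMult G m : ℝ) -
      hypSum (fun q b => (b : ℝ) + q) X| ≤ B * ∑ q ∈ Finset.Icc 1 X, ((X / q : ℕ) : ℝ) := by
  classical
  have := Fintype.ofFinite G
  have hex : ∀ g : G, ∃ B : ℝ, 0 ≤ B ∧ ∀ X, g ≠ 1 →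
      ‖hypSum (fun q b => formChar (b + q - 1) q g) X‖ ≤
        B * ∑ q ∈ Finset.Icc 1 X, ((X / q : ℕ) : ℝ) := by
    intro g
    by_cases hg : g = 1
    · exact ⟨0, le_rfl, fun X h => absurd hg h⟩
    · obtain ⟨B, h0, hB⟩ := norm_hypSum_formChar_le hg
      exact ⟨B, h0, fun X _ => hB X⟩
  choose B hB0 hB using hex
  refine ⟨∑ g, B g, Finset.sum_nonneg fun g _ => hB0 g, fun X => ?_⟩
  have h1 : ((Nat.card G : ℝ) * ∑ m ∈ Finset.Icc 1 X, (specMult G m : ℝ) : ℂ) =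
      ∑ g : G, hypSum (fun q b => formChar (b + q - 1) q g) X := by
    have h2 : (∑ m ∈ Finset.Icc 1 X, specMult G m) =
        hypSum (fun q b => Module.finrank ℂ (semiInv G (b + q - 1) q)) X :=
      hypSum_eq_divisors (fun q b => Module.finrank ℂ (semiInv G (b + q - 1) q)) X
    rw [← Nat.cast_sum, h2]
    simp only [hypSum]
    rw [Finset.sum_comm]
    push_cast
    rw [Finset.mul_sum]
    refine Finset.sum_congr rfl fun q _ => ?_
    rw [Finset.sum_comm, Finset.mul_sum]
    exact Finset.sum_congr rfl fun b _ => card_mul_finrank _ _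
  have h3 : hypSum (fun q b => formChar (b + q - 1) q (1 : G)) X =
      ((hypSum (fun q b => (b : ℝ) + q) X : ℝ) : ℂ) := by
    simp only [hypSum]
    push_cast
    refine Finset.sum_congr rfl fun q hq => Finset.sum_congr rfl fun b hb => ?_
    rw [Finset.mem_Icc] at hq hb
    rw [formChar_scalar (c := 1) (by rw [mat_one, one_smul])]
    have : ((b + q - 1 : ℕ) : ℂ) + 1 = b + q := by
      rw [← Nat.cast_add_one, Nat.sub_add_cancel (by omega)]
      push_cast; rfl
    rw [this]
    simp
  have h4 := Finset.add_sum_erase Finset.univ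
    (fun g : G => hypSum (fun q b => formChar (b + q - 1) q g) X) (Finset.mem_univ 1)
  rw [← h1, h3] at h4
  rw [← Real.norm_eq_abs, ← Complex.norm_real]
  push_cast
  push_cast at h4
  rw [← h4, add_sub_cancel_left, Finset.sum_mul]
  refine (norm_sum_le _ _).trans ?_
  refine (Finset.sum_le_sum (g := fun g => B g * ∑ q ∈ Finset.Icc 1 X, ((X / q : ℕ) : ℝ))
    fun g hg => hB g X (Finset.ne_of_mem_erase hg)).trans ?_
  exact Finset.sum_le_sum_of_subset_of_nonneg (Finset.erase_subset _ _) fun g _ _ =>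
    mul_nonneg (hB0 g) (Finset.sum_nonneg fun _ _ => Nat.cast_nonneg _)

/-- For X = k² the harmonic sum is at most 1 + 2 log k ≤ 2k. The resulting error of order X^(3/2) is
small against the main term, which is at least X²/2. -/
lemma sum_div_sq_le (k : ℕ) :
    ∑ q ∈ Finset.Icc 1 (k ^ 2), ((k ^ 2 / q : ℕ) : ℝ) ≤ 2 * (k : ℝ) ^ 3 := by
  rcases Nat.eq_zero_or_pos k with rfl | hk
  · simp
  have hk' : (0 : ℝ) < k := by exact_mod_cast hk
  have h1 : ∑ q ∈ Finset.Icc 1 (k ^ 2), ((k ^ 2 / q : ℕ) : ℝ) ≤ (k : ℝ) ^ 2 * (harmonic (k ^ 2) : ℚ) := by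
    rw [harmonic_eq_sum_Icc]
    push_cast
    rw [Finset.mul_sum]
    refine Finset.sum_le_sum fun q _ => ?_
    refine Nat.cast_div_le.trans ?_
    push_cast
    rw [div_eq_mul_inv]
  have h2 : ((harmonic (k ^ 2) : ℚ) : ℝ) ≤ 1 + Real.log ((k ^ 2 : ℕ) : ℝ) :=
    harmonic_le_one_add_log _
  have h3 : Real.log ((k ^ 2 : ℕ) : ℝ) ≤ 2 * (k - 1) := by
    push_cast
    rw [Real.log_pow]
    have := Real.log_le_sub_one_of_pos hk'
    push_cast
    linarith
  calc _ ≤ _ := h1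
    _ ≤ (k : ℝ) ^ 2 * (2 * k) := by
        apply mul_le_mul_of_nonneg_left _ (by positivity)
        linarith
    _ = _ := by ring

lemma le_hypSum (X : ℕ) : (X : ℝ) ^ 2 / 2 ≤ hypSum (fun q b => (b : ℝ) + q) X := by
  have h1 : ∑ b ∈ Finset.Icc 1 X, (b : ℝ) ≤ hypSum (fun q b => (b : ℝ) + q) X := by
    rw [hypSum_swap, hypSum]
    refine Finset.sum_le_sum fun b hb => ?_
    rw [Finset.mem_Icc] at hb
    have h2 : 1 ∈ Finset.Icc 1 (X / b) := by
      rw [Finset.mem_Icc]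
      exact ⟨le_rfl, Nat.div_pos hb.2 (by omega)⟩
    refine le_trans ?_ (Finset.single_le_sum (f := fun q : ℕ => (b : ℝ) + q)
      (fun q _ => by positivity) h2)
    simp
  have h2 : (X : ℝ) ^ 2 / 2 ≤ ∑ b ∈ Finset.Icc 1 X, (b : ℝ) := by
    clear h1
    induction X with
    | zero => simp
    | succ X ih =>
      rw [Finset.sum_Icc_succ_top (by omega)]
      push_cast
      nlinarith
  exact h2.trans h1

/-- The multiplicities determine the order of the group. -/
theorem card_eq_of_specMult_eq {G G' : Subgroup U2} [Finite G] [Finite G']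
    (h : ∀ m, 0 < m → specMult G m = specMult G' m) : Nat.card G = Nat.card G' := by
  obtain ⟨B, hB0, hB⟩ := exists_weyl_bound G
  obtain ⟨B', hB0', hB'⟩ := exists_weyl_bound G'
  by_contra hne
  have hT : ∀ X, ∑ m ∈ Finset.Icc 1 X, (specMult G' m : ℝ) =
      ∑ m ∈ Finset.Icc 1 X, (specMult G m : ℝ) := fun X =>
    Finset.sum_congr rfl fun m hm => by rw [h m (Finset.mem_Icc.1 hm).1]
  have hD : (1 : ℝ) ≤ |(Nat.card G : ℝ) - Nat.card G'| := by
    have h1 : (1 : ℤ) ≤ |(Nat.card G : ℤ) - Nat.card G'| :=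
      Int.one_le_abs (sub_ne_zero.2 (by exact_mod_cast hne))
    exact_mod_cast h1
  set C : ℝ := Nat.card G * (B + B') + B with hC
  obtain ⟨k, hk⟩ := exists_nat_gt (4 * C)
  have hC0 : 0 ≤ C := by positivity
  have hk0 : (0 : ℝ) < k := lt_of_le_of_lt (by positivity) hk
  have e1 := hB (k ^ 2)
  have e2 := hB' (k ^ 2)
  rw [hT] at e2
  have e3 := sum_div_sq_le k
  have e4 := le_hypSum (k ^ 2)
  have hT0 : 0 ≤ ∑ m ∈ Finset.Icc 1 (k ^ 2), (specMult G m : ℝ) :=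
    Finset.sum_nonneg fun _ _ => Nat.cast_nonneg _
  have hH0 : 0 ≤ ∑ q ∈ Finset.Icc 1 (k ^ 2), ((k ^ 2 / q : ℕ) : ℝ) :=
    Finset.sum_nonneg fun _ _ => Nat.cast_nonneg _
  set T := ∑ m ∈ Finset.Icc 1 (k ^ 2), (specMult G m : ℝ)
  set H := ∑ q ∈ Finset.Icc 1 (k ^ 2), ((k ^ 2 / q : ℕ) : ℝ)
  set M := hypSum (fun q b => (b : ℝ) + q) (k ^ 2)
  -- If the orders differ, subtracting the two estimates bounds T itself by the error term, and then
  -- also the main term M, which is too large for that.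
  have h5 : T ≤ (B + B') * H := by
    calc T = 1 * T := (one_mul T).symm
      _ ≤ |(Nat.card G : ℝ) - Nat.card G'| * T := mul_le_mul_of_nonneg_right hD hT0
      _ = |(Nat.card G * T - M) - (Nat.card G' * T - M)| := by
          rw [← abs_of_nonneg hT0, ← abs_mul, abs_of_nonneg hT0]
          congr 1
          ring
      _ ≤ B * H + B' * H := (abs_sub _ _).trans (add_le_add e1 e2)
      _ = _ := by ring
  have h6 : M ≤ C * H := by
    have h7 := (abs_le.1 e1).1
    have h8 : (Nat.card G : ℝ) * T ≤ Nat.card G * ((B + B') * H) :=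
      mul_le_mul_of_nonneg_left h5 (Nat.cast_nonneg _)
    rw [hC]
    linarith
  have h9 : C * H ≤ C * (2 * (k : ℝ) ^ 3) := mul_le_mul_of_nonneg_left e3 hC0
  push_cast at e4
  have h10 : (k : ℝ) ^ 3 * k ≤ (k : ℝ) ^ 3 * (4 * C) := by nlinarith
  have h11 := le_of_mul_le_mul_left h10 (by positivity)
  linarith

/-- Under the divisibility condition every scalar has character value n + 1, while the nonscalar
elements contribute a bounded amount. -/
lemma exists_rate_bound (G : Subgroup U2) [Finite G] : ∃ B : ℝ, 0 ≤ B ∧ ∀ n q : ℕ,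
    (zc G : ℤ) ∣ n - 2 * q →
      |(Nat.card G : ℝ) * Module.finrank ℂ (semiInv G n q) - zc G * (n + 1)| ≤ B := by
  classical
  have := Fintype.ofFinite G
  have hex : ∀ g : G, ∃ B : ℝ, 0 ≤ B ∧ ∀ n q, g ∉ scal G → ‖formChar n q g‖ ≤ B := by
    intro g
    by_cases hg : g ∈ scal G
    · exact ⟨0, le_rfl, fun _ _ h => absurd hg h⟩
    · obtain ⟨B, h0, hB⟩ := norm_formChar_le hg
      exact ⟨B, h0, fun n q _ => hB n q⟩
  choose B hB0 hB using hex
  refine ⟨∑ g, B g, Finset.sum_nonneg fun g _ => hB0 g, fun n q hnq => ?_⟩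
  have h1 := card_mul_finrank (G := G) n q
  rw [← Finset.sum_filter_add_sum_filter_not Finset.univ (· ∈ scal G)] at h1
  have h2 : ∑ g with g ∈ scal G, formChar n q g = (zc G * (n + 1) : ℂ) := by
    rw [Finset.sum_congr rfl (g := fun _ => (n + 1 : ℂ))]
    · rw [Finset.sum_const, nsmul_eq_mul, zc, Nat.card_eq_fintype_card, Fintype.card_subtype]
    · intro g hg
      obtain ⟨c, hc⟩ := (Finset.mem_filter.1 hg).2
      have hc1 := (exists_scalar_iff (G := G) c).1 ⟨g, hc⟩
      have hc0 : c ≠ 0 := by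
        rintro rfl
        rw [zero_pow zc_pos.ne'] at hc1
        exact zero_ne_one hc1
      rw [formChar_scalar hc]
      obtain ⟨t, ht⟩ := hnq
      have : c ^ n / (c * c) ^ q = 1 := by
        have h3 : c ^ ((n : ℤ) - 2 * q) = 1 := by
          rw [ht, zpow_mul, zpow_natCast, hc1, one_zpow]
        rw [← h3, zpow_sub₀ hc0, zpow_mul, zpow_natCast, ← pow_two]
        norm_cast
      rw [this, mul_one]
  rw [h2] at h1
  rw [← Real.norm_eq_abs, ← Complex.norm_real]
  push_cast
  rw [h1, add_sub_cancel_left]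
  refine (norm_sum_le _ _).trans ((Finset.sum_le_sum fun g hg =>
    hB g n q (Finset.mem_filter.1 hg).2).trans ?_)
  exact Finset.sum_le_sum_of_subset_of_nonneg (Finset.filter_subset _ _) fun g _ _ => hB0 g

lemma divisors_two_mul_prime {l : ℕ} (hl : l.Prime) (h2 : 2 < l) :
    (2 * l).divisors = {1, 2, l, 2 * l} := by
  ext d
  simp only [Nat.mem_divisors, Finset.mem_insert, Finset.mem_singleton]
  constructor
  · rintro ⟨h, -⟩
    obtain ⟨a, b, ha, hb, rfl⟩ := (Nat.dvd_mul).1 h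
    rcases (Nat.dvd_prime Nat.prime_two).1 ha with rfl | rfl <;>
      rcases (Nat.dvd_prime hl).1 hb with rfl | rfl <;> simp
  · rintro (rfl | rfl | rfl | rfl)
    · exact ⟨one_dvd _, by omega⟩
    · exact ⟨Dvd.intro _ rfl, by omega⟩
    · exact ⟨Dvd.intro_left _ rfl, by omega⟩
    · exact ⟨dvd_rfl, by omega⟩

lemma specMult_two_mul_prime (G : Subgroup U2) {l : ℕ} (hl : l.Prime) (h2 : 2 < l) :
    specMult G (2 * l) = Module.finrank ℂ (semiInv G (2 * l) 1) +
      Module.finrank ℂ (semiInv G (l + 1) 2) + Module.finrank ℂ (semiInv G (l + 1) l) +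
      Module.finrank ℂ (semiInv G (2 * l) (2 * l)) := by
  have e1 : divDegree (2 * l) 1 = 2 * l := by simp [divDegree]
  have e2 : divDegree (2 * l) 2 = l + 1 := by simp [divDegree]
  have e3 : divDegree (2 * l) l = l + 1 := by
    rw [divDegree, Nat.mul_div_cancel _ (by omega)]; omega
  have e4 : divDegree (2 * l) (2 * l) = 2 * l := by
    rw [divDegree, Nat.div_self (by omega)]; omega
  rw [specMult, divisors_two_mul_prime hl h2, Finset.sum_insert, Finset.sum_insert,
    Finset.sum_insert, Finset.sum_singleton, e1, e2, e3, e4]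
  · ring
  all_goals simp only [Finset.mem_insert, Finset.mem_singleton]; omega

/-- The weight with which the number `z` of scalars enters the growth of the multiplicities. -/
def scalWeight (z : ℕ) : ℕ := if z ∣ 2 then 2 * z else z

/-- The divisors 1, 2, l, 2l of 2l have weights n - 2q equal to 2(l - 1), l - 3, 1 - l and -2l. For
l congruent to 1 modulo z the first and third are divisible by z, and the other two exactly when z
divides 2. In each of these pairs the values n + 1 add up to 3(l + 1). -/
lemma exists_prime_rate_bound (G : Subgroup U2) [Finite G] : ∃ B : ℝ, 0 ≤ B ∧ ∀ l : ℕ, l.Prime →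
    2 < l → zc G ∣ l - 1 →
      |(Nat.card G : ℝ) * specMult G (2 * l) - scalWeight (zc G) * (3 * (l + 1))| ≤ B := by
  obtain ⟨B, hB0, hB⟩ := exists_rate_bound G
  refine ⟨4 * B, by positivity, fun l hl h2 hz => ?_⟩
  rw [specMult_two_mul_prime G hl h2]
  have hz' : (zc G : ℤ) ∣ l - 1 := by
    have := Int.natCast_dvd_natCast.2 hz
    rwa [Nat.cast_sub (by omega), Nat.cast_one] at this
  have b1 := hB (2 * l) 1 (by
    have : ((2 * l : ℕ) : ℤ) - 2 * (1 : ℕ) = 2 * (l - 1) := by push_cast; ring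
    rw [this]
    exact hz'.mul_left 2)
  have b3 := hB (l + 1) l (by
    have : ((l + 1 : ℕ) : ℤ) - 2 * l = -(l - 1) := by push_cast; ring
    rw [this]
    exact (dvd_neg.2 hz'))
  rw [scalWeight]
  by_cases h : zc G ∣ 2
  · have hz2 : (zc G : ℤ) ∣ 2 := by exact_mod_cast Int.natCast_dvd_natCast.2 h
    have b2 := hB (l + 1) 2 (by
      have : ((l + 1 : ℕ) : ℤ) - 2 * (2 : ℕ) = (l - 1) - 2 := by push_cast; ring
      rw [this]
      exact dvd_sub hz' hz2)
    have b4 := hB (2 * l) (2 * l) (by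
      have : ((2 * l : ℕ) : ℤ) - 2 * (2 * l : ℕ) = -(2 * l) := by push_cast; ring
      rw [this]
      exact dvd_neg.2 (hz2.mul_right _))
    rw [if_pos h]
    rw [abs_le] at b1 b2 b3 b4 ⊢
    push_cast at b1 b2 b3 b4 ⊢
    constructor <;> linarith [b1.1, b1.2, b2.1, b2.2, b3.1, b3.2, b4.1, b4.2]
  · have hz2 : ¬(zc G : ℤ) ∣ 2 := fun h' => h (by exact_mod_cast h')
    rw [finrank_semiInv_eq_zero (n := l + 1) (q := 2), finrank_semiInv_eq_zero (n := 2 * l) (q := 2 * l),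
      if_neg h]
    · rw [abs_le] at b1 b3 ⊢
      push_cast at b1 b3 ⊢
      constructor <;> linarith [b1.1, b1.2, b3.1, b3.2]
    · intro h'
      apply hz2
      have : (2 : ℤ) = -(((2 * l : ℕ) : ℤ) - 2 * (2 * l : ℕ)) - 2 * (l - 1) := by push_cast; ring
      rw [this]
      exact dvd_sub (dvd_neg.2 h') (hz'.mul_left 2)
    · intro h'
      apply hz2
      have : (2 : ℤ) = (l - 1) - (((l + 1 : ℕ) : ℤ) - 2 * (2 : ℕ)) := by push_cast; ring
      rw [this]
      exact dvd_sub hz' h'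

/-- The multiplicities determine the number of scalars up to one ambiguity. -/
theorem scalWeight_eq_of_specMult_eq {G G' : Subgroup U2} [Finite G] [Finite G']
    (h : ∀ m, 0 < m → specMult G m = specMult G' m) :
    scalWeight (zc G) = scalWeight (zc G') := by
  have hcard := card_eq_of_specMult_eq h
  obtain ⟨B, hB0, hB⟩ := exists_prime_rate_bound G
  obtain ⟨B', hB0', hB'⟩ := exists_prime_rate_bound G'
  by_contra hne
  have hD : (1 : ℝ) ≤ |(scalWeight (zc G) : ℝ) - scalWeight (zc G')| := by
    have h1 : (1 : ℤ) ≤ |(scalWeight (zc G) : ℤ) - scalWeight (zc G')| :=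
      Int.one_le_abs (sub_ne_zero.2 (by exact_mod_cast hne))
    exact_mod_cast h1
  obtain ⟨k, hk⟩ := exists_nat_gt (B + B')
  -- A prime congruent to 1 modulo both numbers of scalars makes both estimates apply to one
  -- multiplicity, and its size defeats the bounded errors.
  obtain ⟨l, hl, hl2, hl3⟩ := Nat.exists_prime_gt_modEq_one (k := zc G * zc G') (k + 2)
    (Nat.mul_pos zc_pos zc_pos).ne'
  have hdvd : zc G * zc G' ∣ l - 1 := (Nat.modEq_iff_dvd' (by omega)).1 hl3.symm
  have e1 := hB l hl (by omega) (dvd_trans (Dvd.intro _ rfl) hdvd)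
  have e2 := hB' l hl (by omega) (dvd_trans (Dvd.intro_left _ rfl) hdvd)
  rw [← h _ (by omega), ← hcard] at e2
  have hlk : (k : ℝ) + 2 < l := by exact_mod_cast hl2
  have h5 : (3 * ((l : ℝ) + 1)) ≤ B + B' := by
    calc (3 * ((l : ℝ) + 1)) = 1 * (3 * ((l : ℝ) + 1)) := (one_mul _).symm
      _ ≤ |(scalWeight (zc G) : ℝ) - scalWeight (zc G')| * (3 * ((l : ℝ) + 1)) :=
          mul_le_mul_of_nonneg_right hD (by positivity)
      _ = |(Nat.card G * specMult G (2 * l) - scalWeight (zc G') * (3 * ((l : ℝ) + 1))) -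
          (Nat.card G * specMult G (2 * l) - scalWeight (zc G) * (3 * ((l : ℝ) + 1)))| := by
          rw [← abs_of_nonneg (show 0 ≤ 3 * ((l : ℝ) + 1) by positivity), ← abs_mul,
            abs_of_nonneg (show 0 ≤ 3 * ((l : ℝ) + 1) by positivity)]
          congr 1
          ring
      _ ≤ B' + B := (abs_sub _ _).trans (add_le_add e2 e1)
      _ = _ := add_comm _ _
  have : (0 : ℝ) ≤ k := Nat.cast_nonneg k
  linarith

end Asymptotics

/-! ### Structure of the noncommutative groups -/

section Structure

variable {G : Subgroup U2}

lemma IsGen.ne_zero {a g : G} {P : M2} {α β : ℂ} (h : IsGen a g P α β) : α ≠ 0 ∧ β ≠ 0 := by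
  have h1 := mat_det_ne g
  rw [h.diag.det_eq] at h1
  exact mul_ne_zero_iff.1 h1

/-- The number of integers `i` with `|i - l| ≤ l` congruent to `l` modulo `c`. -/
def centDim (l c : ℕ) : ℕ := ((Finset.range (2 * l + 1)).filter fun i => i ≡ l [MOD c]).card

/-- For n = 2q the condition on a monomial is homogeneous of degree zero, so only the ratio β/α
matters, and its order is `relOrd a`. -/
lemma IsGen.cycDim_center {a g : G} {P : M2} {α β : ℂ} (h : IsGen a g P α β) (l : ℕ) :
    cycDim α β (2 * l) l = centDim l (relOrd a) := by
  obtain ⟨hα, hβ⟩ := h.ne_zero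
  rw [cycDim, centDim]
  congr 1
  refine Finset.filter_congr fun i hi => ?_
  rw [Finset.mem_range] at hi
  have hr0 : β / α ≠ 0 := div_ne_zero hβ hα
  have h1 : α ^ i * β ^ (2 * l - i) = (α * β) ^ l ↔ (β / α) ^ l = (β / α) ^ i := by
    have e1 : β ^ (2 * l) = β ^ i * β ^ (2 * l - i) := by rw [← pow_add]; congr 1; omega
    have e2 : β ^ (2 * l) = β ^ l * β ^ l := by rw [← pow_add]; congr 1; omega
    rw [div_pow, div_pow, div_eq_div_iff (pow_ne_zero _ hα) (pow_ne_zero _ hα), mul_pow]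
    constructor
    · intro h2
      have h3 : β ^ l * (β ^ l * α ^ i) = β ^ l * (β ^ i * α ^ l) := by
        calc β ^ l * (β ^ l * α ^ i) = α ^ i * (β ^ l * β ^ l) := by ring
          _ = β ^ i * (α ^ i * β ^ (2 * l - i)) := by rw [← e2, e1]; ring
          _ = _ := by rw [h2]; ring
      exact mul_left_cancel₀ (pow_ne_zero _ hβ) h3
    · intro h2
      have h3 : β ^ i * (α ^ i * β ^ (2 * l - i)) = β ^ i * (α ^ l * β ^ l) := by
        calc β ^ i * (α ^ i * β ^ (2 * l - i)) = α ^ i * (β ^ i * β ^ (2 * l - i)) := by ring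
          _ = β ^ l * (β ^ l * α ^ i) := by rw [← e1, e2]; ring
          _ = _ := by rw [h2]; ring
      exact mul_left_cancel₀ (pow_ne_zero _ hβ) h3
  rw [h1, h.ratio.eq_orderOf, ← Units.val_mk0 hr0, orderOf_units, ← Units.val_pow_eq_pow_val,
    ← Units.val_pow_eq_pow_val, Units.val_inj, pow_eq_pow_iff_modEq]
  exact ⟨Nat.ModEq.symm, Nat.ModEq.symm⟩

variable [Finite G]

instance instFintypeCentSub {K : Type*} [Group K] [Finite K] (Z : Subgroup K) :
    Fintype (CentSub Z) :=
  Fintype.ofFinite _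

/-- The relative orders of the centralizers of the nonscalar elements of `G` are distributed like
the isotropy orders `k₁, k₂, k₃` of a rotation group. -/
structure IsTriple (G : Subgroup U2) [Finite G] (k₁ k₂ k₃ : ℕ) : Prop where
  sum : ∀ F : ℕ → ℚ, 2 * ∑ C : CentSub (scal G), (Nat.card C.1 : ℚ) * F C.relCard =
    Nat.card G * (F k₁ + F k₂ + F k₃)
  inv : (1 : ℚ) / k₁ + 1 / k₂ + 1 / k₃ = 1 + 2 / (scal G).index
  swap : ∀ a ∉ scal G, Multiset.count (relOrd a) {k₁, k₂, k₃} ≤ 1 →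
    ∃ g, Commute a (g * a * g⁻¹) ∧ ¬Commute a g

lemma exists_isTriple (hG : ∃ a b : G, ¬Commute a b) : ∃ k₁ k₂ k₃, IsTriple G k₁ k₂ k₃ ∧
    (k₁ = 2 ∧ k₂ = 2 ∧ (scal G).index = 2 * k₃ ∨ k₁ = 2 ∧ k₂ = 3 ∧
      (k₃ = 3 ∧ (scal G).index = 12 ∨ k₃ = 4 ∧ (scal G).index = 24 ∨
        k₃ = 5 ∧ (scal G).index = 60)) := by
  obtain ⟨k₁, k₂, k₃, h1, h2, h3, h4⟩ := (isCA_scal G).exists_triple hG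
  exact ⟨k₁, k₂, k₃, ⟨h1, h2, fun a ha hc => h4 ⟨_, a, ha, rfl⟩ hc a ha rfl⟩, h3⟩

namespace IsTriple

variable {k₁ k₂ k₃ : ℕ}

/-- The identity `sum` is tested on the indicator function of k; the next lemma does the same with
`relOrd a`. -/
lemma exists_relOrd (h : IsTriple G k₁ k₂ k₃) {k : ℕ} (hk : k = k₁ ∨ k = k₂ ∨ k = k₃) :
    ∃ a : G, a ∉ scal G ∧ relOrd a = k := by
  by_contra hno
  push Not at hno
  have h1 := h.sum (fun j => if j = k then 1 else 0)
  rw [Finset.sum_eq_zero, mul_zero] at h1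
  · have h2 : (0 : ℚ) < Nat.card G := by exact_mod_cast Nat.card_pos
    have h3 := (mul_eq_zero.1 h1.symm).resolve_left h2.ne'
    have hnn : ∀ j : ℕ, (0 : ℚ) ≤ if j = k then 1 else 0 := fun j => by split_ifs <;> norm_num
    rcases hk with rfl | rfl | rfl
    · have e1 := hnn k₂
      have e2 := hnn k₃
      rw [if_pos rfl] at h3
      linarith
    · have e1 := hnn k₁
      have e2 := hnn k₃
      rw [if_pos rfl] at h3
      linarith
    · have e1 := hnn k₁
      have e2 := hnn k₂
      rw [if_pos rfl] at h3
      linarith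
  · rintro ⟨C, a, ha, rfl⟩ _
    rw [if_neg, mul_zero]
    exact hno a ha

lemma relOrd_mem (h : IsTriple G k₁ k₂ k₃) {a : G} (ha : a ∉ scal G) :
    relOrd a = k₁ ∨ relOrd a = k₂ ∨ relOrd a = k₃ := by
  by_contra hno
  push Not at hno
  have h1 := h.sum (fun j => if j = relOrd a then 1 else 0)
  rw [if_neg (Ne.symm hno.1), if_neg (Ne.symm hno.2.1), if_neg (Ne.symm hno.2.2)] at h1
  have h2 := Finset.single_le_sum (f := fun C : CentSub (scal G) =>
    (Nat.card C.1 : ℚ) * if C.relCard = relOrd a then 1 else 0)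
    (fun C _ => by positivity) (Finset.mem_univ ⟨_, a, ha, rfl⟩)
  have h3 : (0 : ℚ) < Nat.card (Subgroup.centralizer {a}) := by exact_mod_cast Nat.card_pos
  have h4 : CentSub.relCard (Z := scal G) ⟨_, a, ha, rfl⟩ = relOrd a := rfl
  simp only [h4, if_true, mul_one] at h2
  linarith

end IsTriple

lemma sum_centralizer_formChar {a g : G} (ha : a ∉ scal G) {P : M2} {α β : ℂ}
    (h : IsGen a g P α β) [Fintype G] [DecidablePred fun b : G => b ∈ Subgroup.centralizer {a}]
    (n q : ℕ) : ∑ b with b ∈ Subgroup.centralizer {a}, formChar n q b =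
      Nat.card (Subgroup.centralizer {a}) * cycDim α β n q := by
  rw [← relOrd_mul_zc ha, ← sum_pow_formChar h.diag n q _ h.left.pow_eq_one h.right.pow_eq_one]
  symm
  refine Finset.sum_bij (fun j _ => g ^ j) ?_ ?_ ?_ (fun _ _ => rfl)
  · intro j _
    rw [Finset.mem_filter, mem_centralizer_singleton]
    exact ⟨Finset.mem_univ _, h.comm.pow_right j⟩
  · intro i hi j hj hij
    have h1 := h.diag.pow i
    have h2 := h.diag.pow j
    rw [← mat_pow] at h1 h2
    rw [hij] at h1
    exact h.left.pow_inj (Finset.mem_range.1 hi) (Finset.mem_range.1 hj) (h1.unique h2).1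
  · intro b hb
    rw [Finset.mem_filter, mem_centralizer_singleton] at hb
    obtain ⟨j, hj, hj'⟩ := h.exists_pow b hb.2
    exact ⟨j, Finset.mem_range.2 hj, hj'⟩

/-- The dimension of a space of semi-invariants in terms of those of the centralizers. -/
lemma IsTriple.two_mul_finrank {k₁ k₂ k₃ : ℕ} (h : IsTriple G k₁ k₂ k₃) (hG : ActsFreely G)
    {n q : ℕ} (hz : (zc G : ℤ) ∣ n - 2 * q) (D : ℕ → ℕ)
    (hD : ∀ (a g : G) (P : M2) (α β : ℂ), a ∉ scal G → IsGen a g P α β →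
      cycDim α β n q = D (relOrd a)) :
    2 * Module.finrank ℂ (semiInv G n q) + (n + 1) = D k₁ + D k₂ + D k₃ := by
  classical
  have := Fintype.ofFinite G
  have h1 := (isCA_scal G).two_mul_sum h.sum h.inv (fun g => formChar n q g)
    (fun k => (D k : ℚ)) (n + 1) ?_ ?_
  · rw [← card_mul_finrank] at h1
    have h0 : (Nat.card G : ℂ) ≠ 0 := by exact_mod_cast Nat.card_pos.ne'
    push_cast at h1
    have h2 : (2 * Module.finrank ℂ (semiInv G n q) : ℂ) = D k₁ + D k₂ + D k₃ - (n + 1) := by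
      apply mul_left_cancel₀ h0
      linear_combination h1
    have h3 : (2 * Module.finrank ℂ (semiInv G n q) + (n + 1) : ℂ) = D k₁ + D k₂ + D k₃ := by
      linear_combination h2
    exact_mod_cast h3
  · rw [Finset.sum_congr rfl (g := fun _ => (n + 1 : ℂ))]
    · rw [Finset.sum_const, nsmul_eq_mul, Nat.card_eq_fintype_card, Fintype.card_subtype]
      push_cast
      rfl
    · intro g hg
      obtain ⟨c, hc⟩ := (Finset.mem_filter.1 hg).2
      have hc1 := (exists_scalar_iff (G := G) c).1 ⟨g, hc⟩
      have hc0 : c ≠ 0 := by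
        rintro rfl
        rw [zero_pow zc_pos.ne'] at hc1
        exact zero_ne_one hc1
      rw [formChar_scalar hc]
      obtain ⟨t, ht⟩ := hz
      have : c ^ n / (c * c) ^ q = 1 := by
        have h3 : c ^ ((n : ℤ) - 2 * q) = 1 := by
          rw [ht, zpow_mul, zpow_natCast, hc1, one_zpow]
        rw [← h3, zpow_sub₀ hc0, zpow_mul, zpow_natCast, ← pow_two]
        norm_cast
      rw [this, mul_one]
  · rintro ⟨C, a, ha, rfl⟩
    obtain ⟨g, P, α, β, hgen⟩ := hG.exists_isGen' ha
    have h2 := sum_centralizer_formChar ha hgen n q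
    rw [hD a g P α β ha hgen] at h2
    push_cast
    exact h2

lemma IsTriple.two_mul_finrank_center {k₁ k₂ k₃ : ℕ} (h : IsTriple G k₁ k₂ k₃)
    (hG : ActsFreely G) (l : ℕ) : 2 * Module.finrank ℂ (semiInv G (2 * l) l) + (2 * l + 1) =
      centDim l k₁ + centDim l k₂ + centDim l k₃ :=
  h.two_mul_finrank hG (by push_cast; simp) (centDim l)
    fun _ _ _ _ _ _ hgen => hgen.cycDim_center l

lemma centDim_of_lt {l c : ℕ} (h : l < c) : centDim l c = 1 := by
  rw [centDim, Finset.card_eq_one]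
  refine ⟨l, ?_⟩
  ext i
  simp only [Finset.mem_filter, Finset.mem_range, Finset.mem_singleton]
  constructor
  · rintro ⟨h1, h2⟩
    rcases le_total i l with h3 | h3
    · have h4 := (Nat.modEq_iff_dvd' h3).1 h2
      have := Nat.eq_zero_of_dvd_of_lt h4 (by omega)
      omega
    · have h4 := (Nat.modEq_iff_dvd' h3).1 h2.symm
      have := Nat.eq_zero_of_dvd_of_lt h4 (by omega)
      omega
  · rintro rfl
    exact ⟨by omega, rfl⟩

lemma relOrd_pow_mem (hG : ActsFreely G) {a : G} (ha : a ∉ scal G) {b : G} (hb : Commute a b) :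
    b ^ relOrd a ∈ scal G := by
  obtain ⟨g, P, α, β, hgen⟩ := hG.exists_isGen' ha
  exact hgen.self_pow_mem hb

/-- If `a` is conjugate to another element of its centralizer, then `det a` lies in `G`. -/
lemma det_pow_zc_of_swap {a g : G} (ha : a ∉ scal G) (h1 : Commute a (g * a * g⁻¹))
    (h2 : ¬Commute a g) : (mat a).det ^ zc G = 1 := by
  rw [← exists_scalar_iff]
  refine ⟨g * a * g⁻¹ * a, ?_⟩
  rw [mat_mul, mat_conj_eq_of_swap ha h1 h2, sub_mul, smul_mul_assoc, one_mul,
    sq_eq_trace_smul_sub, sub_sub_cancel]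

lemma det_pow_of_mem_scal (hz : Even (zc G)) {a : G} (ha : a ∈ scal G) :
    (mat a).det ^ (zc G / 2) = 1 := by
  obtain ⟨c, hc⟩ := ha
  have h1 := (exists_scalar_iff (G := G) c).1 ⟨a, hc⟩
  rw [hc, Matrix.det_smul, Matrix.det_one, mul_one, Fintype.card_fin, ← pow_mul,
    Nat.mul_div_cancel' hz.two_dvd, h1]

/-- The determinant of an element of odd order modulo scalars. -/
lemma det_pow_of_odd (hz : Even (zc G)) {b : G} {k : ℕ} (hk : Odd k) (hb : b ^ k ∈ scal G)
    (hd : (mat b).det ^ zc G = 1) : (mat b).det ^ (zc G / 2) = 1 := by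
  have h1 := det_pow_of_mem_scal hz hb
  obtain ⟨j, rfl⟩ := hk
  rw [mat_pow, Matrix.det_pow, ← pow_mul] at h1
  have h2 : (2 * j + 1) * (zc G / 2) = zc G * j + zc G / 2 := by
    have := Nat.mul_div_cancel' hz.two_dvd
    calc (2 * j + 1) * (zc G / 2) = (2 * (zc G / 2)) * j + zc G / 2 := by ring
      _ = _ := by rw [this]
  rwa [h2, pow_add, pow_mul, hd, one_pow, one_mul] at h1

/-! #### The dihedral case -/

section Dihedral

variable {a : G}

lemma commute_mul_of_not_commute (hidx : 2 * Nat.card (Subgroup.centralizer {a}) = Nat.card G)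
    {y y' : G} (hy : ¬Commute a y) (hy' : ¬Commute a y') : Commute a (y * y') := by
  have h1 : (Subgroup.centralizer {a}).index = 2 := by
    have := (Subgroup.centralizer {a}).card_mul_index
    rw [← hidx, mul_comm 2] at this
    exact Nat.eq_of_mul_eq_mul_left Nat.card_pos this
  have h2 := Subgroup.mul_mem_iff_of_index_two h1 (a := y) (b := y')
  rw [mem_centralizer_singleton, mem_centralizer_singleton, mem_centralizer_singleton] at h2
  exact h2.2 (iff_of_false hy hy')

/-- The centralizer has index two, so y² commutes with a, and it commutes with y. If it were not
scalar, transitivity would make a and y commute. -/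
lemma sq_mem_scal_of_not_commute
    (hidx : 2 * Nat.card (Subgroup.centralizer {a}) = Nat.card G) {y : G} (hy : ¬Commute a y) :
    y ^ 2 ∈ scal G := by
  by_contra hno
  apply hy
  have h1 := commute_mul_of_not_commute hidx hy hy
  rw [← pow_two] at h1
  exact (isCA_scal G).trans _ hno a y h1.symm ((Commute.refl y).pow_left 2)

lemma exists_not_commute (hidx : 2 * Nat.card (Subgroup.centralizer {a}) = Nat.card G) :
    ∃ y, ¬Commute a y := by
  by_contra hno
  push Not at hno
  have h1 : Subgroup.centralizer {a} = ⊤ := by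
    rw [eq_top_iff]
    intro y _
    exact mem_centralizer_singleton.2 (hno y)
  rw [h1, Subgroup.card_top] at hidx
  have : 0 < Nat.card G := Nat.card_pos
  omega

variable (hG : ActsFreely G) (hidx : 2 * Nat.card (Subgroup.centralizer {a}) = Nat.card G)

include hG hidx

lemma trace_eq_zero_of_not_commute {y : G} (hy : ¬Commute a y) : Even (zc G) ∧
    (mat y).trace = 0 ∧ (-(mat y).det) ^ (zc G / 2) = -1 := by
  apply hG.of_sq_scalar _ (sq_mem_scal_of_not_commute hidx hy)
  intro hs
  exact hy (Subgroup.mem_center_iff.1 ((isCA_scal G).le_center hs) a)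

/-- For y off the centralizer, y and cy both satisfy (-det)^(z/2) = -1; dividing isolates det c. -/
lemma det_pow_of_commute {c : G} (hc : Commute a c) : (mat c).det ^ (zc G / 2) = 1 := by
  obtain ⟨y, hy⟩ := exists_not_commute hidx
  have hcy : ¬Commute a (c * y) := fun h => hy (by
    have := hc.inv_right.mul_right h
    simpa using this)
  obtain ⟨-, -, h1⟩ := trace_eq_zero_of_not_commute hG hidx hy
  obtain ⟨-, -, h2⟩ := trace_eq_zero_of_not_commute hG hidx hcy
  rw [mat_mul, Matrix.det_mul, ← mul_neg, mul_pow, h1] at h2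
  linear_combination -h2

/-- Let n be the relative order, m = z/2, d = gcd(n, m) and n' = n/d. The eigenvalues of a generator
satisfy β^n = α^n and (αβ)^m = 1. Since n divides mn', these give α^(zn') = 1. As α has order nz, n
divides n' and d = 1. -/
lemma coprime_relOrd (ha : a ∉ scal G) : Nat.Coprime (relOrd a) (zc G / 2) := by
  obtain ⟨y, hy⟩ := exists_not_commute hidx
  obtain ⟨hz, -, -⟩ := trace_eq_zero_of_not_commute hG hidx hy
  obtain ⟨g, P, α, β, hgen⟩ := hG.exists_isGen' ha
  obtain ⟨hα, hβ⟩ := hgen.ne_zero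
  have h1 := det_pow_of_commute hG hidx hgen.comm
  rw [hgen.diag.det_eq] at h1
  have hz2 := Nat.mul_div_cancel' hz.two_dvd
  set m := zc G / 2 with hm
  set n := relOrd a with hn
  have hn0 : 0 < n := by have := two_le_relOrd ha; omega
  set d := Nat.gcd n m with hd
  have hd0 : 0 < d := Nat.gcd_pos_of_pos_left _ hn0
  obtain ⟨n', hn'⟩ : d ∣ n := Nat.gcd_dvd_left _ _
  obtain ⟨m', hm'⟩ : d ∣ m := Nat.gcd_dvd_right _ _
  have hr : β ^ n = α ^ n := by
    have := hgen.ratio.pow_eq_one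
    rwa [div_pow, div_eq_one_iff_eq (pow_ne_zero _ hα)] at this
  have h2 : α ^ (zc G * n') = 1 := by
    have h3 : (α * β) ^ (m * n') = 1 := by rw [pow_mul, h1, one_pow]
    have h4 : m * n' = n * m' := by rw [hm', hn']; ring
    have h5 : β ^ (m * n') = α ^ (m * n') := by rw [h4, pow_mul, pow_mul, hr]
    rw [mul_pow, h5, ← pow_add, ← two_mul, ← mul_assoc, hz2] at h3
    exact h3
  have h6 := hgen.left.dvd_of_pow_eq_one _ h2
  have hn'0 : 0 < n' := Nat.pos_of_ne_zero fun h0 => by rw [h0] at hn'; omega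
  have h7 : n ∣ n' := by
    rw [mul_comm] at h6
    exact Nat.dvd_of_mul_dvd_mul_left zc_pos h6
  have h8 := Nat.le_of_dvd hn'0 h7
  change d = 1
  nlinarith

end Dihedral

/-! #### The polyhedral case -/

section Polyhedral

variable {k : ℕ} (h : IsTriple G 2 3 k) (hk : 3 ≤ k) (hG : ActsFreely G)

include h hk hG

/-- Take a of relative order 2. This order occurs only once in the triple, so some g conjugates a to
tr(a) - a = -a, that is, g anticommutes with a; so does ag. Then a, g and ag all satisfy
(-det)^(z/2) = -1. If z/2 were even, multiplicativity of the determinant would give (-1)(-1) = -1.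
-/
lemma IsTriple.odd_half_zc : Even (zc G) ∧ Odd (zc G / 2) := by
  obtain ⟨a, ha, ha2⟩ := h.exists_relOrd (k := 2) (Or.inl rfl)
  have hsq : a ^ 2 ∈ scal G := by
    have := relOrd_pow_mem hG ha (Commute.refl a)
    rwa [ha2] at this
  obtain ⟨g, hg1, hg2⟩ := h.swap a ha (by
    rw [ha2]
    simp only [Multiset.insert_eq_cons, Multiset.count_cons, Multiset.count_singleton]
    rw [if_neg (by omega)]
    simp)
  obtain ⟨hz, htr, hd⟩ := hG.of_sq_scalar ha hsq
  have hsw := mat_conj_eq_of_swap ha hg1 hg2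
  rw [htr, zero_smul, zero_sub] at hsw
  have hga : mat g * mat a = -(mat a * mat g) := by
    have h1 : mat (g * a * g⁻¹) * mat g = mat g * mat a := by
      rw [← mat_mul, ← mat_mul]
      congr 1
      group
    rw [← h1, hsw, neg_mul]
  have key : ∀ x : G, mat x * mat a = -(mat a * mat x) → x ∉ scal G → x ^ 2 ∈ scal G := by
    intro x hx _
    have h1 : (mat x).trace = 0 := by
      have h2 : mat (a * x * a⁻¹) = -mat x := by
        rw [mat_mul, mat_mul, ← neg_eq_iff_eq_neg.2 hx, neg_mul, mul_assoc, mat_mul_inv, mul_one]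
      have h3 := trace_mat_conj a x
      rw [h2, Matrix.trace_neg] at h3
      linear_combination -(1 / 2 : ℂ) * h3
    refine ⟨-(mat x).det, ?_⟩
    rw [mat_pow, pow_two, sq_eq_trace_smul_sub, h1, zero_smul, zero_sub, neg_smul]
  have hgs : g ∉ scal G := fun hs =>
    hg2 (Subgroup.mem_center_iff.1 ((isCA_scal G).le_center hs) a)
  have hags : a * g ∉ scal G := fun hs => hg2 (by
    have h1 : Commute a (a * g) := Subgroup.mem_center_iff.1 ((isCA_scal G).le_center hs) a
    have := (Commute.refl a).inv_right.mul_right h1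
    simpa using this)
  obtain ⟨-, -, e1⟩ := hG.of_sq_scalar hgs (key g hga hgs)
  obtain ⟨-, -, e2⟩ := hG.of_sq_scalar hags (key (a * g) (by
    rw [mat_mul, mul_assoc, hga, mul_neg]) hags)
  refine ⟨hz, ?_⟩
  rw [mat_mul, Matrix.det_mul] at e2
  by_contra hodd
  rw [Nat.not_odd_iff_even] at hodd
  rw [hodd.neg_pow] at hd e1 e2
  rw [mul_pow, hd, e1] at e2
  norm_num at e2

lemma IsTriple.det_pow_of_sq {a : G} (ha2 : a ^ 2 ∈ scal G) : (mat a).det ^ (zc G / 2) = 1 := by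
  obtain ⟨hz, hodd⟩ := h.odd_half_zc hk hG
  by_cases ha : a ∈ scal G
  · exact det_pow_of_mem_scal hz ha
  · obtain ⟨-, -, hd⟩ := hG.of_sq_scalar ha ha2
    rw [hodd.neg_pow] at hd
    exact neg_injective hd

lemma IsTriple.det_pow_of_swap {b : G} (hb : b ∉ scal G) (hodd : Odd (relOrd b))
    (hc : Multiset.count (relOrd b) {2, 3, k} ≤ 1) : (mat b).det ^ (zc G / 2) = 1 := by
  obtain ⟨g, hg1, hg2⟩ := h.swap b hb hc
  exact det_pow_of_odd (h.odd_half_zc hk hG).1 hodd (relOrd_pow_mem hG hb (Commute.refl b))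
    (det_pow_zc_of_swap hb hg1 hg2)

end Polyhedral

/-- As 3 does not divide z, the scalar b³ has a cube root u among the scalars of G. By freeness u is
not an eigenvalue of b, so the distinct eigenvalues are u times the two primitive cube roots of
unity, and det b = u². -/
lemma det_pow_of_cube (hG : ActsFreely G) (hz : Even (zc G)) (h3 : ¬3 ∣ zc G) {b : G}
    (hb : b ^ 3 ∈ scal G) : (mat b).det ^ (zc G / 2) = 1 := by
  by_cases hbs : b ∈ scal G
  · exact det_pow_of_mem_scal hz hbs
  obtain ⟨c, hc⟩ := hb
  have hcz := (exists_scalar_iff (G := G) c).1 ⟨_, hc⟩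
  obtain ⟨u, huz, huc⟩ : ∃ u : ℂ, u ^ zc G = 1 ∧ u ^ 3 = c := by
    have hcop : Nat.Coprime 3 (zc G) := (Nat.Prime.coprime_iff_not_dvd Nat.prime_three).2 h3
    have hz1 : 1 < zc G := by
      have := zc_pos (G := G)
      obtain ⟨k, hk⟩ := hz
      omega
    obtain ⟨e, he⟩ := Nat.exists_mul_mod_eq_one_of_coprime hcop hz1
    refine ⟨c ^ e, by rw [← pow_mul, mul_comm, pow_mul, hcz, one_pow], ?_⟩
    rw [← pow_mul, mul_comm]
    conv_lhs => rw [← Nat.div_add_mod (3 * e) (zc G), he.2]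
    rw [pow_add, pow_mul, hcz, one_pow, one_mul, pow_one]
  have hu0 : u ≠ 0 := by
    rintro rfl
    rw [zero_pow zc_pos.ne'] at huz
    exact zero_ne_one huz
  obtain ⟨P, α, β, hD, -, -⟩ := exists_isDiag_mat b
  obtain ⟨s, hs⟩ := (exists_scalar_iff (G := G) u).2 huz
  have hDs := IsDiag.smul_one hD.det_ne u
  rw [← hs] at hDs
  have hcube := hD.pow 3
  rw [← mat_pow] at hcube
  have hD3 := IsDiag.smul_one hD.det_ne c
  rw [← hc] at hD3
  obtain ⟨e1, e2⟩ := hcube.unique hD3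
  have hne := hD.ne_of_notMem hbs
  have hαu : α ≠ u := by
    rintro rfl
    exact hbs ⟨α, by rw [hG.eq_of_left hD hDs, hs]⟩
  have hβu : β ≠ u := by
    rintro rfl
    exact hbs ⟨β, by rw [hG.eq_of_right hD hDs, hs]⟩
  have f1 : α ^ 2 + α * u + u ^ 2 = 0 := by
    have : (α - u) * (α ^ 2 + α * u + u ^ 2) = 0 := by linear_combination e1 - huc
    exact (mul_eq_zero.1 this).resolve_left (sub_ne_zero.2 hαu)
  have f2 : β ^ 2 + β * u + u ^ 2 = 0 := by
    have : (β - u) * (β ^ 2 + β * u + u ^ 2) = 0 := by linear_combination e2 - huc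
    exact (mul_eq_zero.1 this).resolve_left (sub_ne_zero.2 hβu)
  have f3 : α + β + u = 0 := by
    have : (α - β) * (α + β + u) = 0 := by linear_combination f1 - f2
    exact (mul_eq_zero.1 this).resolve_left (sub_ne_zero.2 hne)
  have f4 : α * β = u ^ 2 := by linear_combination α * f3 - f1
  rw [hD.det_eq, f4, ← pow_mul, Nat.mul_div_cancel' hz.two_dvd, huz]

end Structure

/-! ### Determinants in the polyhedral groups -/

section Determinants

variable {G : Subgroup U2}

/-- The elements whose determinant is the square of a scalar in `G`. -/
def detKer (G : Subgroup U2) (m : ℕ) : Subgroup G where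
  carrier := {g | (mat g).det ^ m = 1}
  one_mem' := by simp [mat_one]
  mul_mem' := by
    intro a b ha hb
    change (mat (a * b)).det ^ m = 1
    rw [mat_mul, Matrix.det_mul, mul_pow, show (mat a).det ^ m = 1 from ha,
      show (mat b).det ^ m = 1 from hb, one_mul]
  inv_mem' := by
    intro a ha
    change (mat a⁻¹).det ^ m = 1
    have h1 : ((mat a).det * (mat a⁻¹).det) ^ m = 1 := by
      rw [← Matrix.det_mul, mat_mul_inv, Matrix.det_one, one_pow]
    rwa [mul_pow, show (mat a).det ^ m = 1 from ha, one_mul] at h1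

lemma mem_detKer {m : ℕ} {g : G} : g ∈ detKer G m ↔ (mat g).det ^ m = 1 := Iff.rfl

variable [Finite G]

/-- The argument for odd relative order does not reach order 4, so elements are counted instead. The
kernel contains the scalars and all centralizers of relative order 2 or 3. By the class sum these
have at least (1/2)(1/2 + 2/3) = 7/12 of the elements of G outside the scalars, so the index is less
than two. -/
lemma IsTriple.detKer_eq_top (h : IsTriple G 2 3 4) (hG : ActsFreely G) :
    detKer G (zc G / 2) = ⊤ := by
  classical
  have := Fintype.ofFinite G
  obtain ⟨hz, -⟩ := h.odd_half_zc (by norm_num) hG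
  set H := detKer G (zc G / 2) with hH
  have hmem : ∀ a ∉ scal G, relOrd a = 2 ∨ relOrd a = 3 → ∀ b, Commute a b → b ∈ H := by
    intro a ha ha2 b hb
    rw [hH, mem_detKer]
    by_cases hbs : b ∈ scal G
    · exact det_pow_of_mem_scal hz hbs
    have hab : relOrd b = relOrd a := by
      rw [relOrd, relOrd, (isCA_scal G).centralizer_eq ha hbs hb]
    rcases ha2 with ha2 | ha2
    · apply h.det_pow_of_sq (by norm_num) hG
      have := relOrd_pow_mem hG ha hb
      rwa [ha2] at this
    · apply h.det_pow_of_swap (by norm_num) hG hbs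
      · rw [hab, ha2]; decide
      · rw [hab, ha2]; decide
  have h1 := (isCA_scal G).sum_eq (fun g => if g ∈ H then (1 : ℚ) else 0)
  have hle : scal G ≤ H := fun a ha => by
    rw [hH, mem_detKer]
    exact det_pow_of_mem_scal hz ha
  have hcard : ∀ S : Subgroup G, S ≤ H → ∑ g with g ∈ S, (if g ∈ H then (1 : ℚ) else 0) =
      Nat.card S := by
    intro S hS
    rw [Finset.sum_congr rfl (g := fun _ => (1 : ℚ)), Finset.sum_const, nsmul_one,
      Nat.card_eq_fintype_card, Fintype.card_subtype]
    intro g hg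
    rw [if_pos (hS (Finset.mem_filter.1 hg).2)]
  have h2 : ∑ C : CentSub (scal G), (Nat.card C.1 : ℚ) *
      (if C.relCard = 2 ∨ C.relCard = 3 then 1 - 1 / (C.relCard : ℚ) else 0) ≤
      ∑ C : CentSub (scal G), (∑ g with g ∈ C.1, (if g ∈ H then (1 : ℚ) else 0) -
        ∑ g with g ∈ scal G, if g ∈ H then (1 : ℚ) else 0) := by
    refine Finset.sum_le_sum ?_
    intro C _
    split_ifs with hC
    · have hC' := (isCA_scal G).relCard_mul C
      have h3 : C.1 ≤ H := by
        obtain ⟨C, a, ha, rfl⟩ := C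
        intro b hb
        exact hmem a ha hC b (mem_centralizer_singleton.1 hb)
      have hpos : (C.relCard : ℚ) ≠ 0 := by
        have := (isCA_scal G).two_le_relCard C
        exact_mod_cast (by omega : C.relCard ≠ 0)
      rw [hcard _ h3, hcard _ hle, ← hC']
      push_cast
      field_simp
      rfl
    · rw [mul_zero, sub_nonneg]
      refine Finset.sum_le_sum_of_subset_of_nonneg ?_ fun g _ _ => by split_ifs <;> norm_num
      intro g hg
      rw [Finset.mem_filter] at hg ⊢
      exact ⟨hg.1, (isCA_scal G).le_centSub C hg.2⟩
  have h3 : 2 * ∑ C : CentSub (scal G), (Nat.card C.1 : ℚ) *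
      (if C.relCard = 2 ∨ C.relCard = 3 then 1 - 1 / (C.relCard : ℚ) else 0) =
      Nat.card G * (7 / 6) :=
    (h.sum fun c => if c = 2 ∨ c = 3 then 1 - 1 / (c : ℚ) else 0).trans (by congr 1; norm_num)
  have h4 : ∑ g : G, (if g ∈ H then (1 : ℚ) else 0) = Nat.card H := by
    rw [Finset.sum_ite, Finset.sum_const_zero, add_zero, Finset.sum_const, nsmul_one,
      Nat.card_eq_fintype_card, Fintype.card_subtype]
  rw [h4, hcard _ hle] at h1
  have hGpos : (0 : ℚ) < Nat.card G := by exact_mod_cast Nat.card_pos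
  have hzpos : (0 : ℚ) ≤ Nat.card (scal G) := Nat.cast_nonneg _
  simp only [hcard _ hle] at h2
  have h5 : (Nat.card G : ℚ) < 2 * Nat.card H := by linarith
  have h6 : Nat.card G < 2 * Nat.card H := by exact_mod_cast h5
  rw [← H.card_mul_index] at h6
  have h7 : H.index < 2 := by
    rw [mul_comm 2] at h6
    exact Nat.lt_of_mul_lt_mul_left h6
  have h8 : H.index ≠ 0 := Subgroup.index_ne_zero_of_finite
  exact Subgroup.index_eq_one.1 (by omega)

/-- In the polyhedral groups every determinant is the square of a scalar of the group, unless the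
group is tetrahedral and its number of scalars is divisible by three. -/
lemma IsTriple.det_pow_eq_one {k : ℕ} (h : IsTriple G 2 3 k) (hk : k = 3 ∨ k = 4 ∨ k = 5)
    (hG : ActsFreely G) (h3 : k = 3 → ¬3 ∣ zc G) (g : G) : (mat g).det ^ (zc G / 2) = 1 := by
  by_cases hgs : g ∈ scal G
  · exact det_pow_of_mem_scal (h.odd_half_zc (by omega) hG).1 hgs
  have hg := relOrd_pow_mem hG hgs (Commute.refl g)
  rcases hk with rfl | rfl | rfl
  · have h2 := h.relOrd_mem hgs
    rcases h2 with h2 | h2 | h2 <;> rw [h2] at hg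
    · exact h.det_pow_of_sq le_rfl hG hg
    · exact det_pow_of_cube hG (h.odd_half_zc le_rfl hG).1 (h3 rfl) hg
    · exact det_pow_of_cube hG (h.odd_half_zc le_rfl hG).1 (h3 rfl) hg
  · have h2 := h.detKer_eq_top hG
    rw [← mem_detKer, h2]
    trivial
  · rcases h.relOrd_mem hgs with h2 | h2 | h2
    · rw [h2] at hg
      exact h.det_pow_of_sq (by norm_num) hG hg
    · exact h.det_pow_of_swap (by norm_num) hG hgs (by rw [h2]; decide) (by rw [h2]; decide)
    · exact h.det_pow_of_swap (by norm_num) hG hgs (by rw [h2]; decide) (by rw [h2]; decide)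

end Determinants

/-! ### Conjugate pairs of matrices -/

section Conjugation

open Matrix

/-- A cyclic vector of `B` that is an eigenvector of `A` brings the pair to a normal form given by
traces and determinants. -/
lemma exists_normal_form {A B : M2} {α : ℂ} {v : Fin 2 → ℂ} (hv : A *ᵥ v = α • v)
    (hQ : (!![v 0, (B *ᵥ v) 0; v 1, (B *ᵥ v) 1]).det ≠ 0) :
    ∃ Q : M2, Q.det ≠ 0 ∧
      A * Q = Q * !![α, (A * B).trace - (A.trace - α) * B.trace; 0, A.trace - α] ∧
      B * Q = Q * !![0, -B.det; 1, B.trace] := by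
  set Q : M2 := !![v 0, (B *ᵥ v) 0; v 1, (B *ᵥ v) 1] with hQdef
  have hu := isUnit_iff_ne_zero.2 hQ
  have hA : A = Q * (Q⁻¹ * A * Q) * Q⁻¹ := by
    rw [mul_assoc Q⁻¹, Matrix.mul_nonsing_inv_cancel_left _ _ hu,
      Matrix.mul_nonsing_inv_cancel_right _ _ hu]
  have hB : B = Q * (Q⁻¹ * B * Q) * Q⁻¹ := by
    rw [mul_assoc Q⁻¹, Matrix.mul_nonsing_inv_cancel_left _ _ hu,
      Matrix.mul_nonsing_inv_cancel_right _ _ hu]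
  set N := Q⁻¹ * A * Q with hN
  set M := Q⁻¹ * B * Q with hM
  have hQN : Q * N = A * Q := by rw [hN, mul_assoc, Matrix.mul_nonsing_inv_cancel_left _ _ hu]
  have hQM : Q * M = B * Q := by rw [hM, mul_assoc, Matrix.mul_nonsing_inv_cancel_left _ _ hu]
  have hcan : ∀ w w' : Fin 2 → ℂ, Q *ᵥ w = Q *ᵥ w' → w = w' := fun w w' h =>
    Matrix.mulVec_injective_of_isUnit ((Matrix.isUnit_iff_isUnit_det Q).2 hu) h
  have e1 : Q *ᵥ ![1, 0] = v := by
    ext i; fin_cases i <;> simp [hQdef, Matrix.mulVec, dotProduct, Fin.sum_univ_two]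
  have e2 : Q *ᵥ ![0, 1] = B *ᵥ v := by
    ext i
    fin_cases i <;> simp [hQdef, Matrix.mulVec, dotProduct, Fin.sum_univ_two]
  have n1 : N *ᵥ ![1, 0] = α • ![1, 0] := by
    apply hcan
    rw [Matrix.mulVec_mulVec, hQN, ← Matrix.mulVec_mulVec, e1, hv, Matrix.mulVec_smul, e1]
  have m1 : M *ᵥ ![1, 0] = ![0, 1] := by
    apply hcan
    rw [Matrix.mulVec_mulVec, hQM, ← Matrix.mulVec_mulVec, e1, e2]
  have n00 : N 0 0 = α := by
    have := congrFun n1 0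
    simpa [Matrix.mulVec, dotProduct, Fin.sum_univ_two] using this
  have n10 : N 1 0 = 0 := by
    have := congrFun n1 1
    simpa [Matrix.mulVec, dotProduct, Fin.sum_univ_two] using this
  have m00 : M 0 0 = 0 := by
    have := congrFun m1 0
    simpa [Matrix.mulVec, dotProduct, Fin.sum_univ_two] using this
  have m10 : M 1 0 = 1 := by
    have := congrFun m1 1
    simpa [Matrix.mulVec, dotProduct, Fin.sum_univ_two] using this
  have hconj : ∀ X Y : M2, X = Q * Y * Q⁻¹ → X.trace = Y.trace ∧ X.det = Y.det := by
    rintro X Y rfl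
    constructor
    · rw [Matrix.trace_mul_comm, ← mul_assoc, Matrix.nonsing_inv_mul _ hu, one_mul]
    · rw [Matrix.det_mul, mul_comm, ← Matrix.det_mul, ← mul_assoc, Matrix.nonsing_inv_mul _ hu,
        one_mul]
  have tA := (hconj A N hA).1
  obtain ⟨tB, dB⟩ := hconj B M hB
  have tAB := (hconj (A * B) (N * M) (by
    have h1 : Q * (N * M) = A * B * Q := by
      rw [← mul_assoc, hQN, mul_assoc, hQM, ← mul_assoc]
    rw [h1, Matrix.mul_nonsing_inv_cancel_right _ _ hu])).1
  rw [Matrix.det_fin_two M, m00, m10] at dB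
  simp only [Matrix.trace, Fin.sum_univ_two, Matrix.diag_apply, n00, m00, zero_add] at tA tB
  simp only [Matrix.trace, Fin.sum_univ_two, Matrix.diag_apply, Matrix.mul_apply, n00, n10, m00,
    m10, mul_zero, zero_mul, zero_add, mul_one] at tAB
  have n11 : N 1 1 = A.trace - α := by
    simp only [Matrix.trace, Fin.sum_univ_two, Matrix.diag_apply]
    linear_combination -tA
  have m11 : M 1 1 = B.trace := by
    simp only [Matrix.trace, Fin.sum_univ_two, Matrix.diag_apply]
    linear_combination -tB
  have m01 : M 0 1 = -B.det := by linear_combination dB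
  have n01 : N 0 1 = (A * B).trace - (A.trace - α) * B.trace := by
    rw [← n11, ← m11]
    simp only [Matrix.trace, Fin.sum_univ_two, Matrix.diag_apply, Matrix.mul_apply]
    linear_combination -tAB
  refine ⟨Q, hQ, ?_, ?_⟩
  · rw [← hQN, ← n01, ← n11]
    congr 1
    ext i j
    fin_cases i <;> fin_cases j <;> simp [n00, n10]
  · rw [← hQM, ← m01, ← m11]
    congr 1
    ext i j
    fin_cases i <;> fin_cases j <;> simp [m00, m10]

variable {G G' : Subgroup U2}

/-- If bv were a multiple of the eigenvector v of a, then ab and ba would agree at v, and freeness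
would make a and b commute. -/
lemma ActsFreely.det_cyclic_ne (hG : ActsFreely G) {a b : G} (hab : ¬Commute a b) {α : ℂ}
    {v : Fin 2 → ℂ} (hv0 : v ≠ 0) (hv : mat a *ᵥ v = α • v) :
    (!![v 0, (mat b *ᵥ v) 0; v 1, (mat b *ᵥ v) 1]).det ≠ 0 := by
  intro h0
  rw [Matrix.det_fin_two_of] at h0
  set w := mat b *ᵥ v with hw
  obtain ⟨c, hc⟩ : ∃ c : ℂ, w = c • v := by
    by_cases h1 : v 0 = 0
    · have h2 : v 1 ≠ 0 := fun h2 => hv0 (by ext i; fin_cases i <;> simp [h1, h2])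
      refine ⟨w 1 / v 1, ?_⟩
      have h3 : w 0 = 0 := by
        rw [h1] at h0
        have : w 0 * v 1 = 0 := by linear_combination -h0
        exact (mul_eq_zero.1 this).resolve_right h2
      ext i
      fin_cases i
      · simp [h3, h1]
      · simp [h2]
    · refine ⟨w 0 / v 0, ?_⟩
      ext i
      fin_cases i
      · simp [h1]
      · simp only [Fin.mk_one, Pi.smul_apply, smul_eq_mul]
        field_simp
        linear_combination h0
  apply hab
  have h1 : a * b = b * a := hG.eq_of_mulVec hv0 (by
    rw [mat_mul, mat_mul, ← Matrix.mulVec_mulVec, ← Matrix.mulVec_mulVec, hv, ← hw, hc,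
      Matrix.mulVec_smul, hv, Matrix.mulVec_smul, ← hw, hc, smul_comm])
  exact h1

/-- Two pairs of noncommuting elements with the same traces and determinants are conjugate. -/
lemma exists_conj (hG : ActsFreely G) (hG' : ActsFreely G') {a b : G} {a' b' : G'}
    (hab : ¬Commute a b) (hab' : ¬Commute a' b') (h1 : (mat a).trace = (mat a').trace)
    (h2 : (mat a).det = (mat a').det) (h3 : (mat b).trace = (mat b').trace)
    (h4 : (mat b).det = (mat b').det) (h5 : (mat (a * b)).trace = (mat (a' * b')).trace) :
    ∃ R : M2, R.det ≠ 0 ∧ R * mat a = mat a' * R ∧ R * mat b = mat b' * R := by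
  obtain ⟨P, α, β, hD, -, -⟩ := exists_isDiag_mat a
  obtain ⟨P', α', β', hD', -, -⟩ := exists_isDiag_mat a'
  rw [hD.trace_eq, hD'.trace_eq] at h1
  rw [hD.det_eq, hD'.det_eq] at h2
  obtain ⟨v', hv0', hv'⟩ : ∃ v' : Fin 2 → ℂ, v' ≠ 0 ∧ mat a' *ᵥ v' = α • v' := by
    have h6 : (α - α') * (α - β') = 0 := by linear_combination α * h1 - h2
    rcases mul_eq_zero.1 h6 with h7 | h7
    · exact ⟨_, hD'.mulVec_single_ne 0, by
        rw [hD'.mulVec_single, sub_eq_zero.1 h7]; rfl⟩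
    · exact ⟨_, hD'.mulVec_single_ne 1, by
        rw [hD'.mulVec_single, sub_eq_zero.1 h7]; rfl⟩
  have hv : mat a *ᵥ (P *ᵥ Pi.single 0 1) = α • (P *ᵥ Pi.single 0 1) := hD.mulVec_single 0
  obtain ⟨Q, hQ0, hQA, hQB⟩ := exists_normal_form hv
    (hG.det_cyclic_ne hab (hD.mulVec_single_ne 0) hv)
  obtain ⟨Q', hQ0', hQA', hQB'⟩ := exists_normal_form hv' (hG'.det_cyclic_ne hab' hv0' hv')
  rw [← mat_mul, ← h5, ← h3, hD'.trace_eq, ← h1, ← hD.trace_eq] at hQA'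
  rw [← h3, ← h4] at hQB'
  rw [← mat_mul] at hQA
  have hu := isUnit_iff_ne_zero.2 hQ0
  have key : ∀ X X' N : M2, X * Q = Q * N → X' * Q' = Q' * N →
      Q' * Q⁻¹ * X = X' * (Q' * Q⁻¹) := by
    intro X X' N e e'
    have e1 : Q⁻¹ * X = N * Q⁻¹ := by
      have h8 : X = Q * N * Q⁻¹ := by rw [← e, Matrix.mul_nonsing_inv_cancel_right _ _ hu]
      rw [h8, mul_assoc, Matrix.nonsing_inv_mul_cancel_left _ _ hu]
    rw [mul_assoc, e1, ← mul_assoc, ← e', mul_assoc]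
  refine ⟨Q' * Q⁻¹, ?_, key _ _ _ hQA hQA', key _ _ _ hQB hQB'⟩
  rw [Matrix.det_mul]
  refine mul_ne_zero hQ0' ?_
  have := Matrix.isUnit_nonsing_inv_det Q hu
  exact this.ne_zero

/-- A matrix that conjugates generators of `G` into a group `G'` of the same order induces an
isomorphism. -/
lemma nonempty_mulEquiv_of_conj [Finite G] [Finite G'] (hcard : Nat.card G = Nat.card G')
    (hz : zc G = zc G') {a b : G} {a' b' : G'} {R : M2} (hR : R.det ≠ 0)
    (ha : R * mat a = mat a' * R) (hb : R * mat b = mat b' * R)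
    (hgen : ∀ H : Subgroup G, scal G ≤ H → a ∈ H → b ∈ H → H = ⊤) : Nonempty (G ≃* G') := by
  have hu := isUnit_iff_ne_zero.2 hR
  have hcanr : ∀ X Y : M2, X * R = Y * R → X = Y := fun X Y h => by
    have := congrArg (· * R⁻¹) h
    simpa only [Matrix.mul_nonsing_inv_cancel_right _ _ hu] using this
  have hcanl : ∀ X Y : M2, R * X = R * Y → X = Y := fun X Y h => by
    have := congrArg (R⁻¹ * ·) h
    simpa only [Matrix.nonsing_inv_mul_cancel_left _ _ hu] using this
  -- The elements that R conjugates into G' form a subgroup. It contains the scalars because equal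
  -- numbers of scalars mean the same roots of unity.
  let H : Subgroup G :=
    { carrier := {g | ∃ g' : G', R * mat g = mat g' * R}
      one_mem' := ⟨1, by rw [mat_one, mat_one, mul_one, one_mul]⟩
      mul_mem' := by
        rintro g h ⟨g', hg⟩ ⟨h', hh⟩
        exact ⟨g' * h', by rw [mat_mul, mat_mul, ← mul_assoc, hg, mul_assoc, hh, mul_assoc]⟩
      inv_mem' := by
        rintro g ⟨g', hg⟩
        refine ⟨g'⁻¹, ?_⟩
        have h1 : mat g' * (R * mat g⁻¹) = R := by
          rw [← mul_assoc, ← hg, mul_assoc, mat_mul_inv, mul_one]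
        calc R * mat g⁻¹ = mat g'⁻¹ * (mat g' * (R * mat g⁻¹)) := by
              rw [← mul_assoc (mat g'⁻¹), mat_inv_mul, one_mul]
          _ = mat g'⁻¹ * R := by rw [h1] }
  have hH : H = ⊤ := by
    refine hgen H ?_ ⟨a', ha⟩ ⟨b', hb⟩
    rintro g ⟨c, hc⟩
    have h1 := (exists_scalar_iff (G := G) c).1 ⟨g, hc⟩
    rw [hz] at h1
    obtain ⟨g', hg'⟩ := (exists_scalar_iff (G := G') c).2 h1
    exact ⟨g', by rw [hc, hg', mul_smul_comm, smul_mul_assoc, mul_one, one_mul]⟩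
  have hall : ∀ g : G, ∃ g' : G', R * mat g = mat g' * R := fun g => by
    have : g ∈ H := by rw [hH]; trivial
    exact this
  choose f hf using hall
  let F : G →* G' :=
    { toFun := f
      map_one' := mat_injective (hcanr _ _ (by rw [← hf, mat_one, mat_one, mul_one, one_mul]))
      map_mul' := fun g h => mat_injective (hcanr _ _ (by
        rw [← hf, mat_mul, mat_mul, mul_assoc, ← hf h, ← mul_assoc, ← mul_assoc, hf g])) }
  have hinj : Function.Injective F := by
    intro g h hgh
    have hgh : f g = f h := hgh
    apply mat_injective
    apply hcanl
    rw [hf, hf, hgh]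
  exact ⟨MulEquiv.ofBijective F ((Nat.bijective_iff_injective_and_card F).2 ⟨hinj, hcard⟩)⟩

end Conjugation

/-! ### Isomorphism of dihedral groups -/

section DihedralIso

variable {G G' : Subgroup U2} [Finite G] [Finite G']

/-- The centralizer is cyclic with faithful eigenvalue characters, so η can be prescribed for its
generator g. Elements off the centralizer have trace zero, so y needs only a scalar factor to
normalize its determinant. -/
lemma exists_dihedral_generators (hG : ActsFreely G) {a : G} (ha : a ∉ scal G)
    (hidx : 2 * Nat.card (Subgroup.centralizer {a}) = Nat.card G) {η ζ : ℂ}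
    (hη : IsPrimitiveRoot η (relOrd a * zc G)) (hζ : IsPrimitiveRoot ζ (zc G)) :
    ∃ (g y : G) (β : ℂ), ¬Commute g y ∧ (mat g).trace = η + β ∧ (mat g).det = η * β ∧
      (η * β) ^ (zc G / 2) = 1 ∧ (β / η) ^ relOrd a = 1 ∧ η ≠ 0 ∧ β ≠ 0 ∧ Even (zc G) ∧
      Nat.Coprime (relOrd a) (zc G / 2) ∧
      (mat y).trace = 0 ∧ (mat y).det = -ζ ∧ (mat (g * y)).trace = 0 ∧
      ∀ H : Subgroup G, scal G ≤ H → g ∈ H → y ∈ H → H = ⊤ := by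
  obtain ⟨g, P, β, hgen⟩ := hG.exists_isGen ha hη
  obtain ⟨y₀, hy₀⟩ := exists_not_commute hidx
  obtain ⟨hz, htr, hd⟩ := trace_eq_zero_of_not_commute hG hidx hy₀
  have hzpos := zc_pos (G := G)
  have : NeZero (zc G) := ⟨hzpos.ne'⟩
  have hdz : (-(mat y₀).det) ^ zc G = 1 := by
    have h1 : (-(mat y₀).det) ^ (zc G / 2 * 2) = 1 := by rw [pow_mul, hd]; norm_num
    rwa [Nat.div_mul_cancel hz.two_dvd] at h1
  obtain ⟨j, hj, hj'⟩ := hζ.eq_pow_of_pow_eq_one hdz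
  have hζ2 : ζ ^ (zc G / 2) = -1 := by
    have h1 : ζ ^ (zc G / 2) * ζ ^ (zc G / 2) = 1 := by
      rw [← pow_add, ← two_mul, Nat.mul_div_cancel' hz.two_dvd, hζ.pow_eq_one]
    refine (mul_self_eq_one_iff.1 h1).resolve_left fun h2 => ?_
    have h3 := Nat.le_of_dvd (by obtain ⟨t, ht⟩ := hz; omega) (hζ.dvd_of_pow_eq_one _ h2)
    omega
  have hjodd : Odd j := by
    by_contra hj2
    rw [Nat.not_odd_iff_even] at hj2
    rw [← hj', ← pow_mul, mul_comm, pow_mul, hζ2, hj2.neg_one_pow] at hd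
    norm_num at hd
  -- A scalar ζ^i multiplies the determinant by ζ^(2i). Since j is odd, i can be chosen with 2i + j
  -- = z + 1, which turns ζ^j into ζ.
  obtain ⟨i, hi⟩ : ∃ i, 2 * i + j = zc G + 1 := by
    obtain ⟨t, ht⟩ := hz
    obtain ⟨u, hu⟩ := hjodd
    exact ⟨t - u, by omega⟩
  obtain ⟨s, hs⟩ := (exists_scalar_iff (G := G) (ζ ^ i)).2 (by
    rw [← pow_mul, mul_comm, pow_mul, hζ.pow_eq_one, one_pow])
  have hsc : Commute a s := Subgroup.mem_center_iff.1 ((isCA_scal G).le_center ⟨_, hs⟩) a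
  have hy : ¬Commute a (s * y₀) := fun h => hy₀ (by
    have := hsc.inv_right.mul_right h
    simpa using this)
  have hgy' : ¬Commute a (g * (s * y₀)) := fun h => hy (by
    have := hgen.comm.inv_right.mul_right h
    simpa using this)
  have hgy : ¬Commute g (s * y₀) := by
    intro h
    obtain ⟨l, -, hl⟩ := hgen.exists_pow a (Commute.refl a)
    apply hy
    rw [← hl]
    exact h.pow_left l
  obtain ⟨hη0, hβ0⟩ := hgen.ne_zero
  refine ⟨g, s * y₀, β, hgy, hgen.diag.trace_eq, hgen.diag.det_eq, ?_, hgen.ratio.pow_eq_one,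
    hη0, hβ0, hz, coprime_relOrd hG hidx ha, (trace_eq_zero_of_not_commute hG hidx hy).2.1, ?_,
    (trace_eq_zero_of_not_commute hG hidx hgy').2.1, ?_⟩
  · rw [← hgen.diag.det_eq]
    exact det_pow_of_commute hG hidx hgen.comm
  · rw [mat_mul, Matrix.det_mul, hs, Matrix.det_smul, Matrix.det_one, Fintype.card_fin, mul_one]
    have h1 : (ζ ^ i) ^ 2 * ζ ^ j = ζ := by
      rw [← pow_mul, ← pow_add, mul_comm i, hi, pow_succ, hζ.pow_eq_one, one_mul]
    rw [hj'] at h1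
    linear_combination -h1
  · intro H _ hgH hyH
    rw [eq_top_iff]
    intro x _
    have hC : ∀ c, Commute a c → c ∈ H := by
      intro c hc
      obtain ⟨l, -, rfl⟩ := hgen.exists_pow c hc
      exact H.pow_mem hgH l
    by_cases hx : Commute a x
    · exact hC x hx
    · have h1 := hC _ (commute_mul_of_not_commute hidx hy hx)
      exact (H.mul_mem_cancel_left hyH).1 h1

/-- Given the first eigenvalue η, the second is forced: the quotient of two candidates has order
dividing both n and z/2, which are coprime. Then all traces and determinants of the chosen
generators agree. -/
theorem nonempty_mulEquiv_of_dihedral (hG : ActsFreely G) (hG' : ActsFreely G') {a : G} {a' : G'}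
    (ha : a ∉ scal G) (ha' : a' ∉ scal G')
    (hidx : 2 * Nat.card (Subgroup.centralizer {a}) = Nat.card G)
    (hidx' : 2 * Nat.card (Subgroup.centralizer {a'}) = Nat.card G')
    (hz : zc G = zc G') (hcard : Nat.card G = Nat.card G') : Nonempty (G ≃* G') := by
  have hn : relOrd a = relOrd a' := by
    rw [relOrd, relOrd, hz]
    congr 1
    omega
  have hpos : relOrd a * zc G ≠ 0 := by rw [relOrd_mul_zc ha]; exact Nat.card_pos.ne'
  have hη := Complex.isPrimitiveRoot_exp _ hpos
  have hζ := Complex.isPrimitiveRoot_exp (zc G) zc_pos.ne'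
  set η := Complex.exp (2 * Real.pi * Complex.I / (relOrd a * zc G : ℕ))
  set ζ := Complex.exp (2 * Real.pi * Complex.I / (zc G : ℕ))
  obtain ⟨g, y, β, h1, h2, h3, h4, h5, hη0, hβ0, -, hcop, h6, h7, h8, h9⟩ :=
    exists_dihedral_generators hG ha hidx hη hζ
  rw [hn, hz] at hη
  rw [hz] at hζ
  obtain ⟨g', y', β', h1', h2', h3', h4', h5', -, hβ0', -, -, h6', h7', h8', -⟩ :=
    exists_dihedral_generators hG' ha' hidx' hη hζ
  have hβ : β = β' := by
    have e1 : (β / β') ^ relOrd a = 1 := by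
      have : β / β' = (β / η) / (β' / η) := by field_simp
      rw [this, div_pow, h5, hn, h5', div_one]
    have e2 : (β / β') ^ (zc G / 2) = 1 := by
      have : β / β' = (η * β) / (η * β') := by field_simp
      rw [this, div_pow, h4, hz, h4', div_one]
    have e3 := Nat.eq_one_of_dvd_coprimes hcop (orderOf_dvd_of_pow_eq_one e1)
      (orderOf_dvd_of_pow_eq_one e2)
    rw [orderOf_eq_one_iff, div_eq_one_iff_eq hβ0'] at e3
    exact e3
  obtain ⟨R, hR, hRg, hRy⟩ := exists_conj hG hG' h1 h1' (by rw [h2, h2', hβ]) (by rw [h3, h3', hβ])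
    (by rw [h6, h6']) (by rw [h7, h7']) (by rw [h8, h8'])
  exact nonempty_mulEquiv_of_conj hcard hz hR hRg hRy h9

end DihedralIso

/-! ### Isomorphism of polyhedral groups -/

section PolyhedralIso

variable {G : Subgroup U2}

lemma commute_of_mem_scal {s : G} (hs : s ∈ scal G) (a : G) : Commute a s :=
  Subgroup.mem_center_iff.1 ((isCA_scal G).le_center hs) a

/-- The eigenvalues α ≠ β satisfy α^c = β^c. Dividing α^c - β^c by α - β leaves a symmetric
polynomial in α and β. -/
lemma trace_of_pow_mem_scal {g : G} (hg : g ∉ scal G) :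
    (g ^ 2 ∈ scal G → (mat g).trace = 0) ∧
    (g ^ 3 ∈ scal G → (mat g).trace ^ 2 = (mat g).det) ∧
    (g ^ 4 ∈ scal G → (mat g).trace = 0 ∨ (mat g).trace ^ 2 = 2 * (mat g).det) ∧
    (g ^ 5 ∈ scal G →
      (mat g).trace ^ 4 - 3 * (mat g).trace ^ 2 * (mat g).det + (mat g).det ^ 2 = 0) := by
  obtain ⟨P, α, β, hD, -, -⟩ := exists_isDiag_mat g
  have hne := sub_ne_zero.2 (hD.ne_of_notMem hg)
  have key : ∀ c : ℕ, g ^ c ∈ scal G → α ^ c = β ^ c := by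
    rintro c ⟨u, hu⟩
    have h1 := hD.pow c
    rw [← mat_pow] at h1
    have h2 := IsDiag.smul_one hD.det_ne u
    rw [← hu] at h2
    obtain ⟨e1, e2⟩ := h1.unique h2
    rw [e1, e2]
  rw [hD.trace_eq, hD.det_eq]
  refine ⟨fun h => ?_, fun h => ?_, fun h => ?_, fun h => ?_⟩
  · apply mul_left_cancel₀ hne
    linear_combination key 2 h
  · rw [← sub_eq_zero]
    apply mul_left_cancel₀ hne
    linear_combination key 3 h
  · have h1 : (α + β) * ((α + β) ^ 2 - 2 * (α * β)) = 0 := by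
      apply mul_left_cancel₀ hne
      linear_combination key 4 h
    rcases mul_eq_zero.1 h1 with h2 | h2
    · exact Or.inl h2
    · exact Or.inr (sub_eq_zero.1 h2)
  · apply mul_left_cancel₀ hne
    linear_combination key 5 h

lemma trace_mul_inv (x y : G) :
    (mat (x * y⁻¹)).trace = ((mat x).trace * (mat y).trace - (mat (x * y)).trace) / (mat y).det := by
  have h0 := mat_det_ne y
  have h1 : (mat y).det • mat y⁻¹ = (mat y).trace • (1 : M2) - mat y := by
    have h2 := sq_eq_trace_smul_sub (mat y)
    have h3 := congrArg (· * mat y⁻¹) h2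
    simp only [sub_mul, smul_mul_assoc, mul_assoc, mat_mul_inv, mul_one, one_mul] at h3
    rw [eq_sub_iff_add_eq] at h3 ⊢
    rw [add_comm]
    exact h3
  rw [eq_div_iff h0, mul_comm, ← smul_eq_mul, ← Matrix.trace_smul, mat_mul, ← mul_smul_comm, h1,
    mul_sub, mul_smul_comm, mul_one, Matrix.trace_sub, Matrix.trace_smul, smul_eq_mul, mat_mul,
    mul_comm]

/-- `x` generates the centralizer of order `k` modulo scalars. -/
structure IsPolyGen (k : ℕ) (x : G) : Prop where
  notMem : x ∉ scal G
  relOrd_eq : relOrd x = k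
  exists_pow : ∀ b, Commute x b → ∃ s ∈ scal G, ∃ j : ℕ, b = s * x ^ j

namespace IsPolyGen

variable {k : ℕ} {x : G}

lemma smul (h : IsPolyGen k x) {s : G} (hs : s ∈ scal G) : IsPolyGen k (s * x) := by
  have hsx : s * x ∉ scal G := fun h' => h.notMem (((scal G).mul_mem_cancel_left hs).1 h')
  have hcomm : Commute x (s * x) := (commute_of_mem_scal hs x).mul_right (Commute.refl x)
  refine ⟨hsx, ?_, fun b hb => ?_⟩
  · rw [← h.relOrd_eq, relOrd, relOrd, (isCA_scal G).centralizer_eq h.notMem hsx hcomm]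
  · obtain ⟨t, ht, j, rfl⟩ := h.exists_pow b ((isCA_scal G).trans _ hsx x b hcomm.symm hb)
    refine ⟨t * (s ^ j)⁻¹, (scal G).mul_mem ht ((scal G).inv_mem ((scal G).pow_mem hs j)), j, ?_⟩
    rw [(commute_of_mem_scal hs x).symm.mul_pow]
    group

lemma conjugate (h : IsPolyGen k x) (g : G) : IsPolyGen k (g * x * g⁻¹) := by
  refine ⟨(isCA_scal G).conj_notMem h.notMem g, ?_, fun b hb => ?_⟩
  · rw [← h.relOrd_eq, relOrd, relOrd, centralizer_conj]
    congr 1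
    exact Nat.card_congr (Subgroup.equivMapOfInjective _ _ (MulAut.conj g).injective).symm.toEquiv
  · rw [← mem_centralizer_singleton, centralizer_conj] at hb
    obtain ⟨c, hc, rfl⟩ := hb
    obtain ⟨s, hs, j, rfl⟩ := h.exists_pow c (mem_centralizer_singleton.1 hc)
    refine ⟨s, hs, j, ?_⟩
    have h1 : g * s = s * g := commute_of_mem_scal hs g
    change g * (s * x ^ j) * g⁻¹ = s * (g * x * g⁻¹) ^ j
    rw [conj_pow, ← mul_assoc, h1]
    group

lemma inv (h : IsPolyGen k x) : IsPolyGen k x⁻¹ := by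
  have hx : x⁻¹ ∉ scal G := fun h' => h.notMem ((scal G).inv_mem_iff.1 h')
  have hcomm : Commute x x⁻¹ := (Commute.refl x).inv_right
  refine ⟨hx, ?_, fun b hb => ?_⟩
  · rw [← h.relOrd_eq, relOrd, relOrd, (isCA_scal G).centralizer_eq h.notMem hx hcomm]
  · obtain ⟨t, ht, j, hj⟩ := h.exists_pow b⁻¹ (by simpa using hb.inv_inv)
    refine ⟨t⁻¹, (scal G).inv_mem ht, j, ?_⟩
    rw [← inv_inj, hj, mul_inv_rev, inv_inv, ← inv_pow, inv_inv]
    exact (commute_of_mem_scal ht (x ^ j)).symm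

lemma mem_of_commute (h : IsPolyGen k x) {H : Subgroup G} (hZ : scal G ≤ H) (hx : x ∈ H) {b : G}
    (hb : Commute x b) : b ∈ H := by
  obtain ⟨s, hs, j, rfl⟩ := h.exists_pow b hb
  exact H.mul_mem (hZ hs) (H.pow_mem hx j)

end IsPolyGen

/-- Since x⁵ is scalar, (x²)^(3j) = x^(5j) x^j recovers x^j up to a scalar. Squaring is used to pass
between the two golden-ratio conjugate traces. -/
lemma IsPolyGen.sq {x : G} (h : IsPolyGen 5 x) (hx2 : x ^ 2 ∉ scal G) (hx5 : x ^ 5 ∈ scal G) :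
    IsPolyGen 5 (x ^ 2) := by
  have hcomm : Commute x (x ^ 2) := (Commute.refl x).pow_right 2
  refine ⟨hx2, ?_, fun b hb => ?_⟩
  · rw [← h.relOrd_eq, relOrd, relOrd, (isCA_scal G).centralizer_eq h.notMem hx2 hcomm]
  · obtain ⟨t, ht, j, rfl⟩ := h.exists_pow b ((isCA_scal G).trans _ hx2 x b hcomm.symm hb)
    refine ⟨t * ((x ^ 5) ^ j)⁻¹,
      (scal G).mul_mem ht ((scal G).inv_mem ((scal G).pow_mem hx5 j)), 3 * j, ?_⟩
    rw [mul_assoc, ← pow_mul, ← pow_mul]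
    congr 1
    rw [eq_inv_mul_iff_mul_eq, ← pow_add]
    congr 1
    ring

lemma trace_sq (x : G) : (mat (x ^ 2)).trace = (mat x).trace ^ 2 - 2 * (mat x).det := by
  rw [mat_pow, pow_two, sq_eq_trace_smul_sub, Matrix.trace_sub, Matrix.trace_smul,
    Matrix.trace_smul, Matrix.trace_one, Fintype.card_fin]
  simp only [smul_eq_mul]
  push_cast
  ring

lemma mul_notMem_of_not_commute {x y : G} (h : ¬Commute x y) : x * y ∉ scal G := fun hs => h (by
  have := (Commute.refl x).inv_right.mul_right (commute_of_mem_scal hs x)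
  simpa using this)

variable [Finite G] {k : ℕ}

/-- The orders and the indices of the polyhedral groups. -/
def IsPolyIndex (k N : ℕ) : Prop := k = 3 ∧ N = 12 ∨ k = 4 ∧ N = 24 ∨ k = 5 ∧ N = 60

/-- Otherwise the centralizer would be normal, of index 1 or 2 by `exists_card_stabilizer`, so that
N = k or N = 2k, while N is 12, 24 or 60. -/
lemma exists_conj_not_commute (hk : IsPolyIndex k (scal G).index) {x : G} (hx : x ∉ scal G)
    (hxk : relOrd x = k) : ∃ g, ¬Commute x (g * x * g⁻¹) := by
  by_contra hno
  push Not at hno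
  obtain ⟨w, hw, hw2⟩ := exists_card_stabilizer (isCA_scal G) ⟨_, x, hx, rfl⟩
  have hw2 : w = 1 ∨ w = 2 := hw2.imp_right And.left
  let := centSubAction (isCA_scal G)
  have h1 : MulAction.stabilizer G (⟨_, x, hx, rfl⟩ : CentSub (scal G)) = ⊤ := by
    rw [eq_top_iff]
    intro g _
    rw [MulAction.mem_stabilizer_iff]
    exact (mem_stabilizer_centSub (isCA_scal G) hx g).2 (hno g)
  rw [h1, Subgroup.card_top] at hw
  have hw : Nat.card G = w * Nat.card (Subgroup.centralizer {x}) := hw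
  rw [← relOrd_mul_zc hx, hxk, ← (scal G).card_mul_index, ← mul_assoc, mul_comm] at hw
  have h2 : (scal G).index = w * k := Nat.eq_of_mul_eq_mul_right zc_pos hw
  rcases hk with ⟨rfl, hN⟩ | ⟨rfl, hN⟩ | ⟨rfl, hN⟩ <;> rcases hw2 with rfl | rfl <;> omega

/-- Two noncommuting centralizers of order `k` generate a polyhedral group. -/
lemma eq_top_of_isPolyGen (hk : IsPolyIndex k (scal G).index) {x y : G} (hx : IsPolyGen k x)
    (hy : IsPolyGen k y) (hxy : ¬Commute x y) {H : Subgroup G} (hZ : scal G ≤ H) (hxH : x ∈ H)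
    (hyH : y ∈ H) : H = ⊤ := by
  classical
  have hCA := (isCA_scal G).subgroupOf H
  have hk3 : 3 ≤ k := by rcases hk with h | h | h <;> omega
  let x' : H := ⟨x, hxH⟩
  let y' : H := ⟨y, hyH⟩
  have hxy' : ¬Commute x' y' := fun h => hxy (h.map H.subtype)
  obtain ⟨k₁, k₂, k₃, hsum, -, hcl, -⟩ := hCA.exists_triple ⟨x', y', hxy'⟩
  have hzH : Nat.card ((scal G).subgroupOf H) = zc G :=
    Nat.card_congr (Subgroup.subgroupOfEquivOfLe hZ).toEquiv
  have hcent : ∀ (a : G) (haH : a ∈ H), IsPolyGen k a →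
      Nat.card (Subgroup.centralizer {(⟨a, haH⟩ : H)}) = k * zc G := by
    intro a haH ha
    have h1 : Subgroup.centralizer {(⟨a, haH⟩ : H)} =
        (Subgroup.centralizer {a}).subgroupOf H := by
      ext b
      rw [Subgroup.mem_subgroupOf, mem_centralizer_singleton, mem_centralizer_singleton]
      exact ⟨fun h => h.map H.subtype, fun h => Subtype.ext h⟩
    have h2 : Subgroup.centralizer {a} ≤ H := fun b hb =>
      ha.mem_of_commute hZ haH (mem_centralizer_singleton.1 hb)
    rw [h1, Nat.card_congr (Subgroup.subgroupOfEquivOfLe h2).toEquiv, ← ha.relOrd_eq,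
      relOrd_mul_zc ha.notMem]
  let Cx : CentSub ((scal G).subgroupOf H) :=
    ⟨_, x', fun h => hx.notMem (Subgroup.mem_subgroupOf.1 h), rfl⟩
  let Cy : CentSub ((scal G).subgroupOf H) :=
    ⟨_, y', fun h => hy.notMem (Subgroup.mem_subgroupOf.1 h), rfl⟩
  have hCx : Nat.card Cx.1 = k * zc G := hcent x hxH hx
  have hCy : Nat.card Cy.1 = k * zc G := hcent y hyH hy
  have hrx : Cx.relCard = k := by
    rw [CentSub.relCard, hCx, hzH, Nat.mul_div_cancel _ zc_pos]
  have hry : Cy.relCard = k := by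
    rw [CentSub.relCard, hCy, hzH, Nat.mul_div_cancel _ zc_pos]
  have hne : Cx ≠ Cy := by
    intro h
    apply hxy'
    have h1 : y' ∈ Cx.1 := by
      rw [h]
      exact mem_centralizer_singleton.2 (Commute.refl y')
    exact mem_centralizer_singleton.1 h1
  have h1 := hsum (fun j => if j = k then 1 else 0)
  have h2 : 2 * (k * zc G : ℚ) ≤ ∑ C : CentSub ((scal G).subgroupOf H),
      (Nat.card C.1 : ℚ) * (if C.relCard = k then 1 else 0) := by
    have h3 := Finset.sum_le_sum_of_subset_of_nonneg (Finset.subset_univ {Cx, Cy})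
      (f := fun C : CentSub ((scal G).subgroupOf H) =>
        (Nat.card C.1 : ℚ) * (if C.relCard = k then 1 else 0)) (fun C _ _ => by positivity)
    rw [Finset.sum_pair hne, if_pos hrx, if_pos hry, hCx, hCy] at h3
    push_cast at h3
    linarith
  have hcard : Nat.card H = zc G * ((scal G).subgroupOf H).index := by
    rw [← hzH, Subgroup.card_mul_index]
  have hzq : (0 : ℚ) < zc G := by exact_mod_cast zc_pos
  have hkq : (3 : ℚ) ≤ k := by exact_mod_cast hk3
  have h4 : 4 * (k : ℚ) ≤ ((scal G).subgroupOf H).index *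
      ((if k₁ = k then 1 else 0) + (if k₂ = k then 1 else 0) + (if k₃ = k then 1 else 0)) := by
    rw [hcard] at h1
    push_cast at h1
    have h5 : zc G * (4 * (k : ℚ)) ≤ zc G * (((scal G).subgroupOf H).index *
      ((if k₁ = k then 1 else 0) + (if k₂ = k then 1 else 0) + (if k₃ = k then 1 else 0))) := by
      linarith
    exact le_of_mul_le_mul_left h5 hzq
  apply Subgroup.eq_top_of_le_card
  rw [hcard, ← (scal G).card_mul_index]
  apply Nat.mul_le_mul_left
  -- H is itself classified by a triple, and h4 bounds 4k by the index in H times the number of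
  -- entries equal to k. In a dihedral triple only k₃ can equal k, with index 2k, which is too
  -- small. The polyhedral triples that remain have index at least that of G.
  rcases hcl with ⟨rfl, rfl, hN⟩ | ⟨rfl, rfl, hN⟩
  · exfalso
    rw [if_neg (by omega), hN] at h4
    split_ifs at h4 with h5
    · rw [h5] at h4
      push_cast at h4
      linarith
    · norm_num at h4
      linarith
  · rw [if_neg (show ¬2 = k by omega)] at h4
    rcases hk with ⟨rfl, hN'⟩ | ⟨rfl, hN'⟩ | ⟨rfl, hN'⟩
    · omega
    · rcases hN with ⟨rfl, hN⟩ | ⟨rfl, hN⟩ | ⟨rfl, hN⟩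
      · norm_num at h4
      · omega
      · norm_num at h4
    · rcases hN with ⟨rfl, hN⟩ | ⟨rfl, hN⟩ | ⟨rfl, hN⟩
      · norm_num at h4
      · norm_num at h4
      · omega

lemma IsGen.isPolyGen {a g : G} {P : M2} {α β : ℂ} (hgen : IsGen a g P α β) (ha : a ∉ scal G) :
    IsPolyGen (relOrd a) g ∧ ∀ j, g ^ j ∈ scal G → relOrd a ∣ j := by
  obtain ⟨hα, hβ⟩ := hgen.ne_zero
  have hgs : ∀ j, g ^ j ∈ scal G → relOrd a ∣ j := by
    rintro j ⟨c, hc⟩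
    apply hgen.ratio.dvd_of_pow_eq_one
    have h1 := hgen.diag.pow j
    rw [← mat_pow] at h1
    have h2 := IsDiag.smul_one hgen.diag.det_ne c
    rw [← hc] at h2
    obtain ⟨e1, e2⟩ := h1.unique h2
    rw [div_pow, e1, e2, div_self]
    rw [← e1]
    exact pow_ne_zero _ hα
  have hg1 : g ∉ scal G := fun h => by
    have h1 := hgs 1 (by rwa [pow_one])
    have := two_le_relOrd ha
    have := Nat.le_of_dvd one_pos h1
    omega
  refine ⟨⟨hg1, ?_, fun b hb => ?_⟩, hgs⟩
  · rw [relOrd, relOrd, (isCA_scal G).centralizer_eq ha hg1 hgen.comm]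
  · obtain ⟨j, -, rfl⟩ := hgen.exists_pow b ((isCA_scal G).trans g hg1 a b hgen.comm.symm hb)
    exact ⟨1, (scal G).one_mem, j, by rw [one_mul]⟩

/-- A generator of a centralizer of order `k` with determinant one. -/
lemma exists_isPolyGen_det_one (hG : ActsFreely G) {a : G} (ha : a ∉ scal G)
    (hz : Even (zc G)) (hdet : ∀ g : G, (mat g).det ^ (zc G / 2) = 1) :
    ∃ x : G, IsPolyGen (relOrd a) x ∧ (mat x).det = 1 ∧ ∀ j, x ^ j ∈ scal G → relOrd a ∣ j := by
  obtain ⟨g, P, α, β, hgen⟩ := hG.exists_isGen' ha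
  obtain ⟨hpg, hgs⟩ := hgen.isPolyGen ha
  obtain ⟨u, hu⟩ := IsAlgClosed.exists_pow_nat_eq ((mat g).det)⁻¹ (n := 2) (by norm_num)
  obtain ⟨s, hs⟩ := (exists_scalar_iff (G := G) u).2 (by
    rw [← Nat.mul_div_cancel' hz.two_dvd, pow_mul, hu, inv_pow, hdet, inv_one])
  have hsm : s ∈ scal G := ⟨u, hs⟩
  refine ⟨s * g, hpg.smul hsm, ?_, fun j hj => hgs j ?_⟩
  · rw [mat_mul, Matrix.det_mul, hs, Matrix.det_smul, Matrix.det_one, mul_one, Fintype.card_fin, hu,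
      inv_mul_cancel₀ (mat_det_ne g)]
  · rw [(commute_of_mem_scal hsm g).symm.mul_pow] at hj
    exact ((scal G).mul_mem_cancel_left ((scal G).pow_mem hsm j)).1 hj

/-- The trace `s` of the chosen generators of a polyhedral group and the trace `p` of their
product. -/
def IsPolyTrace (k : ℕ) (s p : ℂ) : Prop :=
  k = 3 ∧ s = 1 ∧ p = 1 ∨ k = 4 ∧ s ^ 2 = 2 ∧ p = 1 ∨ k = 5 ∧ s ^ 2 = s + 1 ∧ p = s

lemma exists_neg_one (hz : Even (zc G)) : ∃ m ∈ scal G, mat m = (-1 : ℂ) • (1 : M2) := by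
  obtain ⟨m, hm⟩ := (exists_scalar_iff (G := G) (-1)).2 hz.neg_one_pow
  exact ⟨m, ⟨_, hm⟩, hm⟩

/-- A generator of determinant one has trace ±1 for k = 3, a square root of 2 for k = 4, and ±s or
±(1 - s) for k = 5. The scalar -1 lies in G and adjusts the sign, and for k = 5 passing to x² leads
from 1 - s to s up to sign. -/
lemma IsTriple.exists_isPolyGen_trace (h : IsTriple G 2 3 k) (hk : 3 ≤ k) (hG : ActsFreely G)
    (hdet : ∀ g : G, (mat g).det ^ (zc G / 2) = 1) {s p : ℂ} (hsp : IsPolyTrace k s p) :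
    ∃ x : G, IsPolyGen k x ∧ (mat x).det = 1 ∧ (mat x).trace = s := by
  obtain ⟨hz, -⟩ := h.odd_half_zc hk hG
  obtain ⟨a, ha, hak⟩ := h.exists_relOrd (k := k) (Or.inr (Or.inr rfl))
  obtain ⟨x, hx, hxd, hxj⟩ := exists_isPolyGen_det_one hG ha hz hdet
  rw [hak] at hx hxj
  obtain ⟨m, hm, hm1⟩ := exists_neg_one hz
  have hsgn : ∀ y : G, IsPolyGen k y → (mat y).det = 1 →
      ((mat y).trace = s ∨ (mat y).trace = -s) →
      ∃ x : G, IsPolyGen k x ∧ (mat x).det = 1 ∧ (mat x).trace = s := by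
    rintro y hy hyd (e | e)
    · exact ⟨y, hy, hyd, e⟩
    · refine ⟨m * y, hy.smul hm, ?_, ?_⟩
      · rw [mat_mul, Matrix.det_mul, hm1, hyd, Matrix.det_smul, Matrix.det_one, Fintype.card_fin]
        norm_num
      · rw [mat_mul, hm1, smul_mul_assoc, one_mul, Matrix.trace_smul, smul_eq_mul, neg_one_mul, e,
          neg_neg]
  have hpow := relOrd_pow_mem hG hx.notMem (Commute.refl x)
  rw [hx.relOrd_eq] at hpow
  obtain ⟨t2, t3, t4, t5⟩ := trace_of_pow_mem_scal hx.notMem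
  rw [hxd] at t3 t4 t5
  have hx2 : x ^ 2 ∉ scal G := fun h2 => by
    have := Nat.le_of_dvd two_pos (hxj 2 h2)
    omega
  rcases hsp with ⟨rfl, hs, -⟩ | ⟨rfl, hs, -⟩ | ⟨rfl, hs, -⟩
  · refine hsgn x hx hxd ?_
    rw [hs]
    exact mul_self_eq_one_iff.1 (by rw [← pow_two, t3 hpow])
  · refine hsgn x hx hxd (sq_eq_sq_iff_eq_or_eq_neg.1 ?_)
    rcases t4 hpow with h0 | h0
    · exfalso
      apply hx2
      refine ⟨-1, ?_⟩
      rw [mat_pow, pow_two, sq_eq_trace_smul_sub, h0, hxd, zero_smul, zero_sub, neg_smul]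
    · rw [h0, hs, mul_one]
  · have h5 := t5 hpow
    -- With s² = s + 1 the quartic in t = tr x is (t² - s²)(t² - (1 - s)²). In the second case x²
    -- has trace (1 - s)² - 2 = -s.
    have h6 : ((mat x).trace - s) * ((mat x).trace + s) *
        (((mat x).trace - (1 - s)) * ((mat x).trace + (1 - s))) = 0 := by
      linear_combination h5 - ((mat x).trace ^ 2 * 2 - s ^ 2 + s - 1) * hs
    rcases mul_eq_zero.1 h6 with h7 | h7
    · refine hsgn x hx hxd ?_
      rcases mul_eq_zero.1 h7 with h8 | h8
      · exact Or.inl (sub_eq_zero.1 h8)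
      · exact Or.inr (eq_neg_of_add_eq_zero_left h8)
    · refine hsgn (x ^ 2) (hx.sq hx2 hpow) (by rw [mat_pow, Matrix.det_pow, hxd, one_pow])
        (Or.inr ?_)
      rw [trace_sq, hxd]
      linear_combination h7 + hs

/-- The traces of the nonscalar elements of determinant one. -/
lemma IsTriple.trace_mem (h : IsTriple G 2 3 k) (hG : ActsFreely G) {g : G} (hg : g ∉ scal G)
    (hd : (mat g).det = 1) : (mat g).trace = 0 ∨ (mat g).trace ^ 2 = 1 ∨
      (k = 4 ∧ (mat g).trace ^ 2 = 2) ∨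
      (k = 5 ∧ (mat g).trace ^ 4 - 3 * (mat g).trace ^ 2 + 1 = 0) ∨ k ≠ 3 ∧ k ≠ 4 ∧ k ≠ 5 := by
  obtain ⟨t2, t3, t4, t5⟩ := trace_of_pow_mem_scal hg
  rw [hd] at t3 t4 t5
  have hpow := relOrd_pow_mem hG hg (Commute.refl g)
  rcases h.relOrd_mem hg with e | e | e <;> rw [e] at hpow
  · exact Or.inl (t2 hpow)
  · exact Or.inr (Or.inl (t3 hpow))
  · by_cases h3 : k = 3
    · subst h3
      exact Or.inr (Or.inl (t3 hpow))
    by_cases h4 : k = 4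
    · subst h4
      rcases t4 hpow with h5 | h5
      · exact Or.inl h5
      · exact Or.inr (Or.inr (Or.inl ⟨rfl, by rw [h5, mul_one]⟩))
    by_cases h5 : k = 5
    · subst h5
      have := t5 hpow
      exact Or.inr (Or.inr (Or.inr (Or.inl ⟨rfl, by linear_combination this⟩)))
    · exact Or.inr (Or.inr (Or.inr (Or.inr ⟨h3, h4, h5⟩)))

/-- In this and the next two lemmas p is the trace of xy and s² - p that of xy⁻¹, for x and y of
determinant one and trace s. Both must occur in the list of `IsTriple.trace_mem`, which pins them
down up to replacing y by y⁻¹. -/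
lemma tetra_trace {p : ℂ} (h1 : p = 0 ∨ p ^ 2 = 1) (h2 : 1 - p = 0 ∨ (1 - p) ^ 2 = 1) :
    p = 1 ∨ 1 - p = 1 := by
  rcases h1 with rfl | h1
  · simp
  rcases mul_self_eq_one_iff.1 ((pow_two p).symm.trans h1) with rfl | rfl
  · simp
  · norm_num at h2

lemma octa_trace {p : ℂ} (h1 : p = 0 ∨ p ^ 2 = 1 ∨ p ^ 2 = 2)
    (h2 : 2 - p = 0 ∨ (2 - p) ^ 2 = 1 ∨ (2 - p) ^ 2 = 2) : p = 1 := by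
  rcases h1 with rfl | h1 | h1
  · norm_num at h2
  · rcases mul_self_eq_one_iff.1 ((pow_two p).symm.trans h1) with rfl | rfl
    · rfl
    · norm_num at h2
  · exfalso
    rcases h2 with h2 | h2 | h2
    · have : p = 2 := by linear_combination -h2
      rw [this] at h1
      norm_num at h1
    · have : p = 5 / 4 := by linear_combination (h1 - h2) / 4
      rw [this] at h1
      norm_num at h1
    · have : p = 1 := by linear_combination (h1 - h2) / 4
      rw [this] at h1
      norm_num at h1

lemma icosa_trace {s p : ℂ} (hs : s ^ 2 = s + 1)
    (h1 : p = 0 ∨ p ^ 2 = 1 ∨ p ^ 4 - 3 * p ^ 2 + 1 = 0)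
    (h2 : s + 1 - p = 0 ∨ (s + 1 - p) ^ 2 = 1 ∨ (s + 1 - p) ^ 4 - 3 * (s + 1 - p) ^ 2 + 1 = 0) :
    p = s ∨ s + 1 - p = s := by
  -- The conclusion is the vanishing of the norm form of ℚ(√5). Every excluded case reduces to m s +
  -- n = 0 for explicit integers whose norm is nonzero.
  have key : ∀ m n : ℂ, m * s + n = 0 → n ^ 2 + n * m - m ^ 2 = 0 := by
    intro m n hmn
    linear_combination (n - m * s + m) * hmn + m ^ 2 * hs
  rcases h1 with rfl | h1 | h1
  · exfalso
    rcases h2 with h2 | h2 | h2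
    · have := key 1 1 (by linear_combination h2); norm_num at this
    · have := key 3 1 (by linear_combination h2 - hs); norm_num at this
    · have := key 12 8 (by linear_combination h2 - (s ^ 2 + 5 * s + 9) * hs); norm_num at this
  · rcases mul_self_eq_one_iff.1 ((pow_two p).symm.trans h1) with rfl | rfl
    · right; ring
    · exfalso
      rcases h2 with h2 | h2 | h2
      · have := key 1 2 (by linear_combination h2); norm_num at this
      · have := key 5 4 (by linear_combination h2 - hs); norm_num at this
      · have := key 60 36 (by linear_combination h2 - (s ^ 2 + 9 * s + 31) * hs); norm_num at this
  · have h3 : (p - s) * (p - (1 - s)) * ((p + s) * (p - (s - 1))) = 0 := by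
      linear_combination h1 - (p ^ 2 * 2 - s ^ 2 + s - 1) * hs
    rcases mul_eq_zero.1 h3 with h4 | h4 <;> rcases mul_eq_zero.1 h4 with h5 | h5
    · exact Or.inl (sub_eq_zero.1 h5)
    · exfalso
      have hp : p = 1 - s := sub_eq_zero.1 h5
      subst hp
      rcases h2 with h2 | h2 | h2
      · have := key 2 0 (by linear_combination h2); norm_num at this
      · have := key 4 3 (by linear_combination h2 - 4 * hs); norm_num at this
      · have := key 36 21 (by linear_combination h2 - (16 * s ^ 2 + 16 * s + 20) * hs)
        norm_num at this
    · exfalso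
      have hp : p = -s := eq_neg_of_add_eq_zero_left h5
      subst hp
      rcases h2 with h2 | h2 | h2
      · have := key 2 1 (by linear_combination h2); norm_num at this
      · have := key 8 4 (by linear_combination h2 - 4 * hs); norm_num at this
      · have := key 120 75 (by linear_combination h2 - (16 * s ^ 2 + 48 * s + 76) * hs)
        norm_num at this
    · exfalso
      have hp : p = s - 1 := sub_eq_zero.1 h5
      subst hp
      have h6 : s + 1 - (s - 1) = 2 := by ring
      rw [h6] at h2
      norm_num at h2

/-- Generators of a polyhedral group with known traces. -/
lemma IsTriple.exists_poly_pair (h : IsTriple G 2 3 k) (hk : IsPolyIndex k (scal G).index)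
    (hG : ActsFreely G) (hdet : ∀ g : G, (mat g).det ^ (zc G / 2) = 1) {s p : ℂ}
    (hsp : IsPolyTrace k s p) : ∃ x y : G, ¬Commute x y ∧ (mat x).trace = s ∧ (mat x).det = 1 ∧
      (mat y).trace = s ∧ (mat y).det = 1 ∧ (mat (x * y)).trace = p ∧
      ∀ H : Subgroup G, scal G ≤ H → x ∈ H → y ∈ H → H = ⊤ := by
  have hk3 : 3 ≤ k := by rcases hk with h | h | h <;> omega
  obtain ⟨x, hx, hxd, hxt⟩ := h.exists_isPolyGen_trace hk3 hG hdet hsp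
  obtain ⟨g, hg⟩ := exists_conj_not_commute hk hx.notMem hx.relOrd_eq
  have hy := hx.conjugate g
  have hyd : (mat (g * x * g⁻¹)).det = 1 := by rw [det_mat_conj, hxd]
  have hyt : (mat (g * x * g⁻¹)).trace = s := by rw [trace_mat_conj, hxt]
  set y := g * x * g⁻¹ with hydef
  have hinv : ¬Commute x y⁻¹ := fun h' => hg (by simpa using h'.inv_right)
  have hyinvd : (mat y⁻¹).det = 1 := by
    have h1 : (mat y * mat y⁻¹).det = 1 := by rw [mat_mul_inv, Matrix.det_one]
    rwa [Matrix.det_mul, hyd, one_mul] at h1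
  have hyinvt : (mat y⁻¹).trace = s := by
    have h1 := trace_mul_inv 1 y
    rw [one_mul, one_mul, hyd, hyt, mat_one, Matrix.trace_one, Fintype.card_fin] at h1
    rw [h1]
    push_cast
    ring
  have e1 := h.trace_mem hG (mul_notMem_of_not_commute hg) (by
    rw [mat_mul, Matrix.det_mul, hxd, hyd, one_mul])
  have e2 := h.trace_mem hG (mul_notMem_of_not_commute hinv) (by
    rw [mat_mul, Matrix.det_mul, hxd, hyinvd, one_mul])
  have e3 := trace_mul_inv x y
  rw [hxt, hyt, hyd, div_one, ← pow_two] at e3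
  have hfin : (mat (x * y)).trace = p ∨ (mat (x * y⁻¹)).trace = p := by
    rw [e3] at e2 ⊢
    rcases hsp with ⟨rfl, rfl, rfl⟩ | ⟨rfl, hs, rfl⟩ | ⟨rfl, hs, rfl⟩
    · simp only [one_pow] at e2 ⊢
      apply tetra_trace
      · simpa using e1
      · simpa using e2
    · rw [hs] at e2 ⊢
      refine Or.inl (octa_trace ?_ ?_)
      · simpa using e1
      · simpa using e2
    · rw [hs] at e2 ⊢
      apply icosa_trace hs
      · simpa using e1
      · simpa using e2
  rcases hfin with hf | hf
  · exact ⟨x, y, hg, hxt, hxd, hyt, hyd, hf, fun H hZ hxH hyH =>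
      eq_top_of_isPolyGen hk hx hy hg hZ hxH hyH⟩
  · exact ⟨x, y⁻¹, hinv, hxt, hxd, hyinvt, hyinvd, hf, fun H hZ hxH hyH =>
      eq_top_of_isPolyGen hk hx hy.inv hinv hZ hxH hyH⟩

/-- Generators of a tetrahedral group whose number of scalars is divisible by three. -/
lemma IsTriple.exists_tetra_pair (h : IsTriple G 2 3 3) (hk : IsPolyIndex 3 (scal G).index)
    (hG : ActsFreely G) (h3 : 3 ∣ zc G) {η : ℂ} (hη : IsPrimitiveRoot η (3 * zc G)) :
    ∃ x y : G, ¬Commute x y ∧ (mat x).trace = η ∧ (mat x).det = η ^ 2 ∧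
      (mat y).trace = η ∧ (mat y).det = η ^ 2 ∧ (mat (x * y)).trace = η ^ 2 ∧
      ∀ H : Subgroup G, scal G ≤ H → x ∈ H → y ∈ H → H = ⊤ := by
  obtain ⟨hz, hodd⟩ := h.odd_half_zc le_rfl hG
  obtain ⟨a, ha, hak⟩ := h.exists_relOrd (k := 3) (Or.inr (Or.inr rfl))
  rw [← hak] at hη
  obtain ⟨g, P, β, hgen⟩ := hG.exists_isGen ha hη
  obtain ⟨hpg, -⟩ := hgen.isPolyGen ha
  rw [hak] at hpg hη
  obtain ⟨hη0, hβ0⟩ := hgen.ne_zero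
  have hr := hgen.ratio
  rw [hak] at hr
  set r := β / η with hrdef
  have hβ : β = η * r := by rw [hrdef]; field_simp
  have hr3 : r ^ 3 = 1 := hr.pow_eq_one
  have hr2 : r ^ 2 + r + 1 = 0 := by
    have h1 : (r - 1) * (r ^ 2 + r + 1) = 0 := by linear_combination hr3
    exact (mul_eq_zero.1 h1).resolve_left (sub_ne_zero.2 (hr.ne_one (by norm_num)))
  -- Since (-r)⁶ = 1 and 6 divides z, -r is a scalar of G. Multiplying by it turns the eigenvalues
  -- η, ηr into -ηr, -ηr², with sum η and product η².
  obtain ⟨t, ht⟩ : 6 ∣ zc G := Nat.Coprime.mul_dvd_of_dvd_of_dvd (by norm_num) hz.two_dvd h3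
  obtain ⟨m, hm⟩ := (exists_scalar_iff (G := G) (-r)).2 (by
    rw [ht, pow_mul]
    have : (-r) ^ 6 = 1 := by linear_combination (r ^ 3 + 1) * hr3
    rw [this, one_pow])
  have hms : m ∈ scal G := ⟨_, hm⟩
  have hx := hpg.smul hms
  have hxD := (IsDiag.smul_one hgen.diag.det_ne (-r)).mul hgen.diag
  rw [← hm, ← mat_mul] at hxD
  have hxt : (mat (m * g)).trace = η := by
    rw [hxD.trace_eq, hβ]
    linear_combination -η * hr2
  have hxd : (mat (m * g)).det = η ^ 2 := by
    rw [hxD.det_eq, hβ]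
    linear_combination η ^ 2 * hr3
  set x := m * g with hxdef
  obtain ⟨w, hw⟩ := exists_conj_not_commute hk hx.notMem hx.relOrd_eq
  have hy := hx.conjugate w
  have hyd : (mat (w * x * w⁻¹)).det = η ^ 2 := by rw [det_mat_conj, hxd]
  have hyt : (mat (w * x * w⁻¹)).trace = η := by rw [trace_mat_conj, hxt]
  set y := w * x * w⁻¹ with hydef
  have hinv : ¬Commute x y⁻¹ := fun h' => hw (by simpa using h'.inv_right)
  have hxyd : (mat (x * y)).det = η ^ 4 := by rw [mat_mul, Matrix.det_mul, hxd, hyd]; ring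
  have hyinvd : (mat (x * y⁻¹)).det = 1 := by
    have h1 : (mat y * mat y⁻¹).det = 1 := by rw [mat_mul_inv, Matrix.det_one]
    rw [Matrix.det_mul, hyd] at h1
    rw [mat_mul, Matrix.det_mul, hxd, h1]
  have hns := mul_notMem_of_not_commute hw
  have hcube : (x * y) ^ 3 ∈ scal G := by
    have hpow := relOrd_pow_mem hG hns (Commute.refl (x * y))
    rcases h.relOrd_mem hns with e | e | e <;> rw [e] at hpow
    · exfalso
      -- A scalar square would give (η⁴)^(z/2) = η^(2z) = 1, although η has order 3z.
      have h1 := h.det_pow_of_sq le_rfl hG hpow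
      rw [hxyd, ← pow_mul] at h1
      have h2 := hη.dvd_of_pow_eq_one _ h1
      have h4 : 4 * (zc G / 2) = 2 * zc G := by
        have := Nat.mul_div_cancel' hz.two_dvd
        omega
      rw [h4] at h2
      have := Nat.le_of_dvd (Nat.mul_pos two_pos zc_pos) h2
      have := zc_pos (G := G)
      omega
    · exact hpow
    · exact hpow
  have ht1 := (trace_of_pow_mem_scal hns).2.1 hcube
  rw [hxyd] at ht1
  have ht2 := h.trace_mem hG (mul_notMem_of_not_commute hinv) hyinvd
  rw [trace_mul_inv, hxt, hyt, hyd] at ht2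
  have hη2 : η ^ 2 ≠ 0 := pow_ne_zero _ hη0
  have hp : (mat (x * y)).trace = η ^ 2 := by
    have h5 : (mat (x * y)).trace ^ 2 = (η ^ 2) ^ 2 := by rw [ht1]; ring
    rcases sq_eq_sq_iff_eq_or_eq_neg.1 h5 with h6 | h6
    · exact h6
    · exfalso
      -- With the minus sign the nonscalar element xy⁻¹ of determinant one would have trace 2, which
      -- is not in the list.
      rw [h6, ← pow_two, sub_neg_eq_add, ← two_mul, mul_div_assoc, div_self hη2] at ht2
      norm_num at ht2
  exact ⟨x, y, hw, hxt, hxd, hyt, hyd, hp, fun H hZ hxH hyH =>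
    eq_top_of_isPolyGen hk hx hy hw hZ hxH hyH⟩

/-- Unless the group is tetrahedral with 3 ∣ z, every determinant is the square of a scalar of the
group. Generators can then be rescaled to determinant one, with traces depending only on k. In the
exceptional case they are normalized by a primitive root of unity of order 3z. -/
theorem nonempty_mulEquiv_of_polyhedral {G' : Subgroup U2} [Finite G'] (hG : ActsFreely G)
    (hG' : ActsFreely G') (h : IsTriple G 2 3 k) (h' : IsTriple G' 2 3 k)
    (hk : IsPolyIndex k (scal G).index) (hk' : IsPolyIndex k (scal G').index)
    (hz : zc G = zc G') (hcard : Nat.card G = Nat.card G') : Nonempty (G ≃* G') := by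
  have hk3 : k = 3 ∨ k = 4 ∨ k = 5 := by rcases hk with h | h | h <;> omega
  by_cases hex : k = 3 → ¬3 ∣ zc G
  · obtain ⟨s, p, hsp⟩ : ∃ s p, IsPolyTrace k s p := by
      rcases hk3 with rfl | rfl | rfl
      · exact ⟨1, 1, Or.inl ⟨rfl, rfl, rfl⟩⟩
      · obtain ⟨s, hs⟩ := IsAlgClosed.exists_pow_nat_eq (2 : ℂ) (n := 2) (by norm_num)
        exact ⟨s, 1, Or.inr (Or.inl ⟨rfl, hs, rfl⟩)⟩
      · obtain ⟨s, hs⟩ := IsAlgClosed.exists_pow_nat_eq (5 : ℂ) (n := 2) (by norm_num)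
        exact ⟨(1 + s) / 2, (1 + s) / 2, Or.inr (Or.inr ⟨rfl, by linear_combination hs / 4, rfl⟩)⟩
    obtain ⟨x, y, h1, h2, h3, h4, h5, h6, h7⟩ :=
      h.exists_poly_pair hk hG (h.det_pow_eq_one hk3 hG hex) hsp
    obtain ⟨x', y', h1', h2', h3', h4', h5', h6', -⟩ :=
      h'.exists_poly_pair hk' hG' (h'.det_pow_eq_one hk3 hG' (by rwa [← hz])) hsp
    obtain ⟨R, hR, hRx, hRy⟩ := exists_conj hG hG' h1 h1' (by rw [h2, h2']) (by rw [h3, h3'])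
      (by rw [h4, h4']) (by rw [h5, h5']) (by rw [h6, h6'])
    exact nonempty_mulEquiv_of_conj hcard hz hR hRx hRy h7
  · push Not at hex
    obtain ⟨rfl, h3⟩ := hex
    have hη := Complex.isPrimitiveRoot_exp (3 * zc G)
      (Nat.mul_ne_zero (by norm_num) zc_pos.ne')
    obtain ⟨x, y, h1, h2, h3, h4, h5, h6, h7⟩ := h.exists_tetra_pair hk hG h3 hη
    rw [hz] at hη
    obtain ⟨x', y', h1', h2', h3', h4', h5', h6', -⟩ :=
      h'.exists_tetra_pair hk' hG' (by rwa [← hz]) hη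
    obtain ⟨R, hR, hRx, hRy⟩ := exists_conj hG hG' h1 h1' (by rw [h2, h2', hz])
      (by rw [h3, h3', hz]) (by rw [h4, h4', hz]) (by rw [h5, h5', hz]) (by rw [h6, h6', hz])
    exact nonempty_mulEquiv_of_conj hcard hz hR hRx hRy h7

end PolyhedralIso

/-! ### The isomorphism class from the spectrum -/

section Low

variable {G : Subgroup U2}

lemma specMult_two (G : Subgroup U2) : specMult G 2 = Module.finrank ℂ (semiInv G 2 1) +
    Module.finrank ℂ (semiInv G 2 2) := by
  have h : Nat.divisors 2 = {1, 2} := by decide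
  rw [specMult, h, Finset.sum_pair (by norm_num)]
  rfl

lemma specMult_four (G : Subgroup U2) : specMult G 4 = Module.finrank ℂ (semiInv G 4 1) +
    (Module.finrank ℂ (semiInv G 3 2) + Module.finrank ℂ (semiInv G 4 4)) := by
  have h : Nat.divisors 4 = {1, 2, 4} := by decide
  rw [specMult, h, Finset.sum_insert (by norm_num), Finset.sum_pair (by norm_num)]
  rfl

lemma specMult_six (G : Subgroup U2) : specMult G 6 = Module.finrank ℂ (semiInv G 6 1) +
    (Module.finrank ℂ (semiInv G 4 2) + (Module.finrank ℂ (semiInv G 4 3) +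
      Module.finrank ℂ (semiInv G 6 6))) := by
  have h : Nat.divisors 6 = {1, 2, 3, 6} := by decide
  rw [specMult, h, Finset.sum_insert (by norm_num), Finset.sum_insert (by norm_num),
    Finset.sum_pair (by norm_num)]
  rfl

lemma semiInv_congr_of_det (h : ∀ g : G, (mat g).det = 1) (n q q' : ℕ) :
    semiInv G n q = semiInv G n q' := by
  ext F
  refine and_congr_right fun _ => forall₂_congr fun g hg => ?_
  have h1 : (g : M2).det = 1 := h ⟨g, hg⟩
  rw [h1, one_pow, one_pow]

lemma IsGen.pow_four_of_relOrd_two {a g : G} {P : M2} {α β : ℂ} (h : IsGen a g P α β)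
    (hz : zc G = 4) (ha : relOrd a = 2) : β = -α ∧ α ^ 4 = -1 := by
  have hr := h.ratio
  have hl := h.left
  rw [ha] at hr
  rw [ha, hz] at hl
  have h1 := hr.eq_neg_one_of_two_right
  rw [div_eq_iff h.ne_zero.1] at h1
  refine ⟨by rw [h1]; ring, ?_⟩
  have h2 : (α ^ 4) ^ 2 = 1 := by rw [← pow_mul]; exact hl.pow_eq_one
  exact (mul_self_eq_one_iff.1 ((pow_two _).symm.trans h2)).resolve_left
    (hl.pow_ne_one_of_pos_of_lt (by norm_num) (by norm_num))

end Low

/-! ### Commutative groups -/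

section Abelian

variable {G : Subgroup U2}

open MvPolynomial

lemma exists_simultaneous_diag (hab : ∀ a b : G, Commute a b) :
    ∃ P : M2, P.det ≠ 0 ∧ ∀ g : G, ∃ γ δ, IsDiag P (mat g) γ δ := by
  by_cases h : ∃ a : G, a ∉ scal G
  · obtain ⟨a, ha⟩ := h
    obtain ⟨P, α, β, hD, -, -⟩ := exists_isDiag_mat a
    exact ⟨P, hD.det_ne, fun g =>
      hD.exists_of_commute (hD.ne_of_notMem ha) ((commute_iff_mat _ _).1 (hab a g))⟩
  · push Not at h
    refine ⟨1, by simp, fun g => ?_⟩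
    obtain ⟨c, hc⟩ := h g
    exact ⟨c, c, by rw [hc]; exact IsDiag.smul_one (by simp) c⟩

lemma isCyclic_of_commute [Finite G] (hG : ActsFreely G) (hab : ∀ a b : G, Commute a b) :
    IsCyclic G := by
  obtain ⟨P, hP, h⟩ := exists_simultaneous_diag hab
  choose γ δ hγ using h
  let f : G →* ℂ :=
    { toFun := γ
      map_one' := ((hγ 1).unique (by simpa [mat_one] using IsDiag.smul_one hP 1)).1
      map_mul' := fun a b => ((hγ (a * b)).unique (by
        rw [mat_mul]; exact (hγ a).mul (hγ b))).1 }
  refine isCyclic_of_injective_ringHom f fun a b hab => ?_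
  have h1 : γ a = γ b := hab
  have h2 := hγ b
  rw [← h1] at h2
  exact hG.eq_of_left (hγ a) h2

/-- In a common eigenbasis the product of the two coordinates is a form of degree 2 on which G acts
by the determinant. As noncommutative groups have no eigenvalue here, m = 2 detects commutativity.
-/
lemma specMult_two_pos_of_commute (hab : ∀ a b : G, Commute a b) : 0 < specMult G 2 := by
  obtain ⟨P, hP, h⟩ := exists_simultaneous_diag hab
  have hu := isUnit_iff_ne_zero.2 hP
  set E : MvPolynomial (Fin 2) ℂ := monomial (Finsupp.single 0 1 + Finsupp.single 1 1) 1 with hE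
  have hEh : E.IsHomogeneous 2 := isHomogeneous_monomial _ (by simp)
  have hmem : formComp P⁻¹ E ∈ semiInv G 2 1 := by
    refine ⟨formComp_isHomogeneous _ hEh, fun g hg => ?_⟩
    obtain ⟨γ, δ, hD⟩ := h ⟨g, hg⟩
    have h1 : P⁻¹ * (g : M2) = Matrix.diagonal ![γ, δ] * P⁻¹ := by
      have h2 : (g : M2) = P * Matrix.diagonal ![γ, δ] * P⁻¹ := hD.eq_conj
      rw [h2, mul_assoc P, Matrix.nonsing_inv_mul_cancel_left _ _ hu]
    have h3 : (g : M2).det = γ * δ := hD.det_eq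
    rw [← formComp_mul, h1, formComp_mul, hE, formComp_diagonal_monomial, map_smul, h3]
    simp
  have hne : formComp P⁻¹ E ≠ 0 := by
    intro h0
    have h1 : formComp P (formComp P⁻¹ E) = E := by
      rw [← formComp_mul, Matrix.nonsing_inv_mul _ hu, formComp_one]
    rw [h0, map_zero, hE, eq_comm, monomial_eq_zero] at h1
    exact one_ne_zero h1
  have : Nontrivial (semiInv G 2 1) := ⟨⟨⟨_, hmem⟩, 0, fun h => hne (congrArg Subtype.val h)⟩⟩
  rw [specMult_two]
  exact Nat.add_pos_left Module.finrank_pos _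

end Abelian

/-! ### Noncommutative groups: dihedral and polyhedral types -/

section Nonabelian

variable {G : Subgroup U2} [Finite G]

lemma zc_mul_index (G : Subgroup U2) [Finite G] : zc G * (scal G).index = Nat.card G :=
  (scal G).card_mul_index

lemma two_mul_card_centralizer {a : G} (ha : a ∉ scal G)
    (hi : (scal G).index = 2 * relOrd a) : 2 * Nat.card (Subgroup.centralizer {a}) = Nat.card G := by
  rw [← relOrd_mul_zc ha, ← zc_mul_index, hi]
  ring

/-- The groups with dihedral image in `PU(2)`. -/
structure IsDihedralType (G : Subgroup U2) [Finite G] (n : ℕ) : Prop where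
  triple : IsTriple G 2 2 n
  index : (scal G).index = 2 * n

/-- The groups with tetrahedral, octahedral or icosahedral image in `PU(2)`. -/
structure IsPolyhedralType (G : Subgroup U2) [Finite G] (k : ℕ) : Prop where
  triple : IsTriple G 2 3 k
  index : IsPolyIndex k (scal G).index

lemma exists_type (hn : ∃ a b : G, ¬Commute a b) :
    (∃ n, IsDihedralType G n) ∨ ∃ k, IsPolyhedralType G k := by
  obtain ⟨k₁, k₂, k₃, h, ⟨rfl, rfl, hi⟩ | ⟨rfl, rfl, hi⟩⟩ := exists_isTriple hn
  · exact Or.inl ⟨k₃, h, hi⟩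
  · exact Or.inr ⟨k₃, h, hi⟩

namespace IsDihedralType

variable {n : ℕ} (h : IsDihedralType G n)
include h

lemma exists_generic : ∃ a : G, a ∉ scal G ∧ relOrd a = n ∧
    2 * Nat.card (Subgroup.centralizer {a}) = Nat.card G := by
  obtain ⟨a, ha, hn⟩ := h.triple.exists_relOrd (k := n) (Or.inr (Or.inr rfl))
  exact ⟨a, ha, hn, two_mul_card_centralizer ha (by rw [hn, h.index])⟩

lemma two_le : 2 ≤ n := by
  obtain ⟨a, ha, rfl, -⟩ := h.exists_generic
  exact two_le_relOrd ha

lemma even_zc (hG : ActsFreely G) : Even (zc G) := by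
  obtain ⟨a, ha, -, hidx⟩ := h.exists_generic
  obtain ⟨y, hy⟩ := exists_not_commute hidx
  exact (trace_eq_zero_of_not_commute hG hidx hy).1

lemma coprime (hG : ActsFreely G) : Nat.Coprime n (zc G / 2) := by
  obtain ⟨a, ha, rfl, hidx⟩ := h.exists_generic
  exact coprime_relOrd hG hidx ha

lemma det_eq_one (hG : ActsFreely G) (hz : zc G = 2) (g : G) : (mat g).det = 1 := by
  obtain ⟨a, ha, -, hidx⟩ := h.exists_generic
  by_cases hg : Commute a g
  · simpa [hz] using det_pow_of_commute hG hidx hg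
  · have h1 := (trace_eq_zero_of_not_commute hG hidx hg).2.2
    simpa [hz] using h1

lemma finrank_four_two_pos (hG : ActsFreely G) : 0 < Module.finrank ℂ (semiInv G 4 2) := by
  have h1 : 2 * Module.finrank ℂ (semiInv G 4 2) + 5 = _ :=
    h.triple.two_mul_finrank_center hG 2
  have h2 : centDim 2 2 = 3 := by decide
  have h3 : 1 ≤ centDim 2 n := by
    rw [centDim, Nat.succ_le_iff, Finset.card_pos]
    exact ⟨2, Finset.mem_filter.2 ⟨by decide, rfl⟩⟩
  omega

end IsDihedralType

namespace IsPolyhedralType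

variable {k : ℕ} (h : IsPolyhedralType G k)
include h

lemma cases : k = 3 ∨ k = 4 ∨ k = 5 := by
  obtain ⟨rfl, -⟩ | ⟨rfl, -⟩ | ⟨rfl, -⟩ := h.index <;> simp

lemma even_zc (hG : ActsFreely G) : Even (zc G) :=
  (h.triple.odd_half_zc (by have := h.cases; omega) hG).1

lemma odd_half_zc (hG : ActsFreely G) : Odd (zc G / 2) :=
  (h.triple.odd_half_zc (by have := h.cases; omega) hG).2

lemma det_eq_one (hG : ActsFreely G) (hz : zc G = 2) (g : G) : (mat g).det = 1 := by
  simpa [hz] using h.triple.det_pow_eq_one h.cases hG (fun _ => by rw [hz]; norm_num) g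

lemma finrank_four_two (hG : ActsFreely G) : Module.finrank ℂ (semiInv G 4 2) = 0 := by
  have h1 : 2 * Module.finrank ℂ (semiInv G 4 2) + 5 = _ :=
    h.triple.two_mul_finrank_center hG 2
  have h2 : centDim 2 2 = 3 := by decide
  have h3 : centDim 2 3 = 1 := by decide
  have h4 : centDim 2 k = 1 := centDim_of_lt (by have := h.cases; omega)
  omega

end IsPolyhedralType

/-- For q = 1 all three centralizer terms equal 1 and the dimension formula reads 2d + 3 = 3. For q
= 2 the weight is -2: either z does not divide it, or z = 2 and all determinants are 1, so that the
exponent q is irrelevant. -/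
lemma specMult_two_of_not_commute (hG : ActsFreely G) (hn : ∃ a b : G, ¬Commute a b) :
    specMult G 2 = 0 := by
  have key : ∀ k₁ k₂ k₃, IsTriple G k₁ k₂ k₃ → 1 < k₁ → 1 < k₂ → 1 < k₃ →
      Module.finrank ℂ (semiInv G 2 1) = 0 := by
    intro k₁ k₂ k₃ h h1 h2 h3
    have : 2 * Module.finrank ℂ (semiInv G 2 1) + 3 = _ := h.two_mul_finrank_center hG 1
    rw [centDim_of_lt h1, centDim_of_lt h2, centDim_of_lt h3] at this
    omega
  have h21 : Module.finrank ℂ (semiInv G 2 1) = 0 := by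
    obtain ⟨n, h⟩ | ⟨k, h⟩ := exists_type hn
    · exact key _ _ _ h.triple (by norm_num) (by norm_num) h.two_le
    · exact key _ _ _ h.triple (by norm_num) (by norm_num) (by have := h.cases; omega)
  have hz : Even (zc G) := by
    obtain ⟨n, h⟩ | ⟨k, h⟩ := exists_type hn
    · exact h.even_zc hG
    · exact h.even_zc hG
  rw [specMult_two, h21, zero_add]
  by_cases hz2 : zc G = 2
  · have hdet : ∀ g : G, (mat g).det = 1 := by
      obtain ⟨n, h⟩ | ⟨k, h⟩ := exists_type hn
      · exact h.det_eq_one hG hz2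
      · exact h.det_eq_one hG hz2
    rw [semiInv_congr_of_det hdet 2 2 1, h21]
  · apply finrank_semiInv_eq_zero
    intro hd
    norm_num at hd
    have h1 : zc G ∣ 2 := by exact_mod_cast hd
    obtain ⟨j, hj⟩ := hz
    have h2 := Nat.le_of_dvd (by norm_num) h1
    have := zc_pos (G := G)
    omega

end Nonabelian

/-! ### Dihedral groups with four scalars -/

section BinaryDihedral

variable {G : Subgroup U2} [Finite G] {n : ℕ}

lemma cycDim_neg_four {α : ℂ} (h : α ^ 4 = -1) : cycDim α (-α) 4 4 = 2 := by
  rw [cycDim, show 2 = ((Finset.range 5).filter fun i => i % 2 = 1).card by decide]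
  congr 1
  refine Finset.filter_congr fun i hi => ?_
  have h1 : (α * -α) ^ 4 = 1 := by linear_combination (α ^ 4 - 1) * h
  rw [Finset.mem_range] at hi
  have h2 : α ^ i * (-α) ^ (4 - i) = -(-1) ^ i := by
    interval_cases i <;> norm_num <;> first | linear_combination h | linear_combination -h
  rw [h1, h2]
  interval_cases i <;> norm_num

lemma cycDim_neg_six {α : ℂ} (h : α ^ 4 = -1) : cycDim α (-α) 6 1 = 4 := by
  rw [cycDim, show 4 = ((Finset.range 7).filter fun i => i % 2 = 0).card by decide]
  congr 1
  refine Finset.filter_congr fun i hi => ?_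
  have h0 : α ^ 2 ≠ 0 := fun h0 => by
    have : α ^ 4 = 0 := by linear_combination α ^ 2 * h0
    rw [h] at this
    norm_num at this
  have h1 : (α * -α) ^ 1 = -α ^ 2 := by ring
  rw [Finset.mem_range] at hi
  have h2 : α ^ i * (-α) ^ (6 - i) = (-1) ^ i * -α ^ 2 := by
    interval_cases i <;> norm_num <;>
      first | linear_combination α ^ 2 * h | linear_combination -α ^ 2 * h
  rw [h1, h2, mul_eq_right₀ (neg_ne_zero.2 h0)]
  interval_cases i <;> norm_num

lemma specMult_six_of_zc_eq_four (hz : zc G = 4) : specMult G 6 =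
    Module.finrank ℂ (semiInv G 6 1) + Module.finrank ℂ (semiInv G 4 2) := by
  rw [specMult_six, finrank_semiInv_eq_zero (n := 4) (q := 3),
    finrank_semiInv_eq_zero (n := 6) (q := 6)]
  · rfl
  · rw [hz]; norm_num
  · rw [hz]; norm_num

namespace IsDihedralType

variable (h : IsDihedralType G n) (hG : ActsFreely G) (hz : zc G = 4)
include h hG hz

lemma det_sq_of_isGen {a g : G} {P : M2} {α β : ℂ} (ha : a ∉ scal G) (hgen : IsGen a g P α β)
    (hn : relOrd a = n) : (α * β) ^ 2 = 1 := by
  have h1 := det_pow_of_commute hG (two_mul_card_centralizer ha (by rw [hn, h.index])) hgen.comm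
  rwa [hz, hgen.diag.det_eq] at h1

lemma odd_and_three_le : Odd n ∧ 3 ≤ n := by
  have h1 := h.coprime hG
  rw [hz, Nat.coprime_comm, Nat.coprime_two_left] at h1
  have h2 := h.two_le
  obtain ⟨j, rfl⟩ := h1
  exact ⟨⟨j, rfl⟩, by omega⟩

/-- The centralizers of relative order 2 have α⁴ = -1 and contribute 2 each. For the generic one
(αβ)² = 1 allows q = 4 to be replaced by 2, with contribution 1. Hence 2d + 5 = 2 + 2 + 1; similarly
`finrank_six_one` is 2d + 7 = 4 + 4 + 3. -/
lemma finrank_four_four : Module.finrank ℂ (semiInv G 4 4) = 0 := by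
  obtain ⟨hodd, h3⟩ := h.odd_and_three_le hG hz
  have key := h.triple.two_mul_finrank hG (n := 4) (q := 4) (by rw [hz]; norm_num)
    (fun c => if c = 2 then 2 else 1) (by
      intro a g P α β ha hgen
      by_cases ha2 : relOrd a = 2
      · obtain ⟨rfl, h4⟩ := hgen.pow_four_of_relOrd_two hz ha2
        rw [if_pos ha2, cycDim_neg_four h4]
      · have han := (h.triple.relOrd_mem ha).resolve_left ha2 |>.resolve_left ha2
        have hd := h.det_sq_of_isGen hG hz ha hgen han
        rw [if_neg ha2, ← centDim_of_lt (l := 2) (c := relOrd a) (by omega),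
          ← hgen.cycDim_center 2, cycDim, cycDim,
          show (α * β) ^ 4 = (α * β) ^ 2 by linear_combination (α * β) ^ 2 * hd])
  rw [if_pos rfl, if_neg (by omega)] at key
  omega

lemma finrank_six_one (hn : n = 3) : Module.finrank ℂ (semiInv G 6 1) = 2 := by
  subst hn
  have key := h.triple.two_mul_finrank hG (n := 6) (q := 1) (by rw [hz]; norm_num)
    (fun c => if c = 2 then 4 else 3) (by
      intro a g P α β ha hgen
      by_cases ha2 : relOrd a = 2
      · obtain ⟨rfl, h4⟩ := hgen.pow_four_of_relOrd_two hz ha2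
        rw [if_pos ha2, cycDim_neg_six h4]
      · have han := (h.triple.relOrd_mem ha).resolve_left ha2 |>.resolve_left ha2
        have hd := h.det_sq_of_isGen hG hz ha hgen han
        rw [if_neg ha2, show 3 = centDim 3 (relOrd a) by rw [han]; decide,
          ← hgen.cycDim_center 3, cycDim, cycDim,
          show (α * β) ^ 1 = (α * β) ^ 3 by linear_combination -(α * β) * hd])
  rw [if_pos rfl, if_neg (by omega)] at key
  omega

lemma specMult_four_eq_zero : specMult G 4 = 0 := by
  rw [specMult_four, h.finrank_four_four hG hz, finrank_semiInv_eq_zero, finrank_semiInv_eq_zero]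
  · rw [hz]; norm_num
  · rw [hz]; norm_num

lemma finrank_four_two_of_zc_eq_four : Module.finrank ℂ (semiInv G 4 2) = 1 := by
  have h3 := (h.odd_and_three_le hG hz).2
  have h1 : 2 * Module.finrank ℂ (semiInv G 4 2) + 5 = _ :=
    h.triple.two_mul_finrank_center hG 2
  have h2 : centDim 2 2 = 3 := by decide
  have h4 : centDim 2 n = 1 := centDim_of_lt (by omega)
  omega

end IsDihedralType

end BinaryDihedral

/-! ### Comparison of the types and conclusion -/

section Comparison

variable {G G' : Subgroup U2} [Finite G] [Finite G']

lemma specMult_four_of_zc_eq_two (hz : zc G = 2) (hdet : ∀ g : G, (mat g).det = 1) :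
    specMult G 4 = 2 * Module.finrank ℂ (semiInv G 4 2) := by
  rw [specMult_four, semiInv_congr_of_det hdet 4 1 2, semiInv_congr_of_det hdet 4 4 2,
    finrank_semiInv_eq_zero (n := 3) (q := 2)]
  · ring
  · rw [hz]; norm_num

lemma IsDihedralType.specMult_four_pos {n : ℕ} (h : IsDihedralType G n) (hG : ActsFreely G)
    (hz : zc G = 2) : 0 < specMult G 4 := by
  rw [specMult_four_of_zc_eq_two hz (h.det_eq_one hG hz)]
  have := h.finrank_four_two_pos hG
  omega

lemma IsPolyhedralType.specMult_six_of_zc_eq_two {k : ℕ} (h : IsPolyhedralType G k)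
    (hG : ActsFreely G) (hz : zc G = 2) :
    specMult G 6 = 2 * Module.finrank ℂ (semiInv G 6 3) := by
  have hdet := h.det_eq_one hG hz
  rw [specMult_six, semiInv_congr_of_det hdet 6 1 3, semiInv_congr_of_det hdet 6 6 3,
    semiInv_congr_of_det hdet 4 3 2, h.finrank_four_two hG]
  ring

/-- Dihedral and polyhedral groups with the same scalars are distinguished by the spectrum. -/
lemma not_dihedral_polyhedral (hG : ActsFreely G) (hG' : ActsFreely G') (hz : zc G = zc G')
    (hs : ∀ m, 0 < m → specMult G m = specMult G' m) {n k : ℕ} (h : IsDihedralType G n)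
    (h' : IsPolyhedralType G' k) : False := by
  have hcard := card_eq_of_specMult_eq hs
  rw [← zc_mul_index G, ← zc_mul_index G', hz] at hcard
  have hidx := Nat.eq_of_mul_eq_mul_left zc_pos hcard
  rw [h.index] at hidx
  -- Equal orders give 2n = 12, 24 or 60. By coprimality of n and z/2, the odd number z/2 is prime
  -- to 3, so z = 2 or z ≥ 10.
  have h3 : 3 ∣ n := by
    obtain ⟨-, hi⟩ | ⟨-, hi⟩ | ⟨-, hi⟩ := h'.index <;> omega
  have hodd := h'.odd_half_zc hG'
  have heven := (h'.even_zc hG').two_dvd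
  have h3z : ¬3 ∣ zc G' / 2 := by
    intro hd
    have := h.coprime hG
    rw [hz] at this
    have := Nat.dvd_gcd h3 hd
    rw [Nat.Coprime] at *
    omega
  by_cases hz2 : zc G' = 2
  · have h1 := h.specMult_four_pos hG (hz.trans hz2)
    rw [hs 4 (by norm_num), specMult_four_of_zc_eq_two hz2 (h'.det_eq_one hG' hz2),
      h'.finrank_four_two hG'] at h1
    omega
  · have hpos := zc_pos (G := G')
    have h10 : 10 ≤ zc G' := by
      obtain ⟨j, hj⟩ := hodd
      omega
    have h6 : ∀ i : ℤ, i ≠ 0 → |i| < 10 → ¬(zc G' : ℤ) ∣ i := fun i hi hi' hd => by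
      have := Int.le_of_dvd (abs_pos.2 hi) ((dvd_abs _ _).2 hd)
      omega
    have h1 := h.finrank_four_two_pos hG
    have h2 := hs 6 (by norm_num)
    -- For z ≥ 10 only weight zero survives at m = 6, namely degree 4 with q = 2. It vanishes in the
    -- polyhedral case and is positive in the dihedral one.
    have h5 : specMult G' 6 = 0 := by
      rw [specMult_six, h'.finrank_four_two hG', finrank_semiInv_eq_zero (n := 6) (q := 1),
        finrank_semiInv_eq_zero (n := 4) (q := 3), finrank_semiInv_eq_zero (n := 6) (q := 6)]
      all_goals exact h6 _ (by norm_num) (by norm_num)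
    rw [h5, specMult_six] at h2
    omega

/-- The spectrum distinguishes the groups of scalars of order two and four. -/
lemma not_zc_two_four (hG : ActsFreely G) (hG' : ActsFreely G') (hz : zc G = 2) (hz' : zc G' = 4)
    (hn : ∃ a b : G, ¬Commute a b) (hn' : ∃ a b : G', ¬Commute a b)
    (hs : ∀ m, 0 < m → specMult G m = specMult G' m) : False := by
  have hcard := card_eq_of_specMult_eq hs
  rw [← zc_mul_index G, ← zc_mul_index G', hz, hz'] at hcard
  obtain ⟨n, h'⟩ | ⟨k, h'⟩ := exists_type hn'
  · obtain ⟨hodd, h3⟩ := h'.odd_and_three_le hG' hz'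
    have h42 := h'.finrank_four_two_of_zc_eq_four hG' hz'
    rw [h'.index] at hcard
    have hs4 := hs 4 (by norm_num)
    have hs6 := hs 6 (by norm_num)
    rw [h'.specMult_four_eq_zero hG' hz'] at hs4
    rw [specMult_six_of_zc_eq_four hz', h42] at hs6
    obtain ⟨m, h⟩ | ⟨k, h⟩ := exists_type hn
    · exact (h.specMult_four_pos hG hz).ne' hs4
    · rw [h.specMult_six_of_zc_eq_two hG hz] at hs6
      have h63 : 2 * Module.finrank ℂ (semiInv G 6 3) + 7 = _ :=
        h.triple.two_mul_finrank_center hG 3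
      have c2 : centDim 3 2 = 3 := by decide
      have c3 : centDim 3 3 = 3 := by decide
      have c5 : centDim 3 5 = 1 := by decide
      -- Equal orders give N = 4n with n odd, which excludes the octahedral case N = 24. At m = 6
      -- the tetrahedral group has multiplicity 2 against 2 + 1 for G', and the icosahedral one 0
      -- against at least 1.
      obtain ⟨j, hj⟩ := hodd
      obtain ⟨rfl, hi⟩ | ⟨rfl, hi⟩ | ⟨rfl, hi⟩ := h.index
      · have := h'.finrank_six_one hG' hz' (by omega)
        omega
      · omega
      · omega
  · have h1 := h'.odd_half_zc hG'
    rw [hz'] at h1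
    exact absurd h1 (by decide)

lemma even_zc_of_not_commute (hG : ActsFreely G) (hn : ∃ a b : G, ¬Commute a b) :
    Even (zc G) := by
  obtain ⟨n, h⟩ | ⟨k, h⟩ := exists_type hn
  · exact h.even_zc hG
  · exact h.even_zc hG

/-- Among even numbers only 2 has its weight doubled, so it collides with 4 and nothing else. -/
lemma zc_eq_of_scalWeight_eq {z z' : ℕ} (h0 : 0 < z) (h0' : 0 < z') (hz : Even z) (hz' : Even z')
    (h : scalWeight z = scalWeight z') : z = z' ∨ z = 2 ∧ z' = 4 ∨ z = 4 ∧ z' = 2 := by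
  have key : ∀ y, 0 < y → Even y → (y = 2 ∧ scalWeight y = 4 ∨ y ≠ 2 ∧ scalWeight y = y) := by
    intro y hy he
    by_cases h2 : y = 2
    · exact Or.inl ⟨h2, by rw [h2]; rfl⟩
    · refine Or.inr ⟨h2, if_neg fun hd => ?_⟩
      have := Nat.le_of_dvd (by norm_num) hd
      obtain ⟨j, hj⟩ := he
      omega
  have h1 := key z h0 hz
  have h2 := key z' h0' hz'
  omega

lemma nonempty_mulEquiv_of_not_commute (hG : ActsFreely G) (hG' : ActsFreely G')
    (hn : ∃ a b : G, ¬Commute a b) (hn' : ∃ a b : G', ¬Commute a b)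
    (hs : ∀ m, 0 < m → specMult G m = specMult G' m) : Nonempty (G ≃* G') := by
  have hcard := card_eq_of_specMult_eq hs
  rcases zc_eq_of_scalWeight_eq zc_pos zc_pos (even_zc_of_not_commute hG hn)
    (even_zc_of_not_commute hG' hn') (scalWeight_eq_of_specMult_eq hs) with hz | ⟨hz, hz'⟩ | ⟨hz, hz'⟩
  · obtain ⟨n, h⟩ | ⟨k, h⟩ := exists_type hn <;> obtain ⟨n', h'⟩ | ⟨k', h'⟩ := exists_type hn'
    · obtain ⟨a, ha, -, hidx⟩ := h.exists_generic
      obtain ⟨a', ha', -, hidx'⟩ := h'.exists_generic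
      exact nonempty_mulEquiv_of_dihedral hG hG' ha ha' hidx hidx' hz hcard
    · exact (not_dihedral_polyhedral hG hG' hz hs h h').elim
    · exact (not_dihedral_polyhedral hG' hG hz.symm (fun m hm => (hs m hm).symm) h' h).elim
    · have hidx : (scal G).index = (scal G').index := by
        have h1 := hcard
        rw [← zc_mul_index G, ← zc_mul_index G', hz] at h1
        exact Nat.eq_of_mul_eq_mul_left zc_pos h1
      have hk : k = k' := by
        obtain ⟨h1, h2⟩ | ⟨h1, h2⟩ | ⟨h1, h2⟩ := h.index <;>
          obtain ⟨h3, h4⟩ | ⟨h3, h4⟩ | ⟨h3, h4⟩ := h'.index <;> omega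
      subst hk
      exact nonempty_mulEquiv_of_polyhedral hG hG' h.triple h'.triple h.index h'.index hz hcard
  · exact (not_zc_two_four hG hG' hz hz' hn hn' hs).elim
  · exact (not_zc_two_four hG' hG hz' hz hn' hn fun m hm => (hs m hm).symm).elim

/-- Commutativity is read off at m = 2. Commutative groups acting freely are cyclic, so for them the
order suffices. -/
lemma nonempty_mulEquiv_of_specMult_eq (hG : ActsFreely G) (hG' : ActsFreely G')
    (hs : ∀ m, 0 < m → specMult G m = specMult G' m) : Nonempty (G ≃* G') := by
  by_cases hn : ∃ a b : G, ¬Commute a b <;> by_cases hn' : ∃ a b : G', ¬Commute a b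
  · exact nonempty_mulEquiv_of_not_commute hG hG' hn hn' hs
  · push Not at hn'
    have h1 := specMult_two_pos_of_commute hn'
    rw [← hs 2 (by norm_num), specMult_two_of_not_commute hG hn] at h1
    exact absurd h1 (lt_irrefl 0)
  · push Not at hn
    have h1 := specMult_two_pos_of_commute hn
    rw [hs 2 (by norm_num), specMult_two_of_not_commute hG' hn'] at h1
    exact absurd h1 (lt_irrefl 0)
  · push Not at hn hn'
    have := isCyclic_of_commute hG hn
    have := isCyclic_of_commute hG' hn'
    exact ⟨mulEquivOfCyclicCardEq (card_eq_of_specMult_eq hs)⟩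

lemma Isospectral.specMult_eq (h : Isospectral G G') {m : ℕ} (hm : 0 < m) :
    specMult G m = specMult G' m := by
  have h1 := h (2 * m)
  rw [multiplicity_eq G hm, multiplicity_eq G' hm] at h1
  exact Nat.cast_injective h1

end Comparison

end KohnSphere

end

/-- Finite subgroups of `U(2)` acting freely on `S³` whose quotients have the same spectrum of the
Kohn Laplacian (with multiplicities) are isomorphic. -/
theorem theorem1p2 (G G' : Subgroup KohnSphere.U2) [Finite G] [Finite G']
    (hG : KohnSphere.ActsFreely G) (hG' : KohnSphere.ActsFreely G')
    (hspec : KohnSphere.Isospectral G G') :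
    Nonempty (G ≃* G') := by
  exact KohnSphere.nonempty_mulEquiv_of_specMult_eq hG hG' fun _ hm => hspec.specMult_eq hm
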